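/- Let $k$ be an algebraically closed field and let $r,m\ge 2$, $\lambda\ge 1$ be integers such that the characteristic of $k$ divides neither $r$ nor $m$. For $c=(c_{j,i})\in k^{(r-1)\lambda}$ ($1\le j\le r-1$, $1\le i\le\lambda$) put $$h_i(z,w)=z^r+c_{1,i}z^{r-1}w+\cdots+c_{r-1,i}zw^{r-1}+w^r$$ and let $C_{r,\lambda,m}$ be the curve with affine equation $$Y^r=\prod_{i=1}^{\lambda}h_i(X^m,1).$$ Exclude the case $(r,\lambda,m)=(2,1,2)$, in which the curve has genus $1$; in all other cases the genus is at least $2$ for generic $c$. Let $\operatorname{Aut}(C_{r,\lambda,m})$ be the group of $k$-automorphisms of the curve (equivalently, of its function field $k(x,y)$), let $\tau:(X,Y)\mapsto(X,\zeta_rY)$, where $\zeta_r$ is a primitive $r$-th root of unity, and let $\overline{\operatorname{Aut}}(C_{r,\lambda,m})=\operatorname{Aut}(C_{r,\lambda,m})/\langle\tau\rangle$ be the reduced automorphism group. Then for generic $c$, that is, for all $c$ in some nonempty Zariski-open subset of $k^{(r-1)\lambda}$ (depending on $k,r,\lambda,m$), the polynomial $Y^r-\prod_{i}h_i(X^m,1)$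 is irreducible over $k(X)$, the subgroup $\langle\tau\rangle$ is normal in $\operatorname{Aut}(C_{r,\lambda,m})$, and: i) if $r\ge 3$, then $\overline{\operatorname{Aut}}(C_{r,\lambda,m})\cong C_m$, the cyclic group of order $m$; ii) if $r=2$, then $\overline{\operatorname{Aut}}(C_{2,\lambda,m})\cong D_{2m}$, the dihedral group of order $2m$. -/

import Mathlib

noncomputable section

namespace Superelliptic

open Polynomial

/-- The binary form `z^r + c₁ z^(r-1) w + ⋯ + c_(r-1) z w^(r-1) + w^r` of degree `r`, evaluated at
two elements `z`, `w` of a `k`-algebra; the coefficient `c_(j+1)` is `c j`. -/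
def form {k R : Type*} [Field k] [CommRing R] [Algebra k R] {r : ℕ}
    (c : Fin (r - 1) → k) (z w : R) : R :=
  z ^ r + (∑ j : Fin (r - 1), c j • (z ^ (r - 1 - (j : ℕ)) * w ^ ((j : ℕ) + 1))) + w ^ r

/-- The right-hand side `∏ i, h_i(X^m, 1)` of the equation of the curve `C_{r, l, m}`, where the
form `h_i` has the coefficients `c i`. -/
def rhs {k : Type*} [Field k] {r l : ℕ} (m : ℕ) (c : Fin l → Fin (r - 1) → k) : k[X] :=
  ∏ i : Fin l, form (c i) (X ^ m : k[X]) 1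

/-- The polynomial `Y^r - f(x)` in `Y` over the rational function field `k(x)`. -/
def equation {k : Type*} [Field k] (r : ℕ) (f : k[X]) : (RatFunc k)[X] :=
  X ^ r - C (algebraMap k[X] (RatFunc k) f)

/-- The function field `k(x, y)`, `y^r = f(x)`, of the curve `Y^r = f(X)`, as `k(x)[Y]/(Y^r - f(x))`
(a field when `Y^r - f(x)` is irreducible over `k(x)`). -/
abbrev FunctionField {k : Type*} [Field k] (r : ℕ) (f : k[X]) : Type _ :=
  AdjoinRoot (equation r f)

/-- The full automorphism group over `k` of the curve `Y^r = f(X)`: the group of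
`k`-automorphisms of its function field. -/
abbrev AutGroup {k : Type*} [Field k] (r : ℕ) (f : k[X]) : Type _ :=
  FunctionField r f ≃ₐ[k] FunctionField r f

/-- The element `y` of the function field. -/
def yCoord {k : Type*} [Field k] (r : ℕ) (f : k[X]) : FunctionField r f :=
  AdjoinRoot.root (equation r f)

theorem yCoord_pow {k : Type*} [Field k] (r : ℕ) (f : k[X]) :
    yCoord r f ^ r =
      algebraMap (RatFunc k) (FunctionField r f) (algebraMap k[X] (RatFunc k) f) := by
  have h := AdjoinRoot.eval₂_root (equation r f)
  rw [equation, eval₂_sub, eval₂_pow, eval₂_X, eval₂_C, sub_eq_zero] at h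
  exact h

/-- The `k(x)`-algebra endomorphism `y ↦ ζ y` of the function field, for `ζ^r = 1`. -/
def scaleY {k : Type*} [Field k] {r : ℕ} (f : k[X]) (ζ : k) (hζ : ζ ^ r = 1) :
    FunctionField r f →ₐ[RatFunc k] FunctionField r f :=
  AdjoinRoot.liftAlgHom (equation r f) (Algebra.ofId _ _) (ζ • yCoord r f) (by
    have h : (ζ • yCoord r f) ^ r = yCoord r f ^ r := by rw [_root_.smul_pow, hζ, one_smul]
    have e : eval₂ (algebraMap (RatFunc k) (FunctionField r f)) (ζ • yCoord r f)
        (X ^ r - C (algebraMap k[X] (RatFunc k) f)) = 0 := by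
      rw [eval₂_sub, eval₂_pow, eval₂_X, eval₂_C, h, yCoord_pow, sub_self]
    exact e)

theorem scaleY_yCoord {k : Type*} [Field k] {r : ℕ} (f : k[X]) (ζ : k) (hζ : ζ ^ r = 1) :
    scaleY f ζ hζ (yCoord r f) = ζ • yCoord r f := by
  simp [scaleY, yCoord]

theorem scaleY_comp {k : Type*} [Field k] {r : ℕ} (f : k[X]) (ζ ξ : k)
    (hζ : ζ ^ r = 1) (hξ : ξ ^ r = 1) (h : ξ * ζ = 1) :
    (scaleY f ζ hζ).comp (scaleY f ξ hξ) = AlgHom.id (RatFunc k) (FunctionField r f) := by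
  apply AdjoinRoot.algHom_ext
  change scaleY f ζ hζ (scaleY f ξ hξ (yCoord r f)) = yCoord r f
  rw [scaleY_yCoord, ← AlgHom.coe_restrictScalars' k, map_smul, AlgHom.coe_restrictScalars',
    scaleY_yCoord, smul_smul, h, one_smul]

/-- The superelliptic automorphism `τ : (x, y) ↦ (x, ζ y)`, for `ζ^r = 1`. -/
def tau {k : Type*} [Field k] {r : ℕ} (f : k[X]) (ζ : kˣ) (hζ : ζ ^ r = 1) : AutGroup r f :=
  have h₁ : (ζ : k) ^ r = 1 := by rw [← Units.val_pow_eq_pow_val, hζ, Units.val_one]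
  have h₂ : ((ζ⁻¹ : kˣ) : k) ^ r = 1 := by
    rw [← Units.val_pow_eq_pow_val, inv_pow, hζ, inv_one, Units.val_one]
  (AlgEquiv.ofAlgHom (scaleY f ζ h₁) (scaleY f (ζ⁻¹ : kˣ) h₂)
    (scaleY_comp f _ _ _ _ ζ.inv_mul) (scaleY_comp f _ _ _ _ ζ.mul_inv)).restrictScalars k

/-- The group `Q` is the reduced automorphism group `Aut / ⟨τ⟩` of the curve `Y^r = f(X)`, up to
isomorphism; in particular `Y^r = f(X)` is an integral curve and `⟨τ⟩` is a normal subgroup. -/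
def ReducedAutIso {k : Type*} [Field k] (r : ℕ) (f : k[X]) (Q : Type*) [Group Q] : Prop :=
  Irreducible (equation r f) ∧
    ∀ (ζ : kˣ) (hζ : IsPrimitiveRoot ζ r),
      ∃ _ : (Subgroup.zpowers (tau f ζ hζ.pow_eq_one)).Normal,
        Nonempty ((AutGroup r f ⧸ Subgroup.zpowers (tau f ζ hζ.pow_eq_one)) ≃* Q)

/-- The property `Φ` holds for a generic choice of the coefficients `c_{i,j}`: on the
complement of a hypersurface in the affine space of all coefficients, that is, on a nonempty
Zariski-open subset. -/
def Generically {k : Type*} [Field k] {r l : ℕ} (Φ : (Fin l → Fin (r - 1) → k) → Prop) : Prop :=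
  ∃ P : MvPolynomial (Fin l × Fin (r - 1)) k, P ≠ 0 ∧
    ∀ c : Fin l → Fin (r - 1) → k, MvPolynomial.eval (fun ij => c ij.1 ij.2) P ≠ 0 → Φ c

end Superelliptic

end

/-! ### The function field k(x, y), its basis in powers of y, and its integral closure. -/

noncomputable section

namespace Superelliptic

open Polynomial

variable {k : Type*} [Field k] {r : ℕ} {f : k[X]}

/-! Put d = l * m, so that f = ∏ h_i(X^m, 1) has degree r d and is generically separable with
nonzero constant term: the curve is unramified over x = 0 and x = ∞. The argument first shows that
every automorphism acts on x by a Möbius transformation permuting the roots of f, and then that for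
generic coefficients only the obvious transformations do so.

Möbius action. The holomorphic differentials are exactly Σ b_i(x) y^i dx / y^(r-1) with deg b_i <
(r-1-i) d - 1 (`mem_holomorphic_iff`). For a function u, consider the holomorphic differentials
whose product with u is again holomorphic. Multiplication by x leaves many of them, and an
automorphism σ transports this space to the one for σ(x) (`sum_le_finrank_commonMultiples`). If u
genuinely involves y, a comparison of degrees in y makes the space too small
(`finrank_commonMultiples_le`, `sum_counting_lt`); if u is a rational function of x of degree δ, the
space shrinks with δ (`finrank_commonMultiples_algebraMap_le`). Hence σ(x) lies in k(x) and has
degree one (`exists_moebius`). The only numerical failure is r = d = 2, the case of genus one.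
Kummer theory applied to σ(y) then shows that roots of f go to roots of f (`exists_moebius_roots`).
The kernel of the action on x is ⟨τ⟩, so the reduced group is a group of Möbius transformations.

Genericity. Parametrise the coefficients by m-th roots a_{i,j} of the roots of the h_i; the roots of
f are the products of the a_{i,j} with the m-th roots of unity. The parameters are integral over the
ring of coefficients, so a polynomial condition of nonvanishing that holds at one family of roots,
even over an extension field, holds off a hypersurface in coefficient space (`exists_generic`). The
test family consists of constant multiples of powers of t in k(t), with distinct exponents. A Möbius
permutation of the generic roots preserves cross-ratios, hence the same permutation satisfies the
cross-ratio identities of the test family; their degrees in t show that it preserves or reverses the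
order of the exponents (`eq_or_eq_reflect`). Reversal forces r = 2, where each h_i is palindromic
(`eq_zero_of_level_reflect`). So fibres of x ↦ x^m go to themselves or, if r = 2, to their inverses,
which leaves x ↦ u x and x ↦ u / x with u^m = 1 (`moebius_stabilizer`). All these transformations
lift to the curve (`reducedAutIso_zmod`, `reducedAutIso_dihedralGroup`). -/

theorem equation_monic (hr : r ≠ 0) : (equation r f).Monic :=
  monic_X_pow_sub_C _ hr

theorem equation_natDegree : (equation r f).natDegree = r :=
  natDegree_X_pow_sub_C

/-- By Eisenstein's criterion `Y^r - f(x)` is irreducible when `f` is squarefree. -/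
theorem equation_irreducible (hr : r ≠ 0) (hf : Squarefree f) (hdeg : f.natDegree ≠ 0) :
    Irreducible (equation r f) := by
  have hf0 : f ≠ 0 := fun h => hdeg (by simp [h])
  obtain ⟨q, hq, hqf⟩ := WfDvdMonoid.exists_irreducible_factor
    (fun h => hdeg (natDegree_eq_zero_of_isUnit h)) hf0
  have hmap : equation r f = (X ^ r - C f : k[X][X]).map (algebraMap k[X] (RatFunc k)) := by
    simp [equation]
  have hmon : (X ^ r - C f : k[X][X]).Monic := monic_X_pow_sub_C f hr
  rw [hmap, ← hmon.irreducible_iff_irreducible_map_fraction_map]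
  have hdegr : (X ^ r - C f : k[X][X]).degree = r := degree_X_pow_sub_C (Nat.pos_of_ne_zero hr) f
  refine irreducible_of_eisenstein_criterion (P := Ideal.span {q})
    ((Ideal.span_singleton_prime hq.ne_zero).2 hq.prime) ?_ ?_ ?_ ?_ hmon.isPrimitive
  · rw [hmon.leadingCoeff, Ideal.mem_span_singleton]
    exact fun h => hq.not_isUnit (isUnit_of_dvd_one h)
  · intro n hn
    rw [hdegr, Nat.cast_lt] at hn
    rw [coeff_sub, coeff_X_pow, if_neg hn.ne, zero_sub, coeff_C, Ideal.mem_span_singleton]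
    split_ifs
    · exact (dvd_neg).2 hqf
    · simp
  · rw [hdegr]; exact_mod_cast Nat.pos_of_ne_zero hr
  · rw [coeff_sub, coeff_X_pow, if_neg (Ne.symm hr), zero_sub, coeff_C_zero,
      Ideal.span_singleton_pow, Ideal.mem_span_singleton, dvd_neg, sq]
    exact fun h => hq.not_isUnit (hf q h)

/-- The element `x` of the function field. -/
def xCoord (r : ℕ) (f : k[X]) : FunctionField r f :=
  algebraMap (RatFunc k) (FunctionField r f) RatFunc.X

theorem algebraMap_polynomial (p : k[X]) :
    algebraMap k[X] (FunctionField r f) p = aeval (xCoord r f) p := by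
  have h : (Algebra.ofId k[X] (FunctionField r f)).restrictScalars k = aeval (xCoord r f) := by
    apply Polynomial.algHom_ext
    simp only [aeval_X, AlgHom.restrictScalars_apply, Algebra.ofId_apply]
    rw [IsScalarTower.algebraMap_apply k[X] (RatFunc k), RatFunc.algebraMap_X, xCoord]
  exact DFunLike.congr_fun h p

theorem algebraMap_ratFunc_polynomial (p : k[X]) :
    algebraMap (RatFunc k) (FunctionField r f) (algebraMap k[X] (RatFunc k) p) =
      aeval (xCoord r f) p := by
  rw [← algebraMap_polynomial,
    IsScalarTower.algebraMap_apply k[X] (RatFunc k) (FunctionField r f)]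

theorem yCoord_pow_eq_aeval : yCoord r f ^ r = aeval (xCoord r f) f := by
  rw [yCoord_pow, algebraMap_ratFunc_polynomial]

/-- The basis `1, y, …, y^(r-1)` of the function field over `k(x)`. -/
def yBasis (f : k[X]) (hr : r ≠ 0) : Module.Basis (Fin r) (RatFunc k) (FunctionField r f) :=
  (AdjoinRoot.powerBasis' (equation_monic hr)).basis.reindex
    (finCongr (by rw [AdjoinRoot.powerBasis'_dim]; exact equation_natDegree))

theorem yBasis_apply (hr : r ≠ 0) (i : Fin r) : yBasis f hr i = yCoord r f ^ (i : ℕ) := by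
  simp [yBasis, yCoord]

theorem sum_repr (hr : r ≠ 0) (u : FunctionField r f) :
    u = ∑ i : Fin r, (yBasis f hr).repr u i • yCoord r f ^ (i : ℕ) := by
  conv_lhs => rw [← (yBasis f hr).sum_repr u]
  simp [yBasis_apply]

theorem repr_smul_pow (hr : r ≠ 0) (a : RatFunc k) (i j : Fin r) :
    (yBasis f hr).repr (a • yCoord r f ^ (i : ℕ)) j = if i = j then a else 0 := by
  rw [← yBasis_apply hr, map_smul, Module.Basis.repr_self, Finsupp.smul_apply,
    Finsupp.single_apply, smul_eq_mul, mul_ite, mul_one, mul_zero]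

theorem repr_sum (hr : r ≠ 0) (a : Fin r → RatFunc k) (j : Fin r) :
    (yBasis f hr).repr (∑ i : Fin r, a i • yCoord r f ^ (i : ℕ)) j = a j := by
  rw [map_sum, Finsupp.finsetSum_apply]
  simp_rw [repr_smul_pow]
  simp

theorem repr_scaleY (hr : r ≠ 0) {ζ : k} (hζ : ζ ^ r = 1) (u : FunctionField r f) (i : Fin r) :
    (yBasis f hr).repr (scaleY f ζ hζ u) i = ζ ^ (i : ℕ) • (yBasis f hr).repr u i := by
  conv_lhs => rw [sum_repr hr u]
  have h : scaleY f ζ hζ (∑ i : Fin r, (yBasis f hr).repr u i • yCoord r f ^ (i : ℕ)) =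
      ∑ i : Fin r, (ζ ^ (i : ℕ) • (yBasis f hr).repr u i) • yCoord r f ^ (i : ℕ) := by
    rw [map_sum]
    refine Finset.sum_congr rfl fun i _ => ?_
    rw [map_smul, map_pow, scaleY_yCoord, _root_.smul_pow, smul_assoc, smul_comm]
  rw [h, repr_sum]

/-- The component of `u` at `y^i` is an average over the conjugates of `u`. -/
theorem smul_repr_smul_pow (hr : 2 ≤ r) {ζ : k} (hζ : IsPrimitiveRoot ζ r)
    (u : FunctionField r f) (i : Fin r) :
    (r : k) • ((yBasis f (by omega)).repr u i • yCoord r f ^ (i : ℕ)) =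
      ∑ j ∈ Finset.range r, (ζ ^ ((r - i) * j)) •
        scaleY f (ζ ^ j) (by rw [← pow_mul, mul_comm, pow_mul, hζ.pow_eq_one, one_pow]) u := by
  have hr0 : r ≠ 0 := by omega
  apply (yBasis f hr0).repr.injective
  ext n
  rw [← IsScalarTower.algebraMap_smul (RatFunc k) (r : k), map_smul, Finsupp.smul_apply,
    repr_smul_pow, map_sum, Finsupp.finsetSum_apply]
  have h1 : ∀ j ∈ Finset.range r, (yBasis f hr0).repr ((ζ ^ ((r - i) * j)) •
        scaleY f (ζ ^ j) (by rw [← pow_mul, mul_comm, pow_mul, hζ.pow_eq_one, one_pow]) u) n =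
      ((ζ ^ (r - (i : ℕ) + n)) ^ j) • (yBasis f hr0).repr u n := by
    intro j _
    rw [← IsScalarTower.algebraMap_smul (RatFunc k) (ζ ^ ((r - (i : ℕ)) * j)), map_smul,
      Finsupp.smul_apply, repr_scaleY, IsScalarTower.algebraMap_smul, smul_smul, ← pow_mul,
      ← pow_mul, ← pow_add]
    congr 2
    ring
  rw [Finset.sum_congr rfl h1, ← Finset.sum_smul]
  by_cases hin : i = n
  · subst hin
    have : ζ ^ (r - (i : ℕ) + i) = 1 := by
      rw [Nat.sub_add_cancel i.2.le, hζ.pow_eq_one]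
    simp_rw [this, one_pow]
    rw [Finset.sum_const, Finset.card_range, nsmul_one, if_true,
      IsScalarTower.algebraMap_smul]
  · have hne : ζ ^ (r - (i : ℕ) + n) ≠ 1 := by
      intro h
      have := hζ.dvd_of_pow_eq_one _ h
      obtain ⟨c, hc⟩ := this
      have hi := i.2
      have hn := n.2
      have hne : (i : ℕ) ≠ n := fun h => hin (Fin.ext h)
      have : c = 1 := by
        have h1 : r * c < r * 2 := by omega
        have h2 : 0 < r * c := by omega
        have := lt_of_mul_lt_mul_left h1 (Nat.zero_le _)
        have := Nat.pos_of_mul_pos_left h2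
        omega
      subst this
      omega
    have hs : ∑ j ∈ Finset.range r, (ζ ^ (r - (i : ℕ) + n)) ^ j = 0 := by
      have h := geom_sum_mul (ζ ^ (r - (i : ℕ) + n)) r
      rw [pow_right_comm, hζ.pow_eq_one, one_pow, sub_self] at h
      exact (mul_eq_zero.1 h).resolve_right (sub_ne_zero.2 hne)
    rw [hs, if_neg hin, zero_smul, smul_zero]

theorem isIntegral_yCoord (hr : r ≠ 0) : IsIntegral k[X] (yCoord r f) := by
  refine IsIntegral.of_pow (Nat.pos_of_ne_zero hr) ?_
  rw [yCoord_pow_eq_aeval, ← algebraMap_polynomial]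
  exact isIntegral_algebraMap

theorem isIntegral_smul (c : k) {u : FunctionField r f} (hu : IsIntegral k[X] u) :
    IsIntegral k[X] (c • u) := by
  rw [← IsScalarTower.algebraMap_smul k[X]]
  exact hu.smul _

/-- The integral closure of `k[x]` in the function field is `k[x, y]`. -/
theorem repr_eq_algebraMap_of_isIntegral [Fact (Irreducible (equation r f))] (hr : 2 ≤ r)
    {ζ : k} (hζ : IsPrimitiveRoot ζ r) (hrk : (r : k) ≠ 0) (hf : Squarefree f)
    {u : FunctionField r f} (hu : IsIntegral k[X] u) (i : Fin r) :
    ∃ p : k[X], (yBasis f (by omega)).repr u i = algebraMap k[X] (RatFunc k) p := by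
  have hr0 : r ≠ 0 := by omega
  set a := (yBasis f hr0).repr u i with ha
  -- Each component of u is an average of Galois conjugates of u, hence integral; this uses that r
  -- is invertible in k.
  have hint : IsIntegral k[X] (a • yCoord r f ^ (i : ℕ)) := by
    have h : IsIntegral k[X] ((r : k) • (a • yCoord r f ^ (i : ℕ))) := by
      rw [ha, smul_repr_smul_pow hr hζ]
      refine IsIntegral.sum _ fun j _ => isIntegral_smul _ ?_
      exact hu.map ((scaleY f (ζ ^ j)
        (by rw [pow_right_comm, hζ.pow_eq_one, one_pow])).restrictScalars k[X])
    have := isIntegral_smul (r : k)⁻¹ h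
    rwa [smul_smul, inv_mul_cancel₀ hrk, one_smul] at this
  have hpow : IsIntegral k[X] (a ^ r * algebraMap k[X] (RatFunc k) f ^ (i : ℕ)) := by
    have h := hint.pow r
    rw [_root_.smul_pow, pow_right_comm, yCoord_pow, Algebra.smul_def,
      ← map_pow (algebraMap (RatFunc k) (FunctionField r f)) _ (i : ℕ), ← map_mul] at h
    exact (isIntegral_algebraMap_iff (algebraMap (RatFunc k) (FunctionField r f)).injective).1 h
  obtain ⟨P, hP⟩ := IsIntegrallyClosed.isIntegral_iff.1 hpow
  have hi := i.2
  -- With a^r f^i = P a polynomial, (a f)^r = P f^(r-i), so g = a f is a polynomial. Since r - i >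
  -- 0, f divides g^r, and squarefreeness of f gives f ∣ g, so a is a polynomial.
  have hg : IsIntegral k[X] (a * algebraMap k[X] (RatFunc k) f) := by
    refine IsIntegral.of_pow (Nat.pos_of_ne_zero hr0) ?_
    have : (a * algebraMap k[X] (RatFunc k) f) ^ r =
        algebraMap k[X] (RatFunc k) (P * f ^ (r - i)) := by
      rw [map_mul, hP, map_pow, mul_assoc, ← pow_add, Nat.add_sub_cancel' hi.le, mul_pow]
    rw [this]
    exact isIntegral_algebraMap
  obtain ⟨g, hg⟩ := IsIntegrallyClosed.isIntegral_iff.1 hg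
  have hgr : g ^ r = P * f ^ (r - i) := by
    apply RatFunc.algebraMap_injective k
    rw [map_pow, hg, map_mul, hP, map_pow, mul_assoc, ← pow_add, Nat.add_sub_cancel' hi.le, mul_pow]
  have hdvd : f ∣ g := by
    rw [← hf.dvd_pow_iff_dvd hr0, hgr]
    exact Dvd.dvd.mul_left (dvd_pow_self f (by omega)) _
  obtain ⟨p, rfl⟩ := hdvd
  refine ⟨p, ?_⟩
  have hf0 : algebraMap k[X] (RatFunc k) f ≠ 0 := RatFunc.algebraMap_ne_zero hf.ne_zero
  rw [map_mul, mul_comm] at hg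
  exact (mul_right_cancel₀ hf0 hg).symm

theorem exists_eq_sum_of_isIntegral [Fact (Irreducible (equation r f))] (hr : 2 ≤ r)
    {ζ : k} (hζ : IsPrimitiveRoot ζ r) (hrk : (r : k) ≠ 0) (hf : Squarefree f)
    {u : FunctionField r f} (hu : IsIntegral k[X] u) :
    ∃ p : Fin r → k[X], u = ∑ i : Fin r, aeval (xCoord r f) (p i) * yCoord r f ^ (i : ℕ) := by
  choose p hp using fun i => repr_eq_algebraMap_of_isIntegral hr hζ hrk hf hu i
  refine ⟨p, ?_⟩
  conv_lhs => rw [sum_repr (by omega) u]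
  refine Finset.sum_congr rfl fun i _ => ?_
  rw [hp, Algebra.smul_def, algebraMap_ratFunc_polynomial]

theorem transcendental_xCoord [Fact (Irreducible (equation r f))] :
    Transcendental k (xCoord r f) := by
  rw [transcendental_iff_injective]
  intro p q h
  rw [← algebraMap_ratFunc_polynomial, ← algebraMap_ratFunc_polynomial] at h
  exact RatFunc.algebraMap_injective k
    ((algebraMap (RatFunc k) (FunctionField r f)).injective h)

theorem xCoord_ne_zero [Fact (Irreducible (equation r f))] : xCoord r f ≠ 0 := by
  intro h
  exact transcendental_xCoord (k := k) (r := r) (f := f) (h ▸ isAlgebraic_zero)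

theorem yCoord_ne_zero [Fact (Irreducible (equation r f))] (hr : r ≠ 0) (hf : f ≠ 0) :
    yCoord r f ≠ 0 := by
  intro h
  have := yCoord_pow r f
  rw [h, zero_pow hr, eq_comm, map_eq_zero] at this
  exact RatFunc.algebraMap_ne_zero hf this

theorem finiteDimensional (hr : r ≠ 0) : Module.Finite (RatFunc k) (FunctionField r f) :=
  Module.Finite.of_basis (yBasis f hr)

end Superelliptic
end

/-! ### Valuation subrings and the derivations regular at them. -/

noncomputable section

namespace Superelliptic

open Polynomial

/-- A valuation subring `O` of the fraction field of a Dedekind domain `R` contained in `O` is a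
localization of `R`. -/
theorem exists_div_eq_of_mem_valuationSubring {R F : Type*} [CommRing R]
    [IsDedekindDomain R] [Field F] [Algebra R F] [IsFractionRing R F] (O : ValuationSubring F)
    (hR : ∀ a : R, algebraMap R F a ∈ O) {t : F} (ht : t ∈ O) :
    ∃ a b : R, (algebraMap R F b)⁻¹ ∈ O ∧ algebraMap R F b ≠ 0 ∧
      t = algebraMap R F a / algebraMap R F b := by
  let ψ : R →+* O := (algebraMap R F).codRestrict O hR
  -- P is the centre of O on R. If it is nonzero, R localized at P is a discrete valuation ring, so
  -- of the numerator and denominator of t one divides the other there.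
  let P : Ideal R := (IsLocalRing.maximalIdeal O).comap ψ
  have hP : P.IsPrime := Ideal.IsPrime.comap ψ
  have hunit : ∀ s : R, s ∉ P → (algebraMap R F s)⁻¹ ∈ O ∧ algebraMap R F s ≠ 0 := by
    intro s hs
    have hs' : IsUnit (ψ s) := by
      by_contra h
      exact hs ((IsLocalRing.mem_maximalIdeal _).2 h)
    obtain ⟨w, hw⟩ := hs'.exists_right_inv
    have hw' : algebraMap R F s * (w : F) = 1 := congrArg Subtype.val hw
    have hs0 : algebraMap R F s ≠ 0 := left_ne_zero_of_mul_eq_one hw'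
    exact ⟨by rw [inv_eq_of_mul_eq_one_right hw']; exact w.2, hs0⟩
  obtain ⟨a, b, hb, rfl⟩ := IsFractionRing.div_surjective (A := R) t
  have hb0 : b ≠ 0 := nonZeroDivisors.ne_zero hb
  have hbF : algebraMap R F b ≠ 0 := by
    simpa using hb0
  by_cases hP0 : P = ⊥
  · obtain ⟨h1, h2⟩ := hunit b (by rw [hP0]; simpa using hb0)
    exact ⟨a, b, h1, h2, rfl⟩
  have := IsLocalization.AtPrime.isDiscreteValuationRing_of_dedekind_domain R hP0
    (Localization.AtPrime P)
  obtain ⟨c, hc⟩ := ValuationRing.cond (algebraMap R (Localization.AtPrime P) a)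
    (algebraMap R (Localization.AtPrime P) b)
  obtain ⟨e, s, rfl⟩ := IsLocalization.exists_mk'_eq P.primeCompl c
  have hinj : Function.Injective (algebraMap R (Localization.AtPrime P)) :=
    IsLocalization.injective _ P.primeCompl_le_nonZeroDivisors
  obtain ⟨h1, h2⟩ := hunit s s.2
  have key : ∀ u v : R, algebraMap R (Localization.AtPrime P) u *
      IsLocalization.mk' (Localization.AtPrime P) e s = algebraMap R (Localization.AtPrime P) v →
      algebraMap R F u * algebraMap R F e = algebraMap R F v * algebraMap R F s := by
    intro u v h
    have h' := congrArg (· * algebraMap R (Localization.AtPrime P) s) h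
    simp only [mul_assoc] at h'
    rw [IsLocalization.mk'_spec, ← map_mul, ← map_mul] at h'
    rw [← map_mul, ← map_mul, hinj h']
  rcases hc with hc | hc
  · have h := key _ _ hc
    have he0 : algebraMap R F e ≠ 0 := by
      intro h0
      rw [h0, mul_zero] at h
      exact mul_ne_zero hbF h2 h.symm
    refine ⟨s, e, ?_, he0, ?_⟩
    · have : (algebraMap R F e)⁻¹ = algebraMap R F a / algebraMap R F b * (algebraMap R F s)⁻¹ := by
        field_simp
        linear_combination -h
      rw [this]
      exact mul_mem ht h1
    · field_simp
      linear_combination h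
  · have h := key _ _ hc
    refine ⟨e, s, h1, h2, ?_⟩
    field_simp
    linear_combination -h

variable {k : Type*} [Field k] {r : ℕ} {f : k[X]}

/-- Integrality over `k[x]`, relative to a `k`-algebra containing an element `x`. -/
theorem mem_valuationSubring_of_isIntegral {F : Type*} [Field F] [Algebra k[X] F]
    (O : ValuationSubring F) (hO : ∀ p : k[X], algebraMap k[X] F p ∈ O) {u : F}
    (hu : IsIntegral k[X] u) : u ∈ O := by
  let ψ : k[X] →+* O := (algebraMap k[X] F).codRestrict O hO
  obtain ⟨p, hp, hpu⟩ := hu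
  have h : IsIntegral O u := by
    refine ⟨p.map ψ, hp.map ψ, ?_⟩
    rw [eval₂_map]
    exact hpu
  obtain ⟨y, hy⟩ := IsIntegrallyClosed.isIntegral_iff.1 h
  rw [← hy]
  exact y.2

theorem aeval_mem_valuationSubring {F : Type*} [Field F] [Algebra k F] (O : ValuationSubring F)
    (hk : ∀ c : k, algebraMap k F c ∈ O) {x : F} (hx : x ∈ O) (p : k[X]) : aeval x p ∈ O := by
  rw [aeval_eq_sum_range]
  refine sum_mem fun i _ => ?_
  rw [Algebra.smul_def]
  exact mul_mem (hk _) (pow_mem hx _)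

section Field

variable [Fact (Irreducible (equation r f))]

theorem algebraIsSeparable (hr : r ≠ 0) {ζ : k} (hζ : IsPrimitiveRoot ζ r) :
    Algebra.IsSeparable (RatFunc k) (FunctionField r f) := by
  have hirr : Irreducible (X ^ r - C (algebraMap k[X] (RatFunc k) f)) :=
    (Fact.out : Irreducible (equation r f))
  have hζ' : (primitiveRoots r (RatFunc k)).Nonempty :=
    ⟨algebraMap k (RatFunc k) ζ, by
      rw [mem_primitiveRoots (Nat.pos_of_ne_zero hr)]
      exact hζ.map_of_injective (algebraMap k (RatFunc k)).injective⟩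
  have : Fact (Irreducible (X ^ r - C (algebraMap k[X] (RatFunc k) f))) := ⟨hirr⟩
  have := isSplittingField_AdjoinRoot_X_pow_sub_C hζ' hirr
  have := isGalois_of_isSplittingField_X_pow_sub_C hζ' hirr
    (AdjoinRoot (X ^ r - C (algebraMap k[X] (RatFunc k) f)))
  exact this.to_isSeparable

/-- The derivation `d/dx` of the function field. -/
theorem exists_derivation (hr : r ≠ 0) {ζ : k} (hζ : IsPrimitiveRoot ζ r) :
    ∃ D : Derivation k (FunctionField r f) (FunctionField r f), D (xCoord r f) = 1 := by
  have := algebraIsSeparable (f := f) hr hζ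
  have h1 : Algebra.FormallyEtale (RatFunc k) (FunctionField r f) :=
    Algebra.FormallyEtale.of_isSeparable _ _
  have h2 : Algebra.FormallyEtale k[X] (RatFunc k) :=
    Algebra.FormallyEtale.of_isLocalization (nonZeroDivisors k[X])
  have h3 : Algebra.FormallyEtale k[X] (FunctionField r f) :=
    Algebra.FormallyEtale.comp _ (RatFunc k) _
  -- The function field is formally étale over k[x], being a separable extension of a localization,
  -- so its differentials are the base change of those of k[x].
  let e := KaehlerDifferential.tensorKaehlerEquivOfFormallyEtale k k[X] (FunctionField r f)
  let δ : Derivation k k[X] (FunctionField r f) :=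
    (Algebra.linearMap k[X] (FunctionField r f)).compDer derivative'
  let L : TensorProduct k[X] (FunctionField r f) (KaehlerDifferential k k[X]) →ₗ[FunctionField r f]
      FunctionField r f := δ.liftKaehlerDifferential.liftBaseChange (FunctionField r f)
  refine ⟨(L ∘ₗ e.symm.toLinearMap).compDer (KaehlerDifferential.D k (FunctionField r f)), ?_⟩
  have hx : xCoord r f = algebraMap k[X] (FunctionField r f) X := by
    rw [algebraMap_polynomial, aeval_X]
  rw [hx]
  change L (e.symm (KaehlerDifferential.D k (FunctionField r f)
    (algebraMap k[X] (FunctionField r f) X))) = 1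
  rw [KaehlerDifferential.tensorKaehlerEquivOfFormallyEtale_symm_D_algebraMap]
  simp [L, δ]

variable (D : Derivation k (FunctionField r f) (FunctionField r f))

theorem derivation_yCoord :
    (r : FunctionField r f) * yCoord r f ^ (r - 1) * D (yCoord r f) =
      aeval (xCoord r f) (derivative f) * D (xCoord r f) := by
  have h := congrArg D (yCoord_pow_eq_aeval (r := r) (f := f))
  rw [Derivation.leibniz_pow, Derivation.map_aeval] at h
  simp only [nsmul_eq_mul, smul_eq_mul] at h
  rw [mul_assoc, h]

theorem natCast_ne_zero (hrk : (r : k) ≠ 0) : (r : FunctionField r f) ≠ 0 := by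
  rw [← map_natCast (algebraMap k (FunctionField r f))]
  exact (_root_.map_ne_zero _).2 hrk

/-- Differentiating y^r = f(x) gives r y^(r-1) Dy = f'(x) Dx, so Dx determines Dy. Consequently the
derivations form a space of dimension one over the function field, and each is compared with d/dx
through its value at x. -/
theorem derivation_eq_zero (hr : r ≠ 0) (hrk : (r : k) ≠ 0) (hf : f ≠ 0)
    (hD : D (xCoord r f) = 0) : D = 0 := by
  have hy : D (yCoord r f) = 0 := by
    have h := derivation_yCoord D
    rw [hD, mul_zero] at h
    exact (mul_eq_zero.1 h).resolve_left
      (mul_ne_zero (natCast_ne_zero hrk) (pow_ne_zero _ (yCoord_ne_zero hr hf)))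
  have hp : ∀ p : k[X], D (algebraMap (RatFunc k) (FunctionField r f)
      (algebraMap k[X] (RatFunc k) p)) = 0 := by
    intro p
    rw [algebraMap_ratFunc_polynomial, Derivation.map_aeval, hD, smul_zero]
  have hq : ∀ a : RatFunc k, D (algebraMap (RatFunc k) (FunctionField r f) a) = 0 := by
    intro a
    rw [← RatFunc.num_div_denom a, map_div₀, Derivation.leibniz_div, hp, hp]
    simp
  ext u
  rw [sum_repr hr u, map_sum, Derivation.zero_apply]
  refine Finset.sum_eq_zero fun i _ => ?_
  rw [Algebra.smul_def, Derivation.leibniz, Derivation.leibniz_pow, hy, hq]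
  simp

theorem derivation_ext (hr : r ≠ 0) (hrk : (r : k) ≠ 0) (hf : f ≠ 0)
    {D D' : Derivation k (FunctionField r f) (FunctionField r f)}
    (h : D (xCoord r f) = D' (xCoord r f)) : D = D' := by
  rw [← sub_eq_zero]
  refine derivation_eq_zero _ hr hrk hf ?_
  rw [Derivation.sub_apply, h, sub_self]

/-- The regular derivations at a place where `x` is finite. -/
theorem derivation_mem_iff (hr : 2 ≤ r) (hrk : (r : k) ≠ 0) {ζ : k} (hζ : IsPrimitiveRoot ζ r)
    (hf : f.Separable) (O : ValuationSubring (FunctionField r f))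
    (hk : ∀ c : k, algebraMap k (FunctionField r f) c ∈ O) (hx : xCoord r f ∈ O) :
    (∀ t ∈ O, D t ∈ O) ↔ D (xCoord r f) / yCoord r f ^ (r - 1) ∈ O := by
  have hr0 : r ≠ 0 := by omega
  have hf0 : f ≠ 0 := hf.ne_zero
  have hy0 : yCoord r f ≠ 0 := yCoord_ne_zero hr0 hf0
  have hrF : (r : FunctionField r f) ≠ 0 := natCast_ne_zero hrk
  have hp : ∀ p : k[X], aeval (xCoord r f) p ∈ O := aeval_mem_valuationSubring O hk hx
  have hO : ∀ p : k[X], algebraMap k[X] (FunctionField r f) p ∈ O := fun p => by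
    rw [algebraMap_polynomial]; exact hp p
  have hy : yCoord r f ∈ O := mem_valuationSubring_of_isIntegral O hO (isIntegral_yCoord hr0)
  have hrO : (r : FunctionField r f) ∈ O := by
    rw [← map_natCast (algebraMap k (FunctionField r f))]; exact hk _
  constructor
  · intro h
    -- With α f + β f' = 1, dividing by y^(r-1) expresses Dx / y^(r-1) as α y Dx + r β Dy, which is
    -- visibly in O.
    obtain ⟨α, β, hαβ⟩ := hf
    have h1 : aeval (xCoord r f) α * yCoord r f ^ r +
        aeval (xCoord r f) β * aeval (xCoord r f) (derivative f) = 1 := by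
      rw [yCoord_pow_eq_aeval, ← map_mul, ← map_mul, ← map_add, hαβ, map_one]
    have h2 := derivation_yCoord D
    have h3 : D (xCoord r f) / yCoord r f ^ (r - 1) = aeval (xCoord r f) α * yCoord r f *
        D (xCoord r f) + aeval (xCoord r f) β * ((r : FunctionField r f) * D (yCoord r f)) := by
      have hpow : yCoord r f ^ r = yCoord r f ^ (r - 1) * yCoord r f := by
        rw [← pow_succ, Nat.sub_add_cancel (by omega)]
      rw [hpow] at h1
      rw [div_eq_iff (pow_ne_zero _ hy0)]
      linear_combination (-D (xCoord r f)) * h1 - aeval (xCoord r f) β * h2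
    rw [h3]
    exact add_mem (mul_mem (mul_mem (hp _) hy) (h _ hx)) (mul_mem (hp _) (mul_mem hrO (h _ hy)))
  · intro h
    obtain ⟨δ, hδ⟩ := exists_derivation (f := f) hr0 hζ
    -- D₀ = y^(r-1) d/dx maps the integral closure k[x, y] to itself, and D is Dx / y^(r-1) times
    -- D₀. Elements of O are quotients of integral elements with denominators invertible in O, so
    -- the quotient rule finishes.
    set D₀ : Derivation k (FunctionField r f) (FunctionField r f) :=
      yCoord r f ^ (r - 1) • δ with hD₀
    have hD : D = (D (xCoord r f) / yCoord r f ^ (r - 1)) • D₀ := by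
      apply derivation_ext hr0 hrk hf0
      rw [Derivation.smul_apply, hD₀, Derivation.smul_apply, hδ, smul_eq_mul, smul_eq_mul, mul_one,
        div_mul_cancel₀ _ (pow_ne_zero _ hy0)]
    have hDx : D₀ (xCoord r f) = yCoord r f ^ (r - 1) := by
      rw [hD₀, Derivation.smul_apply, hδ, smul_eq_mul, mul_one]
    have hDy : D₀ (yCoord r f) = (r : k)⁻¹ • aeval (xCoord r f) (derivative f) := by
      have h2 := derivation_yCoord D₀
      rw [hDx] at h2
      rw [Algebra.smul_def, map_inv₀, map_natCast]
      field_simp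
      apply mul_right_cancel₀ (pow_ne_zero (r - 1) hy0)
      linear_combination h2
    have hxi : ∀ p : k[X], IsIntegral k[X] (aeval (xCoord r f) p) := fun p => by
      rw [← algebraMap_polynomial]; exact isIntegral_algebraMap
    have hyi : IsIntegral k[X] (yCoord r f) := isIntegral_yCoord hr0
    have hDxi : IsIntegral k[X] (D₀ (xCoord r f)) := by rw [hDx]; exact hyi.pow _
    have hDyi : IsIntegral k[X] (D₀ (yCoord r f)) := by
      rw [hDy]; exact isIntegral_smul _ (hxi _)
    have hDi : ∀ u : FunctionField r f, IsIntegral k[X] u → IsIntegral k[X] (D₀ u) := by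
      intro u hu
      obtain ⟨p, rfl⟩ := exists_eq_sum_of_isIntegral hr hζ hrk hf.squarefree hu
      rw [map_sum]
      refine IsIntegral.sum _ fun i _ => ?_
      rw [Derivation.leibniz, Derivation.leibniz_pow, Derivation.map_aeval]
      simp only [smul_eq_mul, nsmul_eq_mul]
      refine ((hxi _).mul (IsIntegral.mul ?_ ((hyi.pow _).mul hDyi))).add
        ((hyi.pow _).mul ((hxi _).mul hDxi))
      rw [← map_natCast (algebraMap k[X] (FunctionField r f))]
      exact isIntegral_algebraMap
    have := algebraIsSeparable (f := f) hr0 hζ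
    have := finiteDimensional (f := f) hr0
    have := integralClosure.isDedekindDomain k[X] (RatFunc k) (FunctionField r f)
    have := integralClosure.isFractionRing_of_finite_extension (A := k[X]) (RatFunc k)
      (FunctionField r f)
    intro t ht
    obtain ⟨a, b, hb, hb0, rfl⟩ := exists_div_eq_of_mem_valuationSubring
      (R := integralClosure k[X] (FunctionField r f)) O
      (fun a => mem_valuationSubring_of_isIntegral O hO a.2) ht
    have hmem : ∀ u : FunctionField r f, IsIntegral k[X] u → u ∈ O := fun u hu =>
      mem_valuationSubring_of_isIntegral O hO hu
    rw [hD, Derivation.smul_apply]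
    refine mul_mem h ?_
    rw [Derivation.leibniz_div, smul_eq_mul, smul_eq_mul, smul_eq_mul]
    exact mul_mem (pow_mem hb 2) (sub_mem
      (mul_mem (hmem _ b.2) (hmem _ (hDi _ a.2))) (mul_mem (hmem _ a.2) (hmem _ (hDi _ b.2))))

end Field

end Superelliptic
end

/-! ### The reciprocal polynomial and the chart at infinity. -/

noncomputable section

namespace Superelliptic

open Polynomial

theorem isIntegral_of_forall_valuationSubring {R F : Type*} [CommRing R] [Field F] [Algebra R F]
    {u : F} (h : ∀ V : ValuationSubring F, (∀ p : R, algebraMap R F p ∈ V) → u ∈ V) :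
    IsIntegral R u := by
  by_contra hu
  have hu' : u ∉ (integralClosure R F).toSubring := hu
  have : IsIntegrallyClosedIn (integralClosure R F).toSubring F :=
    inferInstanceAs (IsIntegrallyClosedIn (integralClosure R F) F)
  obtain ⟨V, hV, huV⟩ := Subring.exists_le_valuationSubring_of_isIntegrallyClosedIn hu'
  exact huV (h V fun p => hV (isIntegral_algebraMap (R := R) (A := F) (x := p)))

section Reverse

variable {k : Type*} [Field k] {f : k[X]}

theorem natDegree_reverse (h : f.coeff 0 ≠ 0) : f.reverse.natDegree = f.natDegree := by
  rw [reverse_natDegree, natTrailingDegree_eq_zero.2 (Or.inr h), Nat.sub_zero]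

theorem reverse_reverse (h : f.coeff 0 ≠ 0) : f.reverse.reverse = f := by
  conv_lhs => rw [reverse, natDegree_reverse h, reverse]
  ext i
  simp

theorem squarefree_reverse (h : f.coeff 0 ≠ 0) (hf : Squarefree f) : Squarefree f.reverse := by
  intro q hq
  have h0 : f.reverse.coeff 0 ≠ 0 := by
    rw [coeff_zero_reverse]
    exact leadingCoeff_ne_zero.2 hf.ne_zero
  obtain ⟨s, hs⟩ := hq
  have hq0 : q.coeff 0 ≠ 0 := by
    intro hq0
    rw [hs, mul_coeff_zero, mul_coeff_zero, hq0] at h0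
    simp at h0
  have hdvd : q.reverse * q.reverse ∣ f := by
    rw [← reverse_reverse h, hs, reverse_mul_of_domain, reverse_mul_of_domain]
    exact dvd_mul_right _ _
  have hu := natDegree_eq_zero_of_isUnit (hf _ hdvd)
  rw [natDegree_reverse hq0] at hu
  rw [eq_C_of_natDegree_eq_zero hu]
  exact isUnit_C.2 (isUnit_iff_ne_zero.2 hq0)

theorem aeval_inv_mul_pow {F : Type*} [Field F] [Algebra k F] {x : F} (hx : x ≠ 0) (p : k[X]) :
    aeval x⁻¹ p * x ^ p.natDegree = aeval x p.reverse := by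
  let := invertibleOfNonzero (inv_ne_zero hx)
  have h := eval₂_reverse_mul_pow (algebraMap k F) x⁻¹ p
  rw [invOf_eq_inv, inv_inv] at h
  rw [aeval_def, aeval_def, ← h, mul_assoc, ← mul_pow, inv_mul_cancel₀ hx, one_pow, mul_one]

end Reverse

variable {k : Type*} [Field k] {r : ℕ} {f : k[X]}

theorem equation_eval₂ {E : Type*} [Field E] [Algebra k E] (g : RatFunc k →ₐ[k] E) {a b : E}
    (hg : g RatFunc.X = a) (hb : b ^ r = aeval a f) :
    eval₂ (g : RatFunc k →+* E) b (equation r f) = 0 := by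
  have h : g (algebraMap k[X] (RatFunc k) f) = aeval a f := by
    have h2 : (g.comp (IsScalarTower.toAlgHom k k[X] (RatFunc k))) = aeval a := by
      apply Polynomial.algHom_ext
      simp [hg]
    exact DFunLike.congr_fun h2 f
  rw [equation, eval₂_sub, eval₂_pow, eval₂_X, eval₂_C, hb, sub_eq_zero]
  exact h.symm

/-- The homomorphism from the function field given by a point `(a, b)` of the curve with `a`
transcendental. -/
def liftHom {E : Type*} [Field E] [Algebra k E] (a b : E) (ha : Transcendental k a)
    (hb : b ^ r = aeval a f) : FunctionField r f →ₐ[k] E :=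
  AdjoinRoot.liftAlgHom (equation r f)
    (RatFunc.liftAlgHom (aeval a)
      (nonZeroDivisors_le_comap_nonZeroDivisors_of_injective _
        (transcendental_iff_injective.1 ha))) b
    (equation_eval₂ _ (by
      rw [← RatFunc.algebraMap_X, ← div_one (algebraMap k[X] (RatFunc k) X),
        ← map_one (algebraMap k[X] (RatFunc k)), RatFunc.liftAlgHom_apply_div]
      simp) hb)

section

variable {E : Type*} [Field E] [Algebra k E] {a b : E} (ha : Transcendental k a)
  (hb : b ^ r = aeval a f)

theorem liftHom_yCoord : liftHom a b ha hb (yCoord r f) = b := by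
  rw [liftHom, yCoord, AdjoinRoot.liftAlgHom_root]

theorem liftHom_xCoord : liftHom a b ha hb (xCoord r f) = a := by
  have h : xCoord r f = AdjoinRoot.of (equation r f) RatFunc.X := rfl
  rw [liftHom, h, AdjoinRoot.liftAlgHom_of]
  rw [← RatFunc.algebraMap_X, ← div_one (algebraMap k[X] (RatFunc k) X),
    ← map_one (algebraMap k[X] (RatFunc k)), RatFunc.liftAlgHom_apply_div]
  simp

end

section Field

variable [Fact (Irreducible (equation r f))]

theorem intermediateField_eq_top (hr : r ≠ 0) (K : IntermediateField k (FunctionField r f))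
    (hx : xCoord r f ∈ K) (hy : yCoord r f ∈ K) : K = ⊤ := by
  refine top_le_iff.1 fun u _ => ?_
  have hp : ∀ p : k[X], aeval (xCoord r f) p ∈ K := fun p => by
    rw [aeval_eq_sum_range]
    exact sum_mem fun i _ => K.smul_mem (pow_mem hx i)
  rw [sum_repr hr u]
  refine sum_mem fun i _ => ?_
  rw [Algebra.smul_def, ← RatFunc.num_div_denom ((yBasis f hr).repr u i), map_div₀,
    algebraMap_ratFunc_polynomial, algebraMap_ratFunc_polynomial]
  exact mul_mem (div_mem (hp _) (hp _)) (pow_mem hy _)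

theorem algHom_ext {E : Type*} [Field E] [Algebra k E] (hr : r ≠ 0)
    {φ ψ : FunctionField r f →ₐ[k] E} (hx : φ (xCoord r f) = ψ (xCoord r f))
    (hy : φ (yCoord r f) = ψ (yCoord r f)) : φ = ψ := by
  have hp : ∀ p : k[X], φ (aeval (xCoord r f) p) = ψ (aeval (xCoord r f) p) := fun p => by
    rw [← aeval_algHom_apply, ← aeval_algHom_apply, hx]
  refine AlgHom.ext fun u => ?_
  rw [sum_repr hr u, map_sum, map_sum]
  refine Finset.sum_congr rfl fun i _ => ?_
  rw [Algebra.smul_def, ← RatFunc.num_div_denom ((yBasis f hr).repr u i), map_div₀,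
    algebraMap_ratFunc_polynomial, algebraMap_ratFunc_polynomial]
  simp only [map_mul, map_pow, map_div₀, hp, hy]

theorem transcendental_inv {E : Type*} [Field E] [Algebra k E] {a : E} (ha : Transcendental k a) :
    Transcendental k a⁻¹ := fun h => ha (by simpa using h.inv)

/-- The curve `Y^r = f^*(X)` for the reciprocal polynomial `f^*` is isomorphic to `Y^r = f(X)`. -/
theorem exists_reverseEquiv (hr : r ≠ 0) {d : ℕ} (hdeg : f.natDegree = r * d)
    (hf0 : f.coeff 0 ≠ 0) [Fact (Irreducible (equation r f.reverse))] :
    ∃ e : FunctionField r f.reverse ≃ₐ[k] FunctionField r f,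
      e (xCoord r f.reverse) = (xCoord r f)⁻¹ ∧
      e (yCoord r f.reverse) = yCoord r f / xCoord r f ^ d := by
  have hx0 : xCoord r f ≠ 0 := xCoord_ne_zero
  have hb : (yCoord r f / xCoord r f ^ d) ^ r = aeval (xCoord r f)⁻¹ f.reverse := by
    have h := aeval_inv_mul_pow hx0 f.reverse
    rw [reverse_reverse hf0, natDegree_reverse hf0, hdeg] at h
    rw [div_pow, ← pow_mul, mul_comm d r, yCoord_pow_eq_aeval, ← h,
      mul_div_assoc, div_self (pow_ne_zero _ hx0), mul_one]
  let φ := liftHom (r := r) (f := f.reverse) (xCoord r f)⁻¹ (yCoord r f / xCoord r f ^ d)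
    (transcendental_inv transcendental_xCoord) hb
  have hφx : φ (xCoord r f.reverse) = (xCoord r f)⁻¹ := liftHom_xCoord _ hb
  have hφy : φ (yCoord r f.reverse) = yCoord r f / xCoord r f ^ d := liftHom_yCoord _ hb
  have htop : φ.fieldRange = ⊤ := by
    have hx : xCoord r f ∈ φ.fieldRange := by
      rw [← inv_inv (xCoord r f), ← hφx]
      exact inv_mem ⟨_, rfl⟩
    refine intermediateField_eq_top hr _ hx ?_
    have : yCoord r f = φ (yCoord r f.reverse) * xCoord r f ^ d := by
      rw [hφy, div_mul_cancel₀ _ (pow_ne_zero _ hx0)]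
    rw [this]
    exact mul_mem ⟨_, rfl⟩ (pow_mem hx _)
  refine ⟨AlgEquiv.ofBijective φ ⟨φ.toRingHom.injective, fun u => ?_⟩, hφx, hφy⟩
  have : u ∈ φ.fieldRange := by rw [htop]; trivial
  exact this

end Field

end Superelliptic
end

/-! ### Holomorphic differentials in coordinates. -/

noncomputable section

namespace Superelliptic

open Polynomial

/-- The hypotheses on a separable curve `Y^r = f(X)` of degree `r * d` that is unramified over
`0` and `∞`. -/
structure IsAdmissible {k : Type*} [Field k] (r d : ℕ) (ζ : k) (f : k[X]) : Prop where
  two_le : 2 ≤ r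
  cast_ne_zero : (r : k) ≠ 0
  isPrimitiveRoot : IsPrimitiveRoot ζ r
  separable : f.Separable
  natDegree_eq : f.natDegree = r * d
  two_le_natDegree : 2 ≤ d
  coeff_zero_ne_zero : f.coeff 0 ≠ 0

variable {k : Type*} [Field k] {r d : ℕ} {ζ : k} {f : k[X]}

namespace IsAdmissible

theorem ne_zero (h : IsAdmissible r d ζ f) : r ≠ 0 := by
  have := h.two_le
  omega

theorem poly_ne_zero (h : IsAdmissible r d ζ f) : f ≠ 0 := h.separable.ne_zero

theorem irreducible (h : IsAdmissible r d ζ f) : Irreducible (equation r f) :=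
  equation_irreducible h.ne_zero h.separable.squarefree (by
    rw [h.natDegree_eq]
    have := h.two_le
    have := h.two_le_natDegree
    positivity)

theorem reverse [PerfectField k] (h : IsAdmissible r d ζ f) : IsAdmissible r d ζ f.reverse where
  two_le := h.two_le
  cast_ne_zero := h.cast_ne_zero
  isPrimitiveRoot := h.isPrimitiveRoot
  separable := PerfectField.separable_iff_squarefree.2
    (squarefree_reverse h.coeff_zero_ne_zero h.separable.squarefree)
  natDegree_eq := by rw [natDegree_reverse h.coeff_zero_ne_zero, h.natDegree_eq]
  two_le_natDegree := h.two_le_natDegree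
  coeff_zero_ne_zero := by
    rw [coeff_zero_reverse]
    exact leadingCoeff_ne_zero.2 h.poly_ne_zero

/-- `x^K₀` with `K₀ = (r - 1) d - 2` compares differentials at `0` and at `∞`. -/
theorem two_le_mul (h : IsAdmissible r d ζ f) : 2 ≤ (r - 1) * d := by
  have h1 := h.two_le
  have h2 := h.two_le_natDegree
  calc 2 = 1 * 2 := rfl
    _ ≤ (r - 1) * d := Nat.mul_le_mul (by omega) h2

end IsAdmissible

/-- Conjugate of a derivation by an isomorphism. -/
def conjDerivation {E F : Type*} [Field E] [Field F] [Algebra k E] [Algebra k F]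
    (e : E ≃ₐ[k] F) (D : Derivation k F F) : Derivation k E E :=
  Derivation.mk' (e.symm.toLinearMap ∘ₗ (D : F →ₗ[k] F) ∘ₗ e.toLinearMap) (fun a b => by
    simp only [LinearMap.comp_apply, AlgEquiv.toLinearMap_apply, map_mul, Derivation.coeFn_coe,
      Derivation.leibniz, map_add, smul_eq_mul, AlgEquiv.symm_apply_apply])

theorem conjDerivation_apply {E F : Type*} [Field E] [Field F] [Algebra k E] [Algebra k F]
    (e : E ≃ₐ[k] F) (D : Derivation k F F) (u : E) :
    conjDerivation e D u = e.symm (D (e u)) := rfl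

section Field

variable [Fact (Irreducible (equation r f))]

/-- The regular derivations at a place where `x⁻¹` is finite. -/
theorem derivation_mem_iff_of_inv_mem [PerfectField k] (h : IsAdmissible r d ζ f)
    (D : Derivation k (FunctionField r f) (FunctionField r f))
    (O : ValuationSubring (FunctionField r f))
    (hk : ∀ c : k, algebraMap k (FunctionField r f) c ∈ O) (hx : (xCoord r f)⁻¹ ∈ O) :
    (∀ t ∈ O, D t ∈ O) ↔
      D (xCoord r f) / yCoord r f ^ (r - 1) * xCoord r f ^ ((r - 1) * d - 2) ∈ O := by
  have : Fact (Irreducible (equation r f.reverse)) := ⟨h.reverse.irreducible⟩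
  have hx0 : xCoord r f ≠ 0 := xCoord_ne_zero
  have hy0 : yCoord r f ≠ 0 := yCoord_ne_zero h.ne_zero h.poly_ne_zero
  obtain ⟨e, hex, hey⟩ := exists_reverseEquiv h.ne_zero h.natDegree_eq h.coeff_zero_ne_zero
  let O' : ValuationSubring (FunctionField r f.reverse) := O.comap (e : _ →+* _)
  have hmem : ∀ u, u ∈ O' ↔ e u ∈ O := fun u => Iff.rfl
  have key := derivation_mem_iff (conjDerivation e D) h.two_le h.cast_ne_zero h.isPrimitiveRoot
    h.reverse.separable O' (fun c => by rw [hmem, e.commutes]; exact hk c)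
    (by rw [hmem, hex]; exact hx)
  have h1 : (∀ t ∈ O, D t ∈ O) ↔ ∀ t ∈ O', conjDerivation e D t ∈ O' := by
    constructor
    · intro hD t ht
      rw [conjDerivation_apply, hmem, e.apply_symm_apply]
      exact hD _ ht
    · intro hD t ht
      have := hD (e.symm t) (by rw [hmem, e.apply_symm_apply]; exact ht)
      rwa [conjDerivation_apply, hmem, e.apply_symm_apply, e.apply_symm_apply] at this
  rw [h1, key, conjDerivation_apply, hmem, map_div₀, map_pow, e.apply_symm_apply, hex, hey,
    Derivation.leibniz_inv, ← neg_mem_iff]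
  -- In the chart (1/x, y/x^d) the derivative of 1/x contributes x^(-2) and the power of y/x^d
  -- contributes x^((r-1)d).
  have h2 : -(-(xCoord r f)⁻¹ ^ 2 • D (xCoord r f) / (yCoord r f / xCoord r f ^ d) ^ (r - 1)) =
      D (xCoord r f) / yCoord r f ^ (r - 1) * xCoord r f ^ ((r - 1) * d - 2) := by
    have h3 : xCoord r f ^ ((r - 1) * d - 2) * xCoord r f ^ 2 = (xCoord r f ^ d) ^ (r - 1) := by
      rw [← pow_add, Nat.sub_add_cancel h.two_le_mul, ← pow_mul, mul_comm]
    rw [div_pow, ← h3, smul_eq_mul]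
    field_simp
  rw [h2]

/-- The multipliers `w` for which `w dx` is a holomorphic differential. -/
def holomorphic (r : ℕ) (f : k[X]) [Fact (Irreducible (equation r f))] :
    Submodule k (FunctionField r f) where
  -- A differential is regular at O when its pairing with every derivation preserving O lies in O;
  -- no uniformizers are needed.
  carrier := {w | ∀ O : ValuationSubring (FunctionField r f),
    (∀ c : k, algebraMap k (FunctionField r f) c ∈ O) →
    ∀ D : Derivation k (FunctionField r f) (FunctionField r f), (∀ t ∈ O, D t ∈ O) →
      w * D (xCoord r f) ∈ O}
  add_mem' := fun {a b} ha hb O hk D hD => by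
    rw [add_mul]
    exact add_mem (ha O hk D hD) (hb O hk D hD)
  zero_mem' := fun O hk D hD => by
    rw [zero_mul]
    exact zero_mem O
  smul_mem' := fun c a ha O hk D hD => by
    rw [Algebra.smul_def, mul_assoc]
    exact mul_mem (hk c) (ha O hk D hD)

/-- The function `∑ i, b_i(x) y^i` with polynomial coefficients. -/
def polySum (r : ℕ) (f : k[X]) : (Fin r → k[X]) →ₗ[k] FunctionField r f where
  toFun b := ∑ i : Fin r, aeval (xCoord r f) (b i) * yCoord r f ^ (i : ℕ)
  map_add' b c := by simp [add_mul, Finset.sum_add_distrib]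
  map_smul' a b := by simp [Finset.smul_sum]

theorem polySum_apply (b : Fin r → k[X]) :
    polySum r f b = ∑ i : Fin r, aeval (xCoord r f) (b i) * yCoord r f ^ (i : ℕ) := rfl

theorem repr_polySum (hr : r ≠ 0) (b : Fin r → k[X]) (i : Fin r) :
    (yBasis f hr).repr (polySum r f b) i = algebraMap k[X] (RatFunc k) (b i) := by
  have : polySum r f b =
      ∑ i : Fin r, algebraMap k[X] (RatFunc k) (b i) • yCoord r f ^ (i : ℕ) := by
    rw [polySum_apply]
    refine Finset.sum_congr rfl fun i _ => ?_
    rw [Algebra.smul_def, algebraMap_ratFunc_polynomial]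
  rw [this, repr_sum]

/-- A monomial x^j y^i divided by x^((r-1)d-2) equals (y/x^d)^i times 1/x to the power (r-1-i)d - 2
- j, and the degree bound says exactly that this exponent is not negative. For i = r - 1 the bound
is 0, so there b = 0. -/
theorem mul_pow_mem_of_degree_lt {O : ValuationSubring (FunctionField r f)}
    (hk : ∀ c : k, algebraMap k (FunctionField r f) c ∈ O) (hx : (xCoord r f)⁻¹ ∈ O)
    (hy : yCoord r f / xCoord r f ^ d ∈ O) (i : Fin r) {b : k[X]}
    (hb : b ∈ degreeLT k ((r - 1 - i) * d - 1)) :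
    aeval (xCoord r f) b * yCoord r f ^ (i : ℕ) / xCoord r f ^ ((r - 1) * d - 2) ∈ O := by
  have hx0 : xCoord r f ≠ 0 := xCoord_ne_zero
  rw [aeval_eq_sum_range, Finset.sum_mul, Finset.sum_div]
  refine sum_mem fun j _ => ?_
  by_cases hj : b.coeff j = 0
  · rw [hj, zero_smul, zero_mul, zero_div]
    exact zero_mem O
  have hjlt : j < (r - 1 - i) * d - 1 := by
    by_contra hcon
    exact hj ((mem_degreeLT.1 hb).trans_le (by exact_mod_cast not_lt.1 hcon) |>
      coeff_eq_zero_of_degree_lt)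
  have hsplit : (r - 1) * d = (r - 1 - i) * d + i * d := by
    rw [← add_mul, Nat.sub_add_cancel (by have := i.2; omega)]
  have hexp : (r - 1) * d - 2 = j + d * i + ((r - 1 - i) * d - 2 - j) := by
    rw [hsplit, mul_comm d i]
    omega
  have heq : b.coeff j • xCoord r f ^ j * yCoord r f ^ (i : ℕ) / xCoord r f ^ ((r - 1) * d - 2) =
      algebraMap k _ (b.coeff j) * (yCoord r f / xCoord r f ^ d) ^ (i : ℕ) *
        (xCoord r f)⁻¹ ^ ((r - 1 - i) * d - 2 - j) := by
    rw [hexp, pow_add, pow_add, pow_mul, Algebra.smul_def, div_pow, inv_pow]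
    field_simp
  rw [heq]
  exact mul_mem (mul_mem (hk _) (pow_mem hy _)) (pow_mem hx _)

theorem yCoord_div_mem (h : IsAdmissible r d ζ f) {O : ValuationSubring (FunctionField r f)}
    (hk : ∀ c : k, algebraMap k (FunctionField r f) c ∈ O) (hx : (xCoord r f)⁻¹ ∈ O) :
    yCoord r f / xCoord r f ^ d ∈ O := by
  have hx0 : xCoord r f ≠ 0 := xCoord_ne_zero
  have hp : (yCoord r f / xCoord r f ^ d) ^ r ∈ O := by
    have h1 := aeval_inv_mul_pow hx0 f.reverse
    rw [reverse_reverse h.coeff_zero_ne_zero, natDegree_reverse h.coeff_zero_ne_zero,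
      h.natDegree_eq] at h1
    rw [div_pow, ← pow_mul, mul_comm d r, yCoord_pow_eq_aeval, ← h1, mul_div_assoc,
      div_self (pow_ne_zero _ hx0), mul_one]
    exact aeval_mem_valuationSubring O hk hx _
  have hint : IsIntegral O (yCoord r f / xCoord r f ^ d) := by
    refine IsIntegral.of_pow (Nat.pos_of_ne_zero h.ne_zero) ?_
    exact isIntegral_algebraMap (R := O) (x := ⟨_, hp⟩)
  obtain ⟨z, hz⟩ := IsIntegrallyClosed.isIntegral_iff.1 hint
  rw [← hz]
  exact z.2

theorem polySum_div_mem_holomorphic [PerfectField k] (h : IsAdmissible r d ζ f)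
    {b : Fin r → k[X]} (hb : ∀ i : Fin r, b i ∈ degreeLT k ((r - 1 - i) * d - 1)) :
    polySum r f b / yCoord r f ^ (r - 1) ∈ holomorphic r f := by
  intro O hk D hD
  have hx0 : xCoord r f ≠ 0 := xCoord_ne_zero
  rcases O.mem_or_inv_mem (xCoord r f) with hx | hx
  · have h1 := (derivation_mem_iff D h.two_le h.cast_ne_zero h.isPrimitiveRoot h.separable O hk
      hx).1 hD
    have h2 : polySum r f b ∈ O := by
      have hp := aeval_mem_valuationSubring O hk hx
      rw [polySum_apply]
      refine sum_mem fun i _ => mul_mem (hp _) (pow_mem ?_ _)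
      exact mem_valuationSubring_of_isIntegral O (fun p => by
        rw [algebraMap_polynomial]; exact hp p) (isIntegral_yCoord h.ne_zero)
    rw [div_mul_eq_mul_div, mul_div_assoc]
    exact mul_mem h2 h1
  · have h1 := (derivation_mem_iff_of_inv_mem h D O hk hx).1 hD
    have h2 : polySum r f b / xCoord r f ^ ((r - 1) * d - 2) ∈ O := by
      rw [polySum_apply, Finset.sum_div]
      exact sum_mem fun i _ => mul_pow_mem_of_degree_lt hk hx (yCoord_div_mem h hk hx) i (hb i)
    have h3 := mul_mem h2 h1
    have h4 : polySum r f b / xCoord r f ^ ((r - 1) * d - 2) * (D (xCoord r f) /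
        yCoord r f ^ (r - 1) * xCoord r f ^ ((r - 1) * d - 2)) =
        polySum r f b / yCoord r f ^ (r - 1) * D (xCoord r f) := by
      field_simp
    rwa [h4] at h3

/-- Pairing with the generating regular derivation y^(r-1) d/dx of the finite chart shows that w
y^(r-1) is integral over k[x]. Pairing with the generator of the chart at infinity shows that w
y^(r-1) / x^((r-1)d-2) is integral over k[1/x]. Comparing the two expansions in powers of y bounds
the degrees. -/
theorem exists_polySum_of_mem_holomorphic [PerfectField k] (h : IsAdmissible r d ζ f)
    {w : FunctionField r f} (hw : w ∈ holomorphic r f) :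
    ∃ b : Fin r → k[X], (∀ i : Fin r, b i ∈ degreeLT k ((r - 1 - i) * d - 1)) ∧
      w * yCoord r f ^ (r - 1) = polySum r f b := by
  have : Fact (Irreducible (equation r f.reverse)) := ⟨h.reverse.irreducible⟩
  have hx0 : xCoord r f ≠ 0 := xCoord_ne_zero
  have hy0 : yCoord r f ≠ 0 := yCoord_ne_zero h.ne_zero h.poly_ne_zero
  obtain ⟨e, hex, hey⟩ := exists_reverseEquiv h.ne_zero h.natDegree_eq h.coeff_zero_ne_zero
  obtain ⟨δ, hδ⟩ := exists_derivation (f := f) h.ne_zero h.isPrimitiveRoot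
  have h1 : IsIntegral k[X] (w * yCoord r f ^ (r - 1)) := by
    refine isIntegral_of_forall_valuationSubring fun V hV => ?_
    have hk : ∀ c : k, algebraMap k (FunctionField r f) c ∈ V := fun c => by
      have := hV (C c)
      rwa [algebraMap_polynomial, aeval_C] at this
    have hx : xCoord r f ∈ V := by
      have := hV X
      rwa [algebraMap_polynomial, aeval_X] at this
    have h2 := hw V hk (yCoord r f ^ (r - 1) • δ) ((derivation_mem_iff _ h.two_le h.cast_ne_zero
      h.isPrimitiveRoot h.separable V hk hx).2 (by
        rw [Derivation.smul_apply, hδ, smul_eq_mul, mul_one, div_self (pow_ne_zero _ hy0)]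
        exact one_mem V))
    rwa [Derivation.smul_apply, hδ, smul_eq_mul, mul_one] at h2
  have h2 : IsIntegral k[X]
      (e.symm (w * yCoord r f ^ (r - 1) / xCoord r f ^ ((r - 1) * d - 2))) := by
    refine isIntegral_of_forall_valuationSubring fun V hV => ?_
    let O : ValuationSubring (FunctionField r f) := V.comap (e.symm : _ →+* _)
    have hmem : ∀ u, u ∈ O ↔ e.symm u ∈ V := fun u => Iff.rfl
    rw [← hmem]
    have hk : ∀ c : k, algebraMap k (FunctionField r f) c ∈ O := fun c => by
      have := hV (C c)
      rwa [algebraMap_polynomial, aeval_C, ← e.symm.commutes, ← hmem] at this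
    have hx : (xCoord r f)⁻¹ ∈ O := by
      have := hV X
      rw [algebraMap_polynomial, aeval_X] at this
      rwa [← hex, hmem, e.symm_apply_apply]
    have h2 := hw O hk ((yCoord r f ^ (r - 1) / xCoord r f ^ ((r - 1) * d - 2)) • δ)
      ((derivation_mem_iff_of_inv_mem h _ O hk hx).2 (by
        rw [Derivation.smul_apply, hδ, smul_eq_mul, mul_one]
        have : yCoord r f ^ (r - 1) / xCoord r f ^ ((r - 1) * d - 2) / yCoord r f ^ (r - 1) *
          xCoord r f ^ ((r - 1) * d - 2) = 1 := by field_simp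
        rw [this]
        exact one_mem O))
    rwa [Derivation.smul_apply, hδ, smul_eq_mul, mul_one, ← mul_div_assoc] at h2
  obtain ⟨b, hb⟩ := exists_eq_sum_of_isIntegral h.two_le h.isPrimitiveRoot h.cast_ne_zero
    h.separable.squarefree h1
  obtain ⟨p, hp⟩ := exists_eq_sum_of_isIntegral h.two_le h.isPrimitiveRoot h.cast_ne_zero
    h.reverse.separable.squarefree h2
  refine ⟨b, fun i => ?_, hb⟩
  have hp' := congrArg e hp
  rw [e.apply_symm_apply, hb] at hp'
  have hX0 : (RatFunc.X : RatFunc k) ≠ 0 := RatFunc.X_ne_zero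
  have hxX : algebraMap (RatFunc k) (FunctionField r f) RatFunc.X = xCoord r f := rfl
  have hl : (∑ i : Fin r, aeval (xCoord r f) (b i) * yCoord r f ^ (i : ℕ)) /
      xCoord r f ^ ((r - 1) * d - 2) =
      ∑ i : Fin r, (algebraMap k[X] (RatFunc k) (b i) / RatFunc.X ^ ((r - 1) * d - 2)) •
        yCoord r f ^ (i : ℕ) := by
    rw [Finset.sum_div]
    refine Finset.sum_congr rfl fun i _ => ?_
    rw [Algebra.smul_def, map_div₀, algebraMap_ratFunc_polynomial, map_pow, hxX]
    ring
  have hr' : e (∑ i : Fin r, aeval (xCoord r f.reverse) (p i) * yCoord r f.reverse ^ (i : ℕ)) =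
      ∑ i : Fin r, (aeval (RatFunc.X : RatFunc k)⁻¹ (p i) / RatFunc.X ^ (d * i)) •
        yCoord r f ^ (i : ℕ) := by
    rw [map_sum]
    refine Finset.sum_congr rfl fun i _ => ?_
    rw [Algebra.smul_def, map_div₀, map_mul, map_pow, hey, map_pow, hxX, ← aeval_algHom_apply, hex,
      ← aeval_algebraMap_apply, map_inv₀, hxX, div_pow, ← pow_mul]
    ring
  rw [hl, hr'] at hp'
  have hcoef := congrArg (fun u => (yBasis f h.ne_zero).repr u i) hp'
  simp only [repr_sum] at hcoef
  rw [div_eq_div_iff (pow_ne_zero _ hX0) (pow_ne_zero _ hX0)] at hcoef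
  have hrev := aeval_inv_mul_pow hX0 (p i)
  have hXa : ∀ q : k[X], aeval (RatFunc.X : RatFunc k) q = algebraMap k[X] (RatFunc k) q := by
    intro q
    rw [← RatFunc.algebraMap_X, aeval_algebraMap_apply, aeval_X_left_apply]
  -- As the reverse of p_i has degree at most deg p_i, this yields deg b_i + d i ≤ (r-1)d - 2
  -- whenever b_i ≠ 0.
  have hpoly : b i * X ^ (d * i + (p i).natDegree) = (p i).reverse * X ^ ((r - 1) * d - 2) := by
    apply RatFunc.algebraMap_injective k
    rw [map_mul, map_mul, map_pow, map_pow, RatFunc.algebraMap_X, ← hXa (p i).reverse, ← hrev,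
      pow_add]
    linear_combination RatFunc.X ^ (p i).natDegree * hcoef
  rw [mem_degreeLT]
  by_cases hb0 : b i = 0
  · rw [hb0, degree_zero]
    exact WithBot.bot_lt_coe _
  have hp0 : (p i).reverse ≠ 0 := by
    intro h0
    rw [h0, zero_mul] at hpoly
    exact mul_ne_zero hb0 (pow_ne_zero _ X_ne_zero) hpoly
  have hdeg := congrArg natDegree hpoly
  rw [natDegree_mul_X_pow _ hb0, natDegree_mul_X_pow _ hp0] at hdeg
  have hle : (p i).reverse.natDegree ≤ (p i).natDegree := reverse_natDegree_le _
  have hsplit : (r - 1) * d = (r - 1 - i) * d + i * d := by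
    rw [← add_mul, Nat.sub_add_cancel (by have := i.2; omega)]
  have h2m := h.two_le_mul
  rw [degree_eq_natDegree hb0]
  rw [mul_comm d] at hdeg
  exact_mod_cast (show (b i).natDegree < (r - 1 - i) * d - 1 by omega)

end Field

end Superelliptic
end

/-! ### Dimension counts: an automorphism acts on x by a Möbius transformation. -/

noncomputable section

namespace Superelliptic

open Polynomial

section Counting

/-- Only the term j = 0 is truncated by natural subtraction, so n terms, not n + 1, lose a unit. -/
theorem two_mul_sum_range_sub_one {d : ℕ} (hd : 2 ≤ d) (n : ℕ) :
    2 * ∑ j ∈ Finset.range (n + 1), (j * d - 1) + 2 * n = d * (n * (n + 1)) := by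
  induction n with
  | zero => simp
  | succ n ih =>
    rw [Finset.sum_range_succ]
    have h1 : 1 ≤ (n + 1) * d := Nat.mul_pos (by omega) (by omega)
    obtain ⟨e, he⟩ := Nat.exists_eq_add_of_le h1
    rw [he, Nat.add_sub_cancel_left]
    nlinarith

theorem two_mul_sum_range_sub_two {d : ℕ} (hd : 2 ≤ d) (n : ℕ) :
    2 * ∑ j ∈ Finset.range (n + 1), (j * d - 1 - 1) + 4 * n = d * (n * (n + 1)) := by
  induction n with
  | zero => simp
  | succ n ih =>
    rw [Finset.sum_range_succ]
    have h1 : 2 ≤ (n + 1) * d := by nlinarith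
    obtain ⟨e, he⟩ := Nat.exists_eq_add_of_le h1
    have h2 : (n + 1) * d - 1 - 1 = e := by omega
    rw [h2]
    nlinarith

theorem sum_range_ite_lt (g : ℕ → ℕ) {n r : ℕ} (h : n ≤ r) :
    (∑ j ∈ Finset.range r, if j < n then g j else 0) = ∑ j ∈ Finset.range n, g j := by
  rw [← Finset.sum_filter]
  congr 1
  ext j
  simp only [Finset.mem_filter, Finset.mem_range]
  omega

theorem sum_fin_reflect (r : ℕ) (g : ℕ → ℕ) :
    ∑ i : Fin r, g (r - 1 - i) = ∑ j ∈ Finset.range r, g j := by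
  rw [Fin.sum_univ_eq_sum_range (fun i => g (r - 1 - i)), Finset.sum_range_reflect]

/-- With a = i₀ - 1 and b = r - i₀ - 1 the closed formulas reduce the inequality to a + b + 2 < d
(a+1)(b+1), where equality occurs precisely for d = 2 and a = b = 0, that is, r = d = 2. -/
theorem sum_counting_lt {r d i₀ : ℕ} (hr : 2 ≤ r) (hd : 2 ≤ d) (hrd : ¬(r = 2 ∧ d = 2))
    (h1 : 1 ≤ i₀) (h2 : i₀ < r) :
    (∑ i : Fin r, if i₀ ≤ (i : ℕ) then (r - 1 - i) * d - 1 else 0) +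
      (∑ i : Fin r, if r - i₀ ≤ (i : ℕ) then (r - 1 - i) * d - 1 else 0) <
      ∑ i : Fin r, ((r - 1 - i) * d - 1 - 1) := by
  have e1 : (∑ i : Fin r, if i₀ ≤ (i : ℕ) then (r - 1 - i) * d - 1 else 0) =
      ∑ j ∈ Finset.range (r - i₀), (j * d - 1) := by
    rw [← sum_range_ite_lt _ (Nat.sub_le r i₀), ← sum_fin_reflect]
    refine Finset.sum_congr rfl fun i _ => ?_
    have := i.2
    exact if_congr (by omega) rfl rfl
  have e2 : (∑ i : Fin r, if r - i₀ ≤ (i : ℕ) then (r - 1 - i) * d - 1 else 0) =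
      ∑ j ∈ Finset.range i₀, (j * d - 1) := by
    rw [← sum_range_ite_lt _ h2.le, ← sum_fin_reflect]
    refine Finset.sum_congr rfl fun i _ => ?_
    have := i.2
    exact if_congr (by omega) rfl rfl
  rw [e1, e2, sum_fin_reflect r (fun j => j * d - 1 - 1)]
  obtain ⟨a, rfl⟩ := Nat.exists_eq_add_of_le h1
  obtain ⟨b, rfl⟩ := Nat.exists_eq_add_of_lt h2
  have h3 := two_mul_sum_range_sub_one hd a
  have h4 := two_mul_sum_range_sub_one hd b
  have h5 := two_mul_sum_range_sub_two hd (a + b + 1)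
  rw [show 1 + a + b + 1 - (1 + a) = b + 1 by omega, show 1 + a = a + 1 by omega,
    show a + 1 + b + 1 = a + b + 1 + 1 by omega]
  have h6 : a + b + 2 < d * ((a + 1) * (b + 1)) := by
    rcases Nat.lt_or_ge 2 d with h | h
    · nlinarith [Nat.zero_le (a * b)]
    · have hd2 : d = 2 := le_antisymm h hd
      subst hd2
      have : 1 ≤ a + b := by omega
      nlinarith [Nat.zero_le (a * b)]
  nlinarith

end Counting

variable {k : Type*} [Field k] {r d : ℕ} {ζ : k} {f : k[X]}

/-- Vectors of polynomials of bounded degrees, as vectors of rational functions. -/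
def boundedVectors (k : Type*) [Field k] {r : ℕ} (n : Fin r → ℕ) :
    Submodule k (Fin r → RatFunc k) :=
  LinearMap.range (LinearMap.pi fun i : Fin r =>
    ((IsScalarTower.toAlgHom k k[X] (RatFunc k)).toLinearMap ∘ₗ (degreeLT k (n i)).subtype) ∘ₗ
      LinearMap.proj (φ := fun i : Fin r => degreeLT k (n i)) i)

theorem mem_boundedVectors {n : Fin r → ℕ} {v : Fin r → RatFunc k} :
    v ∈ boundedVectors k n ↔
      ∀ i, ∃ b ∈ degreeLT k (n i), v i = algebraMap k[X] (RatFunc k) b := by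
  constructor
  · rintro ⟨b, rfl⟩ i
    exact ⟨b i, (b i).2, rfl⟩
  · intro h
    choose b hb hv using h
    exact ⟨fun i => ⟨b i, hb i⟩, funext fun i => (hv i).symm⟩

instance (n : ℕ) : Module.Finite k (degreeLT k n) :=
  Module.Finite.equiv (degreeLTEquiv k n).symm

instance (n : Fin r → ℕ) : Module.Finite k (boundedVectors k n) :=
  Module.Finite.range _

theorem finrank_boundedVectors (n : Fin r → ℕ) :
    Module.finrank k (boundedVectors k n) = ∑ i, n i := by
  rw [boundedVectors, LinearMap.finrank_range_of_inj, Module.finrank_pi_fintype]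
  · refine Finset.sum_congr rfl fun i _ => ?_
    rw [(degreeLTEquiv k (n i)).finrank_eq, Module.finrank_fin_fun]
  · intro b c h
    funext i
    apply Subtype.ext
    exact RatFunc.algebraMap_injective k (congrFun h i)

/-- Coordinates with respect to `1, y, …, y^(r-1)`. -/
def coords (f : k[X]) (hr : r ≠ 0) : FunctionField r f ≃ₗ[k] (Fin r → RatFunc k) :=
  (yBasis f hr).equivFun.restrictScalars k

theorem coords_apply (hr : r ≠ 0) (u : FunctionField r f) (i : Fin r) :
    coords f hr u i = (yBasis f hr).repr u i := rfl

theorem coords_algebraMap_mul (hr : r ≠ 0) (c : RatFunc k) (u : FunctionField r f) (i : Fin r) :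
    coords f hr (algebraMap (RatFunc k) (FunctionField r f) c * u) i = c * coords f hr u i := by
  rw [← Algebra.smul_def, coords_apply, coords_apply, map_smul, Finsupp.smul_apply, smul_eq_mul]

/-- The polynomial in `y` with given coefficients. -/
def toPoly (v : Fin r → RatFunc k) : (RatFunc k)[X] := ∑ i : Fin r, monomial (i : ℕ) (v i)

theorem toPoly_coeff (v : Fin r → RatFunc k) (i : Fin r) : (toPoly v).coeff i = v i := by
  rw [toPoly, finsetSum_coeff, Finset.sum_eq_single i]
  · simp
  · intro j _ hj
    rw [coeff_monomial, if_neg (fun h => hj (Fin.ext h))]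
  · simp

theorem toPoly_natDegree_lt (hr : r ≠ 0) (v : Fin r → RatFunc k) : (toPoly v).natDegree < r := by
  refine lt_of_le_of_lt (natDegree_sum_le_of_forall_le (n := r - 1) _ _ fun i _ => ?_) (by omega)
  exact (natDegree_monomial_le _).trans (by have := i.2; omega)

theorem aeval_toPoly (hr : r ≠ 0) (u : FunctionField r f) :
    aeval (yCoord r f) (toPoly (coords f hr u)) = u := by
  conv_rhs => rw [sum_repr hr u]
  rw [toPoly, map_sum]
  refine Finset.sum_congr rfl fun i _ => ?_
  rw [aeval_monomial, ← Algebra.smul_def, coords_apply]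

theorem coords_aeval (hr : r ≠ 0) {p : (RatFunc k)[X]} (hp : p.natDegree < r) (i : Fin r) :
    coords f hr (aeval (yCoord r f) p) i = p.coeff i := by
  rw [aeval_eq_sum_range' hp, ← Fin.sum_univ_eq_sum_range (fun i => p.coeff i • yCoord r f ^ i),
    coords_apply, repr_sum]

section Field

variable [Fact (Irreducible (equation r f))]

theorem mem_holomorphic_iff [PerfectField k] (h : IsAdmissible r d ζ f) {w : FunctionField r f} :
    w ∈ holomorphic r f ↔ coords f h.ne_zero (w * yCoord r f ^ (r - 1)) ∈
      boundedVectors k (fun i : Fin r => (r - 1 - i) * d - 1) := by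
  have hy0 : yCoord r f ^ (r - 1) ≠ 0 :=
    pow_ne_zero _ (yCoord_ne_zero h.ne_zero h.poly_ne_zero)
  rw [mem_boundedVectors]
  constructor
  · intro hw i
    obtain ⟨b, hb, hwb⟩ := exists_polySum_of_mem_holomorphic h hw
    exact ⟨b i, hb i, by rw [hwb, coords_apply, repr_polySum]⟩
  · intro hw
    choose b hb hwb using hw
    have : w = polySum r f b / yCoord r f ^ (r - 1) := by
      rw [eq_div_iff hy0]
      apply (coords f h.ne_zero).injective
      funext i
      rw [hwb, coords_apply, repr_polySum]
    rw [this]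
    exact polySum_div_mem_holomorphic h hb

/-- An automorphism acts on holomorphic differentials. -/
theorem exists_map_holomorphic (h : IsAdmissible r d ζ f) (σ : AutGroup r f) :
    ∃ g : FunctionField r f, g ≠ 0 ∧ ∀ w ∈ holomorphic r f, σ (w / g) ∈ holomorphic r f := by
  obtain ⟨δ, hδ⟩ := exists_derivation (f := f) h.ne_zero h.isPrimitiveRoot
  -- The factor g is d(σ⁻¹x)/dx: then w dx = (w/g) d(σ⁻¹x), and σ carries it to σ(w/g) dx.
  have key : ∀ D : Derivation k (FunctionField r f) (FunctionField r f),
      D (σ.symm (xCoord r f)) = D (xCoord r f) * δ (σ.symm (xCoord r f)) := by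
    intro D
    have hD : D = D (xCoord r f) • δ := by
      apply derivation_ext h.ne_zero h.cast_ne_zero h.poly_ne_zero
      rw [Derivation.smul_apply, hδ, smul_eq_mul, mul_one]
    conv_lhs => rw [hD]
    rw [Derivation.smul_apply, smul_eq_mul]
  have hg : δ (σ.symm (xCoord r f)) ≠ 0 := by
    intro h0
    have := key (conjDerivation σ δ)
    rw [h0, mul_zero, conjDerivation_apply, σ.apply_symm_apply, hδ, map_one] at this
    exact one_ne_zero this
  refine ⟨_, hg, fun w hw O hk D hD => ?_⟩
  let O' : ValuationSubring (FunctionField r f) := O.comap (σ : _ →+* _)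
  have hmem : ∀ u, u ∈ O' ↔ σ u ∈ O := fun u => Iff.rfl
  have h1 := hw O' (fun c => by rw [hmem, σ.commutes]; exact hk c) (conjDerivation σ D)
    (fun t ht => by
      rw [conjDerivation_apply, hmem, σ.apply_symm_apply]
      exact hD _ ht)
  have h2 := key (conjDerivation σ D)
  rw [conjDerivation_apply, σ.apply_symm_apply] at h2
  have h3 : σ (w / δ (σ.symm (xCoord r f))) * D (xCoord r f) =
      σ (w * conjDerivation σ D (xCoord r f)) := by
    rw [← σ.apply_symm_apply (D (xCoord r f)), h2, ← map_mul]
    congr 1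
    field_simp
  rw [h3]
  exact h1

/-- In coordinates: the functions `v` such that `v` and `u v` both give holomorphic
differentials. -/
def commonMultiples (hr : r ≠ 0) (d : ℕ) (u : FunctionField r f) :
    Submodule k (Fin r → RatFunc k) :=
  boundedVectors k (fun i : Fin r => (r - 1 - i) * d - 1) ⊓
    (boundedVectors k (fun i : Fin r => (r - 1 - i) * d - 1)).comap
      ((coords f hr).toLinearMap ∘ₗ LinearMap.mulLeft k u ∘ₗ (coords f hr).symm.toLinearMap)

theorem mem_commonMultiples (hr : r ≠ 0) {u : FunctionField r f} {v : Fin r → RatFunc k} :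
    v ∈ commonMultiples hr d u ↔
      v ∈ boundedVectors k (fun i : Fin r => (r - 1 - i) * d - 1) ∧
      coords f hr (u * (coords f hr).symm v) ∈
        boundedVectors k (fun i : Fin r => (r - 1 - i) * d - 1) := Iff.rfl

instance (hr : r ≠ 0) (u : FunctionField r f) : Module.Finite k (commonMultiples hr d u) :=
  Module.Finite.of_injective (Submodule.inclusion
    (inf_le_left : commonMultiples hr d u ≤ _)) (Submodule.inclusion_injective _)

theorem X_mul_mem_degreeLT {n : ℕ} {b : k[X]} (hb : b ∈ degreeLT k (n - 1)) :
    X * b ∈ degreeLT k n := by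
  rw [mem_degreeLT] at *
  by_cases hb0 : b = 0
  · rw [hb0, mul_zero, degree_zero]; exact WithBot.bot_lt_coe _
  rw [degree_mul, degree_X, degree_eq_natDegree hb0] at *
  have : b.natDegree < n - 1 := by exact_mod_cast hb
  exact_mod_cast (show 1 + b.natDegree < n by omega)

/-- Lowering each degree bound by one leaves differentials that stay holomorphic after
multiplication by x. Applying σ to such a pair gives two holomorphic differentials with ratio σ(x),
and this transport is injective. -/
theorem sum_le_finrank_commonMultiples [PerfectField k] (h : IsAdmissible r d ζ f)
    (σ : AutGroup r f) :
    ∑ i : Fin r, ((r - 1 - i) * d - 1 - 1) ≤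
      Module.finrank k (commonMultiples h.ne_zero d (σ (xCoord r f))) := by
  have hy0 : yCoord r f ^ (r - 1) ≠ 0 :=
    pow_ne_zero _ (yCoord_ne_zero h.ne_zero h.poly_ne_zero)
  obtain ⟨g, hg, hσ⟩ := exists_map_holomorphic h σ
  let R := coords f h.ne_zero
  let T : (Fin r → RatFunc k) →ₗ[k] (Fin r → RatFunc k) :=
    R.toLinearMap ∘ₗ LinearMap.mulRight k (yCoord r f ^ (r - 1)) ∘ₗ σ.toLinearMap ∘ₗ
      LinearMap.mulRight k ((yCoord r f ^ (r - 1))⁻¹ * g⁻¹) ∘ₗ R.symm.toLinearMap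
  have hT : ∀ v, T v = R (σ (R.symm v * ((yCoord r f ^ (r - 1))⁻¹ * g⁻¹)) *
    yCoord r f ^ (r - 1)) := fun v => rfl
  rw [← finrank_boundedVectors (k := k) (fun i : Fin r => (r - 1 - i) * d - 1 - 1)]
  have hmaps : ∀ v ∈ boundedVectors k (fun i : Fin r => (r - 1 - i) * d - 1 - 1),
      T v ∈ commonMultiples h.ne_zero d (σ (xCoord r f)) := by
    intro v hv
    have h1 : R.symm v * (yCoord r f ^ (r - 1))⁻¹ ∈ holomorphic r f := by
      rw [mem_holomorphic_iff h, inv_mul_cancel_right₀ hy0, LinearEquiv.apply_symm_apply,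
        mem_boundedVectors]
      intro i
      obtain ⟨b, hb, hvb⟩ := mem_boundedVectors.1 hv i
      exact ⟨b, degreeLT_mono (Nat.sub_le _ _) hb, hvb⟩
    have h2 : xCoord r f * (R.symm v * (yCoord r f ^ (r - 1))⁻¹) ∈ holomorphic r f := by
      rw [mem_holomorphic_iff h, mul_assoc, inv_mul_cancel_right₀ hy0, mem_boundedVectors]
      intro i
      obtain ⟨b, hb, hvb⟩ := mem_boundedVectors.1 hv i
      refine ⟨X * b, X_mul_mem_degreeLT hb, ?_⟩
      rw [xCoord, coords_algebraMap_mul, LinearEquiv.apply_symm_apply, hvb, map_mul,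
        RatFunc.algebraMap_X]
    have h3 := (mem_holomorphic_iff h).1 (hσ _ h1)
    have h4 := (mem_holomorphic_iff h).1 (hσ _ h2)
    rw [mem_commonMultiples, hT]
    refine ⟨?_, ?_⟩
    · rwa [div_eq_mul_inv, mul_assoc] at h3
    · rw [LinearEquiv.symm_apply_apply, ← mul_assoc, ← map_mul]
      rwa [div_eq_mul_inv, mul_assoc, mul_assoc] at h4
  have hinj : Function.Injective T := by
    intro v w hvw
    rw [hT, hT] at hvw
    have h1 := mul_right_cancel₀ hy0 (R.injective hvw)
    exact R.symm.injective (mul_right_cancel₀ (mul_ne_zero (inv_ne_zero hy0) (inv_ne_zero hg))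
      (σ.injective h1))
  refine LinearMap.finrank_le_finrank_of_injective (f := T.restrict hmaps) ?_
  intro v w hvw
  exact Subtype.ext (hinj (congrArg Subtype.val hvw))

/-- If `u` is not a rational function of `x`, it has few common multiples. -/
theorem finrank_commonMultiples_le (hr : r ≠ 0) (u : FunctionField r f) :
    Module.finrank k (commonMultiples hr d u) ≤
      (∑ i : Fin r, if (toPoly (coords f hr u)).natDegree ≤ (i : ℕ) then (r - 1 - i) * d - 1
        else 0) +
      (∑ i : Fin r, if r - (toPoly (coords f hr u)).natDegree ≤ (i : ℕ) then (r - 1 - i) * d - 1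
        else 0) := by
  by_cases hu : u = 0
  · subst hu
    have : toPoly (coords f hr (0 : FunctionField r f)) = 0 := by simp [toPoly]
    rw [this, natDegree_zero]
    simp only [zero_le, if_true]
    refine le_trans ?_ (Nat.le_add_right _ _)
    rw [← finrank_boundedVectors (k := k)]
    exact Submodule.finrank_mono inf_le_left
  set i₀ := (toPoly (coords f hr u)).natDegree with hi₀
  have hi₀r : i₀ < r := toPoly_natDegree_lt hr _
  set n₁ : Fin r → ℕ := fun i => if i₀ ≤ (i : ℕ) then (r - 1 - i) * d - 1 else 0 with hn₁
  set n₂ : Fin r → ℕ := fun i => if r - i₀ ≤ (i : ℕ) then (r - 1 - i) * d - 1 else 0 with hn₂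
  change _ ≤ (∑ i, n₁ i) + ∑ i, n₂ i
  let cut (n : ℕ) : (Fin r → RatFunc k) →ₗ[k] (Fin r → RatFunc k) :=
    LinearMap.pi fun i => if n ≤ (i : ℕ) then LinearMap.proj i else 0
  have hcut : ∀ n v (i : Fin r), cut n v i = if n ≤ (i : ℕ) then v i else 0 := by
    intro n v i
    simp only [cut, LinearMap.pi_apply]
    split_ifs <;> simp
  have hcutmem : ∀ n v, v ∈ boundedVectors k (fun i : Fin r => (r - 1 - i) * d - 1) →
      cut n v ∈ boundedVectors k
        (fun i : Fin r => if n ≤ (i : ℕ) then (r - 1 - i) * d - 1 else 0) := by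
    intro n v hv
    rw [mem_boundedVectors] at *
    intro i
    rw [hcut]
    by_cases hni : n ≤ (i : ℕ)
    · simp only [if_pos hni]; exact hv i
    · simp only [if_neg hni]; exact ⟨0, zero_mem _, by simp⟩
  rw [← finrank_boundedVectors (k := k) n₁, ← finrank_boundedVectors (k := k) n₂,
    ← Module.finrank_prod]
  -- A common multiple v is determined by the coordinates of u v at y^i with i ≥ i₀ together with
  -- those of v at y^i with i ≥ r - i₀.
  let T₁ : commonMultiples hr d u →ₗ[k] boundedVectors k n₁ :=
    ((cut i₀ ∘ₗ (coords f hr).toLinearMap ∘ₗ LinearMap.mulLeft k u ∘ₗ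
      (coords f hr).symm.toLinearMap) ∘ₗ (commonMultiples hr d u).subtype).codRestrict _
      (fun v => hcutmem _ _ v.2.2)
  let T₂ : commonMultiples hr d u →ₗ[k] boundedVectors k n₂ :=
    (cut (r - i₀) ∘ₗ (commonMultiples hr d u).subtype).codRestrict _ (fun v => hcutmem _ _ v.2.1)
  refine LinearMap.finrank_le_finrank_of_injective (f := T₁.prod T₂) ?_
  rw [← LinearMap.ker_eq_bot, LinearMap.ker_eq_bot']
  rintro ⟨v, hv⟩ hTv
  have hT1 : cut i₀ (coords f hr (u * (coords f hr).symm v)) = 0 :=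
    congrArg (fun z => (z.1 : Fin r → RatFunc k)) hTv
  have hT2 : cut (r - i₀) v = 0 := congrArg (fun z => (z.2 : Fin r → RatFunc k)) hTv
  apply Subtype.ext
  change v = 0
  by_contra hv0
  have hq : toPoly v ≠ 0 := by
    intro h0
    apply hv0
    funext i
    rw [← toPoly_coeff v i, h0, coeff_zero, Pi.zero_apply]
  have hp : toPoly (coords f hr u) ≠ 0 := by
    intro h0
    apply hu
    rw [← aeval_toPoly hr u, h0, map_zero]
  set s := (toPoly v).natDegree with hs
  have hsr : s < r := toPoly_natDegree_lt hr _
  have hs' : s < r - i₀ := by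
    by_contra hcon
    have h1 := congrFun hT2 ⟨s, hsr⟩
    rw [hcut, if_pos (not_lt.1 hcon), ← toPoly_coeff v ⟨s, hsr⟩] at h1
    exact leadingCoeff_ne_zero.2 hq h1
  -- Since i₀ + s < r, the product needs no reduction by y^r = f, and its leading coefficient
  -- survives as the coordinate of u v at i₀ + s, which was assumed to vanish.
  have hdeg : (toPoly (coords f hr u) * toPoly v).natDegree = i₀ + s := natDegree_mul hp hq
  have hlt : i₀ + s < r := by omega
  have h1 := congrFun hT1 ⟨i₀ + s, hlt⟩
  have hv' : (coords f hr).symm v = aeval (yCoord r f) (toPoly v) := by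
    have := aeval_toPoly hr ((coords f hr).symm v)
    rw [LinearEquiv.apply_symm_apply] at this
    exact this.symm
  rw [hcut, if_pos (Nat.le_add_right _ _), hv'] at h1
  conv at h1 => lhs; rw [← aeval_toPoly hr u]
  rw [← map_mul, coords_aeval hr (by rw [hdeg]; exact hlt)] at h1
  have h2 : (toPoly (coords f hr u) * toPoly v).leadingCoeff = 0 := by
    rw [leadingCoeff, hdeg]; exact h1
  exact mul_ne_zero hp hq (leadingCoeff_eq_zero.1 h2)

/-- A rational function of `x` of degree `δ` has few common multiples. -/
theorem finrank_commonMultiples_algebraMap_le (hr : r ≠ 0) (c : RatFunc k) :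
    Module.finrank k (commonMultiples (f := f) hr d (algebraMap (RatFunc k) _ c)) ≤
      ∑ i : Fin r, ((r - 1 - i) * d - 1 - max c.num.natDegree c.denom.natDegree) := by
  set q : RatFunc k := algebraMap k[X] (RatFunc k) c.denom with hq
  have hq0 : q ≠ 0 := RatFunc.algebraMap_ne_zero c.denom_ne_zero
  rw [← finrank_boundedVectors (k := k)]
  let T : (Fin r → RatFunc k) →ₗ[k] (Fin r → RatFunc k) :=
    LinearMap.pi fun i => LinearMap.mulLeft k q⁻¹ ∘ₗ LinearMap.proj i
  have hT : ∀ v i, T v i = q⁻¹ * v i := fun v i => rfl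
  have hmaps : ∀ v ∈ commonMultiples (f := f) hr d (algebraMap (RatFunc k) _ c),
      T v ∈ boundedVectors k (fun i : Fin r => (r - 1 - i) * d - 1 -
        max c.num.natDegree c.denom.natDegree) := by
    intro v hv
    rw [mem_commonMultiples, mem_boundedVectors, mem_boundedVectors] at hv
    rw [mem_boundedVectors]
    intro i
    obtain ⟨b, hb, hvb⟩ := hv.1 i
    obtain ⟨b', hb', hvb'⟩ := hv.2 i
    rw [coords_algebraMap_mul, LinearEquiv.apply_symm_apply, hvb, ← RatFunc.num_div_denom c,
      div_mul_eq_mul_div, div_eq_iff hq0, ← map_mul, hq, ← map_mul] at hvb'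
    have hpoly := RatFunc.algebraMap_injective k hvb'
    -- As numerator and denominator are coprime, b = denom * e and b' = num * e, so e obeys the
    -- degree bound lowered by each of the two degrees.
    have hdvd : c.denom ∣ b :=
      c.isCoprime_num_denom.symm.dvd_of_dvd_mul_left ⟨b', by rw [hpoly, mul_comm]⟩
    obtain ⟨e, rfl⟩ := hdvd
    have hb'e : b' = c.num * e := by
      apply mul_right_cancel₀ c.denom_ne_zero
      rw [← hpoly]
      ring
    refine ⟨e, ?_, ?_⟩
    · by_cases he : e = 0
      · rw [he]; exact zero_mem _
      rw [mem_degreeLT] at *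
      rw [degree_eq_natDegree he]
      rw [degree_eq_natDegree (mul_ne_zero c.denom_ne_zero he), natDegree_mul c.denom_ne_zero he,
        Nat.cast_lt] at hb
      rw [Nat.cast_lt]
      by_cases hc : c = 0
      · subst hc
        rw [RatFunc.num_zero, natDegree_zero]
        omega
      have hn : c.num ≠ 0 := RatFunc.num_ne_zero hc
      rw [hb'e, degree_eq_natDegree (mul_ne_zero hn he), natDegree_mul hn he, Nat.cast_lt] at hb'
      omega
    · rw [hT, hvb, map_mul, inv_mul_cancel_left₀ hq0]
  refine LinearMap.finrank_le_finrank_of_injective (f := T.restrict hmaps) ?_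
  intro v w hvw
  apply Subtype.ext
  funext i
  have h1 : T v i = T w i := congrFun (congrArg Subtype.val hvw) i
  rw [hT, hT] at h1
  exact mul_left_cancel₀ (inv_ne_zero hq0) h1

/-- Every automorphism of the curve acts on `x` by a Möbius transformation. -/
theorem exists_moebius [PerfectField k] (h : IsAdmissible r d ζ f) (hrd : ¬(r = 2 ∧ d = 2))
    (σ : AutGroup r f) :
    ∃ α β γ η : k, α * η - β * γ ≠ 0 ∧
      σ (xCoord r f) * aeval (xCoord r f) (C γ * X + C η) =
        aeval (xCoord r f) (C α * X + C β) := by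
  have hlow := sum_le_finrank_commonMultiples h σ
  have hdeg : (toPoly (coords f h.ne_zero (σ (xCoord r f)))).natDegree = 0 := by
    by_contra hne
    exact absurd (hlow.trans (finrank_commonMultiples_le h.ne_zero _)) (not_le.2
      (sum_counting_lt h.two_le h.two_le_natDegree hrd (Nat.one_le_iff_ne_zero.2 hne)
        (toPoly_natDegree_lt h.ne_zero _)))
  obtain ⟨c, hc⟩ : ∃ c : RatFunc k, σ (xCoord r f) = algebraMap (RatFunc k) _ c := by
    refine ⟨(toPoly (coords f h.ne_zero (σ (xCoord r f)))).coeff 0, ?_⟩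
    conv_lhs => rw [← aeval_toPoly h.ne_zero (σ (xCoord r f)), eq_C_of_natDegree_eq_zero hdeg,
      aeval_C]
  rw [hc] at hlow
  have hup := hlow.trans (finrank_commonMultiples_algebraMap_le h.ne_zero c)
  have hδ : max c.num.natDegree c.denom.natDegree ≤ 1 := by
    by_contra hcon
    refine absurd hup (not_le.2 (Finset.sum_lt_sum (fun i _ => by omega)
      ⟨⟨0, Nat.pos_of_ne_zero h.ne_zero⟩, Finset.mem_univ _, ?_⟩))
    -- At index 0 the bound minus one is still positive, so subtracting a degree of at least 2
    -- instead of 1 makes that term strictly smaller. Here r = d = 2 is excluded again.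
    have h1 : 3 ≤ (r - 1) * d := by
      have := h.two_le
      have := h.two_le_natDegree
      obtain ⟨a, rfl⟩ := Nat.exists_eq_add_of_le h.two_le
      obtain ⟨b, rfl⟩ := Nat.exists_eq_add_of_le h.two_le_natDegree
      rw [show 2 + a - 1 = a + 1 by omega]
      have : a ≠ 0 ∨ b ≠ 0 := by omega
      rcases this with h | h
      · have : 1 ≤ a := by omega
        nlinarith [Nat.zero_le (a * b)]
      · have : 1 ≤ b := by omega
        nlinarith [Nat.zero_le (a * b)]
    simp only [Nat.sub_zero]
    omega
  have hnum := exists_eq_X_add_C_of_natDegree_le_one ((le_max_left _ _).trans hδ)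
  have hden := exists_eq_X_add_C_of_natDegree_le_one ((le_max_right _ _).trans hδ)
  obtain ⟨α, β, hn⟩ := hnum
  obtain ⟨γ, η, hd⟩ := hden
  have hden0 : aeval (xCoord r f) c.denom ≠ 0 := by
    rw [← algebraMap_ratFunc_polynomial]
    exact (_root_.map_ne_zero _).2 (RatFunc.algebraMap_ne_zero c.denom_ne_zero)
  have heq : σ (xCoord r f) * aeval (xCoord r f) (C γ * X + C η) =
        aeval (xCoord r f) (C α * X + C β) := by
    rw [← hn, ← hd, hc]
    conv_lhs => rw [← RatFunc.num_div_denom c]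
    rw [map_div₀, algebraMap_ratFunc_polynomial, algebraMap_ratFunc_polynomial,
      RatFunc.num_div_denom, div_mul_cancel₀ _ hden0]
  refine ⟨α, β, γ, η, fun hdet => ?_, heq⟩
  have htr : Transcendental k (σ (xCoord r f)) := fun hal =>
    transcendental_xCoord (k := k) (r := r) (f := f)
      ((isAlgebraic_algHom_iff (σ : FunctionField r f →ₐ[k] FunctionField r f)
        σ.injective (a := xCoord r f)).1 hal)
  rw [hd] at hden0
  -- A vanishing determinant would make σ(x) a constant, contrary to its transcendence.
  simp only [map_add, map_mul, aeval_C, aeval_X] at heq hden0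
  by_cases hγ : γ = 0
  · subst hγ
    have hη : η ≠ 0 := by rintro rfl; simp at hden0
    have hα : α = 0 := by
      rw [mul_zero, sub_zero] at hdet
      exact (mul_eq_zero.1 hdet).resolve_right hη
    subst hα
    apply htr
    have : σ (xCoord r f) = algebraMap k _ (β / η) := by
      rw [map_div₀, eq_div_iff ((_root_.map_ne_zero _).2 hη)]
      simpa using heq
    rw [this]
    exact isAlgebraic_algebraMap _
  · apply htr
    have : σ (xCoord r f) = algebraMap k _ (α / γ) := by
      have hγ' : algebraMap k (FunctionField r f) γ ≠ 0 := (_root_.map_ne_zero _).2 hγ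
      rw [map_div₀, eq_div_iff hγ']
      apply mul_right_cancel₀ hden0
      have hdet' : algebraMap k (FunctionField r f) α * algebraMap k _ η -
          algebraMap k _ β * algebraMap k _ γ = 0 := by
        rw [← map_mul, ← map_mul, ← map_sub, hdet, map_zero]
      linear_combination algebraMap k (FunctionField r f) γ * heq - hdet'
    rw [this]
    exact isAlgebraic_algebraMap _

end Field

end Superelliptic
end

/-! ### Action on the roots of f, and the kernel of the action on x. -/

noncomputable section

namespace Superelliptic

open Polynomial

variable {k : Type*} [Field k] {r d : ℕ} {ζ : k} {f : k[X]}

/-- The polynomial `q^N f(p/q)`. -/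
def homogenizedComp (f p q : k[X]) (N : ℕ) : k[X] :=
  ∑ n ∈ Finset.range (N + 1), C (f.coeff n) * p ^ n * q ^ (N - n)

theorem aeval_homogenizedComp {F : Type*} [Field F] [Algebra k F] {p q : k[X]} {N : ℕ}
    (hN : f.natDegree ≤ N) {x u : F} (hu : u * aeval x q = aeval x p) :
    aeval x (homogenizedComp f p q N) = aeval u f * aeval x q ^ N := by
  rw [homogenizedComp, map_sum, aeval_eq_sum_range' (Nat.lt_succ_of_le hN), Finset.sum_mul]
  refine Finset.sum_congr rfl fun n hn => ?_
  have hnN : n ≤ N := Nat.lt_succ_iff.1 (Finset.mem_range.1 hn)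
  rw [map_mul, map_mul, map_pow, map_pow, aeval_C, ← hu, Algebra.smul_def, mul_pow]
  have : aeval x q ^ N = aeval x q ^ n * aeval x q ^ (N - n) := by
    rw [← pow_add, Nat.add_sub_cancel' hnN]
  rw [this]
  ring

theorem natDegree_homogenizedComp_le {p q : k[X]} {N : ℕ} (hp : p.natDegree ≤ 1)
    (hq : q.natDegree ≤ 1) : (homogenizedComp f p q N).natDegree ≤ N := by
  refine natDegree_sum_le_of_forall_le _ _ fun n hn => ?_
  have hnN : n ≤ N := Nat.lt_succ_iff.1 (Finset.mem_range.1 hn)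
  calc (C (f.coeff n) * p ^ n * q ^ (N - n)).natDegree
      ≤ (p ^ n).natDegree + (q ^ (N - n)).natDegree := by
        rw [mul_assoc]
        exact (natDegree_C_mul_le _ _).trans natDegree_mul_le
    _ ≤ n * 1 + (N - n) * 1 := Nat.add_le_add
        (natDegree_pow_le.trans (Nat.mul_le_mul_left _ hp))
        (natDegree_pow_le.trans (Nat.mul_le_mul_left _ hq))
    _ = N := by omega

theorem eval_homogenizedComp_of_eq_zero {p q : k[X]} {N : ℕ} (hN : f.natDegree = N) {a : k}
    (ha : q.eval a = 0) :
    (homogenizedComp f p q N).eval a = f.leadingCoeff * p.eval a ^ N := by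
  rw [homogenizedComp, eval_finsetSum, Finset.sum_eq_single N]
  · rw [eval_mul, eval_mul, eval_pow, eval_pow, eval_C, ha, Nat.sub_self, pow_zero, mul_one,
      leadingCoeff, hN]
  · intro n hn hne
    have hnN : n ≤ N := Nat.lt_succ_iff.1 (Finset.mem_range.1 hn)
    rw [eval_mul, eval_pow, ha, zero_pow (by omega), mul_zero]
  · simp

theorem tau_xCoord {ξ : kˣ} (hξ : ξ ^ r = 1) : tau f ξ hξ (xCoord r f) = xCoord r f := by
  have h₁ : (ξ : k) ^ r = 1 := by rw [← Units.val_pow_eq_pow_val, hξ, Units.val_one]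
  exact AlgHom.commutes (scaleY f (ξ : k) h₁) _

theorem tau_yCoord {ξ : kˣ} (hξ : ξ ^ r = 1) :
    tau f ξ hξ (yCoord r f) = algebraMap k _ (ξ : k) * yCoord r f := by
  have h₁ : (ξ : k) ^ r = 1 := by rw [← Units.val_pow_eq_pow_val, hξ, Units.val_one]
  rw [← Algebra.smul_def]
  exact scaleY_yCoord f (ξ : k) h₁

section Field

variable [Fact (Irreducible (equation r f))]

theorem aeval_linear_ne_zero {α β γ η : k} (hdet : α * η - β * γ ≠ 0) :
    aeval (xCoord r f) (C γ * X + C η) ≠ 0 := by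
  rw [← algebraMap_ratFunc_polynomial]
  refine (_root_.map_ne_zero _).2 (RatFunc.algebraMap_ne_zero fun h0 => ?_)
  have h1 : γ = 0 := by simpa using congrArg (coeff · 1) h0
  have h2 : η = 0 := by simpa using congrArg (coeff · 0) h0
  exact hdet (by rw [h1, h2]; ring)

/-- Kummer theory: y ↦ ζ y fixes s^r, so it multiplies s by some ζ^i, and the corresponding
eigenspace is k(x) y^i. Integrality of s makes the coefficient a polynomial. -/
theorem exists_eq_smul_pow_of_pow_eq (h : IsAdmissible r d ζ f) {s : FunctionField r f} {G : k[X]}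
    (hs : s ^ r = aeval (xCoord r f) G) (hs0 : s ≠ 0) :
    ∃ (i : Fin r) (p : k[X]), s = aeval (xCoord r f) p * yCoord r f ^ (i : ℕ) := by
  have hr0 := h.ne_zero
  have : NeZero r := ⟨hr0⟩
  have hint : IsIntegral k[X] s := by
    refine IsIntegral.of_pow (Nat.pos_of_ne_zero hr0) ?_
    rw [hs, ← algebraMap_polynomial]
    exact isIntegral_algebraMap
  have hτ : scaleY f ζ h.isPrimitiveRoot.pow_eq_one (aeval (xCoord r f) G) =
      aeval (xCoord r f) G := by
    rw [← algebraMap_ratFunc_polynomial, AlgHom.commutes]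
  have hpow : (scaleY f ζ h.isPrimitiveRoot.pow_eq_one s / s) ^ r = 1 := by
    rw [div_pow, ← map_pow, hs, hτ, div_self]
    rw [← hs]
    exact pow_ne_zero _ hs0
  have hprim : IsPrimitiveRoot (algebraMap k (FunctionField r f) ζ) r :=
    h.isPrimitiveRoot.map_of_injective (algebraMap k (FunctionField r f)).injective
  obtain ⟨i, hi, hζi⟩ := hprim.eq_pow_of_pow_eq_one hpow
  have hscale : scaleY f ζ h.isPrimitiveRoot.pow_eq_one s =
      algebraMap (RatFunc k) _ (algebraMap k (RatFunc k) (ζ ^ i)) * s := by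
    rw [← IsScalarTower.algebraMap_apply, map_pow, hζi, div_mul_cancel₀ _ hs0]
  have hzero : ∀ n : Fin r, n ≠ ⟨i, hi⟩ → (yBasis f hr0).repr s n = 0 := by
    intro n hn
    have h1 := repr_scaleY hr0 h.isPrimitiveRoot.pow_eq_one s n
    rw [hscale, ← Algebra.smul_def, map_smul, Finsupp.smul_apply, IsScalarTower.algebraMap_smul,
      ← sub_eq_zero, ← sub_smul, smul_eq_zero, sub_eq_zero] at h1
    refine h1.resolve_left fun heq => hn (Fin.ext ?_)
    exact (h.isPrimitiveRoot.pow_inj hi n.2 heq).symm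
  obtain ⟨p, hp⟩ := exists_eq_sum_of_isIntegral h.two_le h.isPrimitiveRoot h.cast_ne_zero
    h.separable.squarefree hint
  refine ⟨⟨i, hi⟩, p ⟨i, hi⟩, ?_⟩
  have hp' : s = polySum r f p := hp
  conv_lhs => rw [hp]
  refine Finset.sum_eq_single _ (fun n _ hn => ?_) (by simp)
  have h1 := hzero n hn
  rw [hp', repr_polySum] at h1
  have : p n = 0 := RatFunc.algebraMap_injective k (by rw [h1, map_zero])
  rw [this, map_zero, zero_mul]

theorem yCoord_notMem_range (h : IsAdmissible r d ζ f) (c : RatFunc k) :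
    algebraMap (RatFunc k) (FunctionField r f) c ≠ yCoord r f := by
  intro hc
  have hr := h.two_le
  have h1 := repr_smul_pow (f := f) h.ne_zero c ⟨0, by omega⟩ ⟨1, by omega⟩
  have h2 := repr_smul_pow (f := f) h.ne_zero (1 : RatFunc k) ⟨1, by omega⟩ ⟨1, by omega⟩
  rw [Algebra.smul_def] at h1
  simp only [pow_zero, mul_one, hc, pow_one, one_smul] at h1 h2
  rw [h1] at h2
  simp at h2

/-- An automorphism of the curve acts on `x` by a Möbius transformation that permutes the roots
of `f`. -/
theorem exists_moebius_roots [PerfectField k] (h : IsAdmissible r d ζ f)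
    (hrd : ¬(r = 2 ∧ d = 2)) (σ : AutGroup r f) :
    ∃ α β γ η : k, α * η - β * γ ≠ 0 ∧
      σ (xCoord r f) * (algebraMap k _ γ * xCoord r f + algebraMap k _ η) =
        algebraMap k _ α * xCoord r f + algebraMap k _ β ∧
      ∀ a : k, f.eval a = 0 → γ * a + η ≠ 0 ∧ f.eval ((α * a + β) / (γ * a + η)) = 0 := by
  obtain ⟨α, β, γ, η, hdet, hσ⟩ := exists_moebius h hrd σ
  refine ⟨α, β, γ, η, hdet, by simpa using hσ, ?_⟩
  set P : k[X] := C α * X + C β with hP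
  set Q : k[X] := C γ * X + C η with hQ
  have hQx : aeval (xCoord r f) Q ≠ 0 := aeval_linear_ne_zero hdet
  have hG := aeval_homogenizedComp (N := r * d) h.natDegree_eq.le hσ
  set G := homogenizedComp f P Q (r * d) with hGdef
  have hGdeg : G.natDegree ≤ r * d := natDegree_homogenizedComp_le
    (natDegree_linear_le) (natDegree_linear_le)
  -- The factor Q^d clears the denominators of f(P/Q), because deg f = r d.
  have hs : (σ (yCoord r f) * aeval (xCoord r f) Q ^ d) ^ r = aeval (xCoord r f) G := by
    rw [hG, mul_pow, ← map_pow, yCoord_pow_eq_aeval, ← aeval_algHom_apply, ← pow_mul, mul_comm d r]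
  have hs0 : σ (yCoord r f) * aeval (xCoord r f) Q ^ d ≠ 0 :=
    mul_ne_zero ((_root_.map_ne_zero σ).2 (yCoord_ne_zero h.ne_zero h.poly_ne_zero))
      (pow_ne_zero _ hQx)
  obtain ⟨i, p, hp⟩ := exists_eq_smul_pow_of_pow_eq h hs hs0
  have hp0 : p ≠ 0 := by
    rintro rfl
    rw [map_zero, zero_mul] at hp
    exact hs0 hp
  have hGp : G = p ^ r * f ^ (i : ℕ) := by
    apply transcendental_iff_injective.1 (transcendental_xCoord (r := r) (f := f))
    rw [← hs, hp, mul_pow, pow_right_comm, yCoord_pow_eq_aeval, map_mul, map_pow, map_pow]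
  -- If i = 0, then σ(x) and σ(y) both lie in k(x), so σ maps the whole function field into k(x),
  -- which does not contain y.
  have hi0 : (i : ℕ) ≠ 0 := by
    intro hi0
    rw [hi0, pow_zero, mul_one] at hp
    let K : IntermediateField k (FunctionField r f) :=
      (IsScalarTower.toAlgHom k (RatFunc k) (FunctionField r f)).fieldRange
    have hpK : ∀ q : k[X], aeval (xCoord r f) q ∈ K := fun q =>
      ⟨algebraMap k[X] (RatFunc k) q, algebraMap_ratFunc_polynomial q⟩
    have htop := intermediateField_eq_top h.ne_zero
      (K.comap (σ : FunctionField r f →ₐ[k] FunctionField r f))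
      (by
        change σ (xCoord r f) ∈ K
        rw [eq_div_of_mul_eq hQx hσ]
        exact div_mem (hpK _) (hpK _))
      (by
        change σ (yCoord r f) ∈ K
        rw [eq_div_of_mul_eq (pow_ne_zero _ hQx) hp]
        exact div_mem (hpK _) (pow_mem (hpK _) _))
    have hy : σ.symm (yCoord r f) ∈ K.comap (σ : FunctionField r f →ₐ[k] FunctionField r f) := by
      rw [htop]; trivial
    obtain ⟨c, hc⟩ : σ (σ.symm (yCoord r f)) ∈ K := hy
    rw [σ.apply_symm_apply] at hc
    exact yCoord_notMem_range h c hc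
  have hdegG := hGdeg
  rw [hGp, natDegree_mul (pow_ne_zero _ hp0) (pow_ne_zero _ h.poly_ne_zero), natDegree_pow,
    natDegree_pow, h.natDegree_eq] at hdegG
  have hrd0 : 0 < r * d := Nat.mul_pos (Nat.pos_of_ne_zero h.ne_zero)
    (by have := h.two_le_natDegree; omega)
  -- G = p^r f^i has degree at most deg f, so i ≤ 1; thus f divides G.
  have hi1 : (i : ℕ) = 1 := by
    have : (i : ℕ) * (r * d) ≤ 1 * (r * d) := by omega
    have := Nat.le_of_mul_le_mul_right this hrd0
    omega
  have hGf : ∀ a, f.eval a = 0 → G.eval a = 0 := by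
    intro a ha
    rw [hGp, hi1, eval_mul, pow_one, ha, mul_zero]
  intro a ha
  have hQa : Q.eval a = γ * a + η := by simp [hQ]
  have hPa : P.eval a = α * a + β := by simp [hP]
  -- At a zero of Q the polynomial G takes the value lc(f) P(a)^(rd); as G(a) = 0, P and Q would
  -- share a root, against the determinant.
  have hne : γ * a + η ≠ 0 := by
    intro h0
    have h1 := eval_homogenizedComp_of_eq_zero (p := P) h.natDegree_eq (hQa.trans h0)
    rw [← hGdef, hGf a ha, eq_comm, mul_eq_zero] at h1
    have h2 : α * a + β = 0 := by
      rw [← hPa]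
      exact eq_zero_of_pow_eq_zero (h1.resolve_left (leadingCoeff_ne_zero.2 h.poly_ne_zero))
    apply hdet
    by_cases hγ : γ = 0
    · have : η = 0 := by rw [hγ] at h0; simpa using h0
      rw [hγ, this]; ring
    · apply mul_left_cancel₀ hγ
      linear_combination α * γ * h0 - γ * γ * h2
  refine ⟨hne, ?_⟩
  have h1 := aeval_homogenizedComp (F := k) (p := P) (q := Q) (x := a)
    (u := (α * a + β) / (γ * a + η)) h.natDegree_eq.le
    (by rw [coe_aeval_eq_eval, hQa, hPa, div_mul_cancel₀ _ hne])
  rw [coe_aeval_eq_eval, coe_aeval_eq_eval, ← hGdef, hGf a ha, hQa, eq_comm,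
    mul_eq_zero] at h1
  exact h1.resolve_right (pow_ne_zero _ hne)

/-- If σ fixes x it fixes f(x) = y^r, so σ(y)/y is an r-th root of unity. -/
theorem mem_zpowers_tau_iff (h : IsAdmissible r d ζ f) {ξ : kˣ} (hξ : IsPrimitiveRoot ξ r)
    (σ : AutGroup r f) :
    σ ∈ Subgroup.zpowers (tau f ξ hξ.pow_eq_one) ↔ σ (xCoord r f) = xCoord r f := by
  constructor
  · intro hσ
    have hle : Subgroup.zpowers (tau f ξ hξ.pow_eq_one) ≤
        MulAction.stabilizer (AutGroup r f) (xCoord r f) := by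
      rw [Subgroup.zpowers_le, MulAction.mem_stabilizer_iff]
      exact tau_xCoord hξ.pow_eq_one
    exact hle hσ
  · intro hσ
    have : NeZero r := ⟨h.ne_zero⟩
    have hy0 : yCoord r f ≠ 0 := yCoord_ne_zero h.ne_zero h.poly_ne_zero
    have hpow : (σ (yCoord r f) / yCoord r f) ^ r = 1 := by
      rw [div_pow, ← map_pow, yCoord_pow_eq_aeval, ← aeval_algHom_apply, hσ, div_self]
      rw [← yCoord_pow_eq_aeval]
      exact pow_ne_zero _ hy0
    have hprim : IsPrimitiveRoot (algebraMap k (FunctionField r f) ξ) r :=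
      (IsPrimitiveRoot.coe_units_iff.2 hξ).map_of_injective
        (algebraMap k (FunctionField r f)).injective
    obtain ⟨i, -, hi⟩ := hprim.eq_pow_of_pow_eq_one hpow
    have hx : ∀ n : ℕ, (tau f ξ hξ.pow_eq_one ^ n) (xCoord r f) = xCoord r f := by
      intro n
      induction n with
      | zero => rfl
      | succ n ih => rw [pow_succ, AlgEquiv.mul_apply, tau_xCoord, ih]
    have hy : ∀ n : ℕ, (tau f ξ hξ.pow_eq_one ^ n) (yCoord r f) =
        algebraMap k _ (ξ : k) ^ n * yCoord r f := by
      intro n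
      induction n with
      | zero => simp
      | succ n ih =>
        rw [pow_succ, AlgEquiv.mul_apply, tau_yCoord, map_mul, AlgEquiv.commutes, ih]
        ring
    have heq : σ = tau f ξ hξ.pow_eq_one ^ i := by
      apply AlgEquiv.coe_toAlgHom_injective
      apply algHom_ext h.ne_zero
      · exact hσ.trans (hx i).symm
      · refine Eq.trans ?_ (hy i).symm
        rw [hi, div_mul_cancel₀ _ hy0]
        rfl
    rw [heq]
    exact Subgroup.npow_mem_zpowers _ _

/-- The reduced automorphism group is determined by the action on `x`. -/
theorem reducedAutIso_of_monoidHom [PerfectField k] (h : IsAdmissible r d ζ f)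
    (hrd : ¬(r = 2 ∧ d = 2)) {Q : Type*} [Group Q]
    (ψ : Q →* (FunctionField r f →ₐ[k] FunctionField r f))
    (hinj : ∀ q, ψ q (xCoord r f) = xCoord r f → q = 1)
    (hsurj : ∀ σ : AutGroup r f, ∃ q, ψ q (xCoord r f) = σ (xCoord r f)) :
    ReducedAutIso r f Q := by
  refine ⟨Fact.out, fun ξ hξ => ?_⟩
  have hnormal : (Subgroup.zpowers (tau f ξ hξ.pow_eq_one)).Normal := by
    refine ⟨fun τ hτ σ => ?_⟩
    rw [mem_zpowers_tau_iff h hξ] at hτ ⊢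
    obtain ⟨α, β, γ, η, hdet, hσ⟩ := exists_moebius h hrd σ⁻¹
    have hp : ∀ p : k[X], τ (aeval (xCoord r f) p) = aeval (xCoord r f) p := by
      intro p
      rw [← aeval_algHom_apply, hτ]
    -- By the Möbius formula σ⁻¹(x) lies in k(x), which τ fixes; hence σ τ σ⁻¹ fixes x.
    have hfix : τ (σ⁻¹ (xCoord r f)) = σ⁻¹ (xCoord r f) := by
      rw [eq_div_of_mul_eq (aeval_linear_ne_zero hdet) hσ, map_div₀, hp, hp]
    rw [AlgEquiv.mul_apply, AlgEquiv.mul_apply, hfix, ← AlgEquiv.mul_apply, mul_inv_cancel,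
      AlgEquiv.one_apply]
  refine ⟨hnormal, ⟨?_⟩⟩
  -- A homomorphism from a group to the monoid of endomorphisms lands in the units, which are the
  -- automorphisms.
  let φ : Q →* AutGroup r f :=
    (AlgEquiv.algHomUnitsEquiv k (FunctionField r f)).toMonoidHom.comp ψ.toHomUnits
  have hφ : ∀ q u, φ q u = ψ q u := fun q u => rfl
  let Φ := (QuotientGroup.mk' (Subgroup.zpowers (tau f ξ hξ.pow_eq_one))).comp φ
  refine (MulEquiv.ofBijective Φ ⟨?_, ?_⟩).symm
  · rw [injective_iff_map_eq_one]
    intro q hq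
    have h1 : φ q ∈ Subgroup.zpowers (tau f ξ hξ.pow_eq_one) :=
      (QuotientGroup.eq_one_iff _).1 hq
    rw [mem_zpowers_tau_iff h hξ, hφ] at h1
    exact hinj q h1
  · intro s
    obtain ⟨σ, rfl⟩ := QuotientGroup.mk_surjective s
    obtain ⟨q, hq⟩ := hsurj σ
    refine ⟨q, ?_⟩
    refine QuotientGroup.eq.2 ?_
    rw [mem_zpowers_tau_iff h hξ, AlgEquiv.mul_apply, ← hq, ← hφ, ← AlgEquiv.mul_apply,
      inv_mul_cancel, AlgEquiv.one_apply]

end Field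

end Superelliptic
end

/-! ### From conditions on roots to generic conditions on coefficients. -/

noncomputable section

namespace Superelliptic

open Polynomial

section GenPoly

variable {S : Type*} [CommRing S] {r : ℕ}

/-- The monic polynomial `X^r + c₁ X^(r-1) + ⋯ + c_(r-1) X + 1`. -/
def genPoly (c : Fin (r - 1) → S) : S[X] :=
  X ^ r + ((∑ j : Fin (r - 1), C (c j) * X ^ (r - 1 - (j : ℕ))) + 1)

theorem genPoly_tail_natDegree_le (c : Fin (r - 1) → S) :
    ((∑ j : Fin (r - 1), C (c j) * X ^ (r - 1 - (j : ℕ))) + 1 : S[X]).natDegree ≤ r - 1 := by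
  refine (natDegree_add_le _ _).trans (max_le ?_ (by simp))
  exact natDegree_sum_le_of_forall_le _ _ fun j _ =>
    (natDegree_C_mul_X_pow_le _ _).trans (Nat.sub_le _ _)

theorem genPoly_monic (hr : r ≠ 0) (c : Fin (r - 1) → S) : (genPoly c).Monic := by
  refine monic_X_pow_add (degree_le_natDegree.trans_lt ?_)
  exact_mod_cast (genPoly_tail_natDegree_le c).trans_lt (by omega)

theorem genPoly_natDegree [Nontrivial S] (hr : r ≠ 0) (c : Fin (r - 1) → S) :
    (genPoly c).natDegree = r := by
  rw [genPoly, natDegree_add_eq_left_of_natDegree_lt, natDegree_X_pow]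
  rw [natDegree_X_pow]
  exact (genPoly_tail_natDegree_le c).trans_lt (by omega)

theorem genPoly_coeff (c : Fin (r - 1) → S) (j : Fin (r - 1)) :
    (genPoly c).coeff (r - 1 - j) = c j := by
  have hj := j.2
  rw [genPoly, coeff_add, coeff_add, coeff_X_pow, if_neg (by omega), finsetSum_coeff,
    Finset.sum_eq_single j, coeff_C_mul_X_pow, if_pos rfl, coeff_one, if_neg (by omega)]
  · simp
  · intro i _ hi
    rw [coeff_C_mul_X_pow, if_neg]
    intro h
    exact hi (Fin.ext (by have := i.2; omega))
  · simp

theorem genPoly_coeff_zero (hr : r ≠ 0) (c : Fin (r - 1) → S) : (genPoly c).coeff 0 = 1 := by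
  rw [genPoly, coeff_add, coeff_add, coeff_X_pow, if_neg (Ne.symm hr), finsetSum_coeff,
    Finset.sum_eq_zero, coeff_one_zero]
  · simp
  · intro i _
    rw [coeff_C_mul_X_pow, if_neg (by have := i.2; omega)]

theorem eq_genPoly [Nontrivial S] (hr : r ≠ 0) {p : S[X]} (hp : p.Monic) (hdeg : p.natDegree = r)
    (h0 : p.coeff 0 = 1) : p = genPoly fun j : Fin (r - 1) => p.coeff (r - 1 - j) := by
  ext n
  rcases lt_trichotomy n r with hn | rfl | hn
  · rcases Nat.eq_zero_or_pos n with rfl | hn0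
    · rw [h0, genPoly_coeff_zero hr]
    · have h1 := genPoly_coeff (fun j : Fin (r - 1) => p.coeff (r - 1 - j)) ⟨r - 1 - n, by omega⟩
      have h2 : r - 1 - (r - 1 - n) = n := by omega
      simp only [h2] at h1
      rw [h1]
  · have h1 := (genPoly_monic hr fun j : Fin (n - 1) => p.coeff (n - 1 - j)).coeff_natDegree
    rw [genPoly_natDegree hr] at h1
    rw [h1, ← hp.coeff_natDegree, hdeg]
  · rw [coeff_eq_zero_of_natDegree_lt (by omega),
      coeff_eq_zero_of_natDegree_lt (by rw [genPoly_natDegree hr]; omega)]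

theorem genPoly_map {S' : Type*} [CommRing S'] (φ : S →+* S') (c : Fin (r - 1) → S) :
    (genPoly c).map φ = genPoly fun j => φ (c j) := by
  simp [genPoly, Polynomial.map_sum]

theorem form_eq_aeval_genPoly {k R : Type*} [Field k] [CommRing R] [Algebra k R]
    (c : Fin (r - 1) → k) (z : R) : form c z 1 = aeval z (genPoly c) := by
  simp [form, genPoly, Algebra.smul_def, add_assoc]

end GenPoly

variable {k : Type*} [Field k] {r l : ℕ}

section Root

variable {S : Type*} [CommRing S] [Algebra k S]

/-- A family of `m`-th roots of the roots of the forms `h_i`, the last one of each form being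
determined by the others. -/
def root (ε : k) (a : Fin l → Fin (r - 1) → Sˣ) : Fin l × Option (Fin (r - 1)) → S
  | (i, some j) => a i j
  | (i, none) => algebraMap k S ε * ((∏ j, a i j)⁻¹ : Sˣ)

/-- The polynomial with the given roots. -/
def rootPoly (m : ℕ) (ε : k) (a : Fin l → Fin (r - 1) → Sˣ) (i : Fin l) : S[X] :=
  ∏ j : Option (Fin (r - 1)), (X - C (root ε a (i, j) ^ m))

/-- The coefficients of the polynomial with the given roots. -/
def coef (m : ℕ) (ε : k) (a : Fin l → Fin (r - 1) → Sˣ) (i : Fin l) (j : Fin (r - 1)) : S :=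
  (rootPoly m ε a i).coeff (r - 1 - j)

/-- This is the reason for the constant ε: the forms have constant term 1, so their r roots must
multiply to (-1)^r. -/
theorem prod_root_pow {m : ℕ} {ε : k} (hε : ε ^ m = (-1) ^ r) (a : Fin l → Fin (r - 1) → Sˣ)
    (i : Fin l) : ∏ j : Option (Fin (r - 1)), root ε a (i, j) ^ m = (-1) ^ r := by
  rw [Finset.prod_pow, Fintype.prod_option]
  simp only [root]
  rw [mul_assoc, ← Units.coe_prod, Units.inv_mul, mul_one, ← map_pow, hε]
  simp

theorem rootPoly_eq_genPoly [Nontrivial S] (hr : r ≠ 0) {m : ℕ} {ε : k} (hε : ε ^ m = (-1) ^ r)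
    (a : Fin l → Fin (r - 1) → Sˣ) (i : Fin l) :
    rootPoly m ε a i = genPoly (coef m ε a i) := by
  have hcard : Fintype.card (Option (Fin (r - 1))) = r := by
    rw [Fintype.card_option, Fintype.card_fin]
    omega
  refine eq_genPoly hr (monic_prod_of_monic _ _ fun _ _ => monic_X_sub_C _) ?_ ?_
  · rw [rootPoly, natDegree_prod_of_monic _ _ fun _ _ => monic_X_sub_C _]
    simp only [natDegree_X_sub_C]
    rw [Finset.sum_const, Finset.card_univ, hcard, smul_eq_mul, mul_one]
  · rw [rootPoly, coeff_zero_eq_eval_zero, eval_prod]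
    simp only [eval_sub, eval_X, eval_C, zero_sub]
    rw [Finset.prod_neg, prod_root_pow hε, Finset.card_univ, hcard, ← mul_pow]
    simp

variable {S' : Type*} [CommRing S'] [Algebra k S'] (φ : S →ₐ[k] S')

theorem map_root (ε : k) (a : Fin l → Fin (r - 1) → Sˣ) (p : Fin l × Option (Fin (r - 1))) :
    φ (root ε a p) = root ε (fun i j => Units.map (φ : S →* S') (a i j)) p := by
  obtain ⟨i, _ | j⟩ := p
  · simp only [root, map_mul, AlgHom.commutes]
    congr 1
    rw [← map_prod (Units.map (φ : S →* S')), ← map_inv, Units.coe_map]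
    rfl
  · rfl

theorem map_coef (m : ℕ) (ε : k) (a : Fin l → Fin (r - 1) → Sˣ) (i : Fin l) (j : Fin (r - 1)) :
    φ (coef m ε a i j) = coef m ε (fun i j => Units.map (φ : S →* S') (a i j)) i j := by
  have h : (rootPoly m ε a i).map (φ : S →+* S') =
      rootPoly m ε (fun i j => Units.map (φ : S →* S') (a i j)) i := by
    rw [rootPoly, Polynomial.map_prod]
    refine Finset.prod_congr rfl fun j _ => ?_
    rw [Polynomial.map_sub, map_X, map_C, map_pow, RingHom.coe_coe, map_root]
  rw [coef, coef, ← h, coeff_map]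
  rfl

end Root

theorem isIntegralElem_aeval {k R M τ : Type*} [Field k] [CommRing R] [Algebra k R] [CommRing M]
    [Algebra k M] (g : R →ₐ[k] M) (v : τ → M) (hv : ∀ t, (g : R →+* M).IsIntegralElem (v t))
    (Q : MvPolynomial τ k) : (g : R →+* M).IsIntegralElem (MvPolynomial.aeval v Q) := by
  induction Q using MvPolynomial.induction_on with
  | C c =>
    rw [MvPolynomial.aeval_C, ← g.commutes]
    exact (g : R →+* M).isIntegralElem_map
  | add p q hp hq => rw [map_add]; exact hp.add _ hq
  | mul_X p t hp => rw [map_mul, MvPolynomial.aeval_X]; exact hp.mul _ (hv t)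

/-- A nonzero integral element of a domain divides the image of some nonzero element of the base.
This turns a condition on the roots into one on the coefficients. -/
theorem exists_ne_zero_dvd {R M : Type*} [CommRing R] [CommRing M] [IsDomain M] (g : R →+* M)
    {s : M} (hs : s ≠ 0) (hint : g.IsIntegralElem s) [Nontrivial R] :
    ∃ P : R, P ≠ 0 ∧ s ∣ g P := by
  let := g.toAlgebra
  have h : IsIntegral R s := hint
  exact h.isAlgebraic.exists_nonzero_dvd (mem_nonZeroDivisors_of_ne_zero hs)

/-- The coordinate ring of a torus. -/
abbrev TorusRing (k : Type*) [Field k] (τ : Type*) [Fintype τ] : Type _ :=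
  Localization.Away (∏ p : τ, MvPolynomial.X p : MvPolynomial τ k)

section Torus

variable {τ : Type*} [Fintype τ]

theorem prod_X_ne_zero : (∏ p : τ, MvPolynomial.X p : MvPolynomial τ k) ≠ 0 :=
  Finset.prod_ne_zero_iff.2 fun p _ => MvPolynomial.X_ne_zero p

instance : IsDomain (TorusRing k τ) :=
  IsLocalization.isDomain_localization (powers_le_nonZeroDivisors_of_noZeroDivisors prod_X_ne_zero)

/-- The coordinates of a torus. -/
def torusUnit (p : τ) : (TorusRing k τ)ˣ :=
  IsUnit.unit (a := algebraMap (MvPolynomial τ k) (TorusRing k τ) (MvPolynomial.X p))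
    (isUnit_of_dvd_unit (map_dvd _ (Finset.dvd_prod_of_mem _ (Finset.mem_univ p)))
      (IsLocalization.Away.algebraMap_isUnit _))

theorem exists_torus_lift {S : Type*} [Field S] [Algebra k S] (a : τ → Sˣ) :
    ∃ φ : TorusRing k τ →ₐ[k] S,
      ∀ p, Units.map (φ : TorusRing k τ →* S) (torusUnit p) = a p := by
  have hy : ∀ y : Submonoid.powers (∏ p : τ, MvPolynomial.X p : MvPolynomial τ k),
      IsUnit ((MvPolynomial.aeval (R := k) fun p : τ => (a p : S)) y) := by
    rintro ⟨_, n, rfl⟩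
    rw [map_pow, map_prod]
    refine IsUnit.pow _ (isUnit_iff_ne_zero.2 (Finset.prod_ne_zero_iff.2 fun p _ => ?_))
    rw [MvPolynomial.aeval_X]
    exact (a p).ne_zero
  refine ⟨IsLocalization.liftAlgHom (S := TorusRing k τ) hy, fun p => ?_⟩
  apply Units.ext
  change IsLocalization.liftAlgHom (S := TorusRing k τ) hy
    (algebraMap (MvPolynomial τ k) (TorusRing k τ) (MvPolynomial.X p)) = _
  rw [IsLocalization.liftAlgHom_apply, IsLocalization.lift_eq]
  exact MvPolynomial.aeval_X _ _

end Torus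

/-- A polynomial condition on the roots that holds for some family of roots over an extension
field holds for generic coefficients. -/
theorem exists_generic (hr : r ≠ 0) {m : ℕ} (hm : m ≠ 0) {ε : k} (hε : ε ^ m = (-1) ^ r)
    {K : Type*} [Field K] [Algebra k K] (a₀ : Fin l → Fin (r - 1) → Kˣ)
    (Q : MvPolynomial (Fin l × Option (Fin (r - 1))) k)
    (hQ : MvPolynomial.aeval (root ε a₀) Q ≠ 0) :
    ∃ P : MvPolynomial (Fin l × Fin (r - 1)) k, P ≠ 0 ∧ ∀ a : Fin l → Fin (r - 1) → kˣ,
      MvPolynomial.eval (fun ij => coef m ε a ij.1 ij.2) P ≠ 0 →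
        MvPolynomial.aeval (root ε a) Q ≠ 0 := by
  let A := MvPolynomial (Fin l × Fin (r - 1)) k
  let M := TorusRing k (Fin l × Fin (r - 1))
  let ag : Fin l → Fin (r - 1) → Mˣ := fun i j => torusUnit (i, j)
  -- The torus carries the universal family of roots; if Q vanished on it, it would vanish at the
  -- specialization a₀.
  have hQM : MvPolynomial.aeval (root ε ag) Q ≠ 0 := by
    intro h0
    obtain ⟨φ, hφ⟩ := exists_torus_lift (k := k) fun p : Fin l × Fin (r - 1) => a₀ p.1 p.2
    replace hφ : (fun i j => Units.map (φ : M →* K) (ag i j)) = a₀ :=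
      funext fun i => funext fun j => hφ (i, j)
    apply hQ
    have h1 := congrArg φ h0
    rw [map_zero, MvPolynomial.comp_aeval_apply] at h1
    have h2 : (fun p => φ (root ε ag p)) = root ε a₀ := by
      funext p
      rw [map_root, hφ]
    rw [← h2]
    exact h1
  let g : A →ₐ[k] M := MvPolynomial.aeval fun ij => coef m ε ag ij.1 ij.2
  -- Each universal root is a zero of the monic polynomial h_i(X^m, 1), whose coefficients come from
  -- A.
  have hint : ∀ p, (g : A →+* M).IsIntegralElem (root ε ag p) := by
    rintro ⟨i, j⟩
    refine ⟨expand A m (genPoly fun j => MvPolynomial.X (i, j)),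
      (genPoly_monic hr _).expand (Nat.pos_of_ne_zero hm), ?_⟩
    rw [eval₂_eq_eval_map, map_expand, genPoly_map, expand_eval]
    have : (fun j => (g : A →+* M) (MvPolynomial.X (i, j))) = coef m ε ag i := by
      funext j
      exact MvPolynomial.aeval_X _ _
    rw [this, ← rootPoly_eq_genPoly hr hε, rootPoly, eval_prod]
    exact Finset.prod_eq_zero (Finset.mem_univ j) (by simp)
  obtain ⟨P, hP, hdvd⟩ := exists_ne_zero_dvd (g : A →+* M) hQM (isIntegralElem_aeval g _ hint Q)
  refine ⟨P, hP, fun a ha h0 => ha ?_⟩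
  obtain ⟨φ, hφ⟩ := exists_torus_lift (k := k) fun p : Fin l × Fin (r - 1) => a p.1 p.2
  replace hφ : (fun i j => Units.map (φ : M →* k) (ag i j)) = a :=
    funext fun i => funext fun j => hφ (i, j)
  have h1 : φ (MvPolynomial.aeval (root ε ag) Q) = 0 := by
    rw [MvPolynomial.comp_aeval_apply, ← h0]
    congr 2
    funext p
    rw [map_root, hφ]
  have h2 : φ (g P) = 0 := by
    obtain ⟨s, hs⟩ := hdvd
    have hs' : g P = MvPolynomial.aeval (root ε ag) Q * s := hs
    rw [hs', map_mul, h1, zero_mul]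
  have h3 : (fun ij : Fin l × Fin (r - 1) => φ (coef m ε ag ij.1 ij.2)) =
      fun ij => coef m ε a ij.1 ij.2 := by
    funext ij
    rw [map_coef, hφ]
  rw [← h2, MvPolynomial.comp_aeval_apply, h3, ← MvPolynomial.coe_aeval_eq_eval]
  rfl

/-- Every choice of coefficients comes from a family of roots. -/
theorem exists_coef_eq [IsAlgClosed k] (hr : r ≠ 0) {m : ℕ} (hm : m ≠ 0) {ε : k}
    (hε : ε ^ m = (-1) ^ r) (c : Fin l → Fin (r - 1) → k) :
    ∃ a : Fin l → Fin (r - 1) → kˣ, coef m ε a = c := by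
  classical
  have hcard : Fintype.card (Option (Fin (r - 1))) = r := by
    rw [Fintype.card_option, Fintype.card_fin]
    omega
  have hz : ∀ i, ∃ z : Option (Fin (r - 1)) → k, genPoly (c i) = ∏ j, (X - C (z j)) := by
    intro i
    have hs := IsAlgClosed.splits (genPoly (c i))
    have hroots : (genPoly (c i)).roots.card = r := by
      rw [← hs.natDegree_eq_card_roots, genPoly_natDegree hr]
    obtain ⟨L, hL⟩ := Quot.exists_rep (genPoly (c i)).roots
    replace hL : (L : Multiset k) = (genPoly (c i)).roots := hL
    rw [← hL, Multiset.coe_card] at hroots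
    have e : Option (Fin (r - 1)) ≃ Fin L.length :=
      Fintype.equivOfCardEq (by rw [hcard, Fintype.card_fin, hroots])
    refine ⟨fun j => L[(e j).1], ?_⟩
    rw [Equiv.prod_comp e (fun n => X - C (L[n.1] : k)),
      Fin.prod_univ_fun_getElem L (fun x => X - C x)]
    conv_lhs => rw [hs.eq_prod_roots_of_monic (genPoly_monic hr _), ← hL]
    rw [Multiset.map_coe, Multiset.prod_coe]
  choose z hz using hz
  have hprod : ∀ i, (-1) ^ r * ∏ j, z i j = 1 := by
    intro i
    have h := genPoly_coeff_zero hr (c i)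
    rw [hz, coeff_zero_eq_eval_zero, eval_prod] at h
    simp only [eval_sub, eval_X, eval_C, zero_sub] at h
    rwa [Finset.prod_neg, Finset.card_univ, hcard] at h
  have hz0 : ∀ i j, z i j ≠ 0 := by
    intro i j h0
    have h := hprod i
    rw [Finset.prod_eq_zero (Finset.mem_univ j) h0, mul_zero] at h
    exact zero_ne_one h
  have hb : ∀ i (j : Fin (r - 1)), ∃ b : k, b ^ m = z i (some j) := fun i j =>
    IsAlgClosed.exists_pow_nat_eq _ (Nat.pos_of_ne_zero hm)
  choose b hb using hb
  have hb0 : ∀ i j, b i j ≠ 0 := by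
    intro i j h0
    apply hz0 i (some j)
    rw [← hb, h0, zero_pow hm]
  let a : Fin l → Fin (r - 1) → kˣ := fun i j => Units.mk0 (b i j) (hb0 i j)
  -- For the last index no m-th root is chosen: both sides are forced by the same product (-1)^r.
  have hroot : ∀ i j, root ε a (i, j) ^ m = z i j := by
    have hsome : ∀ i (j : Fin (r - 1)), root ε a (i, some j) ^ m = z i (some j) := hb
    rintro i (_ | j)
    · have h1 := prod_root_pow hε a i
      have h2 := hprod i
      rw [Fintype.prod_option] at h1 h2
      simp only [hsome] at h1
      have h3 : ∏ j : Fin (r - 1), z i (some j) ≠ 0 := Finset.prod_ne_zero_iff.2 fun j _ => hz0 i _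
      apply mul_right_cancel₀ h3
      rw [h1]
      have h4 : ((-1 : k) ^ r) * (-1) ^ r = 1 := by rw [← mul_pow]; simp
      have h5 : ((-1 : k) ^ r) ≠ 0 := pow_ne_zero _ (by simp)
      apply mul_left_cancel₀ h5
      rw [h4, h2]
    · exact hsome i j
  refine ⟨a, ?_⟩
  funext i j
  rw [coef, rootPoly]
  simp only [hroot]
  rw [← hz, genPoly_coeff]

end Superelliptic
end

/-! ### Degeneration: degrees of cross-ratios and the order of the exponents. -/

noncomputable section

namespace Superelliptic

open Polynomial

section Tree

/-- The combinatorics of a tree whose spine carries at least two leaves at each end: a map of the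
leaves that preserves the lengths between pairs preserves or reverses the spine. -/
theorem eq_or_eq_reflect {I : Type*} {e : I → ℤ} {π : I → I}
    {lo hi : ℤ} (hlt : lo < hi) (hlo : ∀ i, lo ≤ e i) (hhi : ∀ i, e i ≤ hi)
    {b₁ b₂ t₁ t₂ : I} (hb : b₁ ≠ b₂) (ht : t₁ ≠ t₂) (hb₁ : e b₁ = hi) (hb₂ : e b₂ = hi)
    (ht₁ : e t₁ = lo) (ht₂ : e t₂ = lo)
    (hD : ∀ p q s u : I, p ≠ s → q ≠ u → p ≠ u → q ≠ s →
      max (e (π p)) (e (π s)) + max (e (π q)) (e (π u)) + max (e p) (e u) + max (e q) (e s) =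
      max (e (π p)) (e (π u)) + max (e (π q)) (e (π s)) + max (e p) (e s) + max (e q) (e u)) :
    (∀ i, e (π i) = e i) ∨ ∀ i, e (π i) = hi + lo - e i := by
  have hne : ∀ i j : I, e i = hi → e j = lo → i ≠ j := by
    rintro i j h1 h2 rfl
    omega
  -- For this quadruple the two pairings differ by hi - lo, the largest difference possible; it is
  -- attained only when one pair of images lies at hi and the other at lo.
  have h0 := hD b₁ t₁ b₂ t₂ hb ht (hne _ _ hb₁ ht₂) (hne _ _ hb₂ ht₁).symm
  have l1 := hlo (π b₁); have l2 := hlo (π b₂); have l3 := hlo (π t₁); have l4 := hlo (π t₂)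
  have u1 := hhi (π b₁); have u2 := hhi (π b₂); have u3 := hhi (π t₁); have u4 := hhi (π t₂)
  have hcase : (e (π b₁) = hi ∧ e (π b₂) = hi ∧ e (π t₁) = lo ∧ e (π t₂) = lo) ∨
      (e (π b₁) = lo ∧ e (π b₂) = lo ∧ e (π t₁) = hi ∧ e (π t₂) = hi) := by
    rw [hb₁, hb₂, ht₁, ht₂] at h0
    omega
  rcases hcase with ⟨c1, c2, c3, c4⟩ | ⟨c1, c2, c3, c4⟩
  · left
    intro q
    by_cases h1 : q = b₂
    · rw [h1, c2, hb₂]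
    by_cases h2 : q = t₁
    · rw [h2, c3, ht₁]
    -- With three leaves at the ends, all terms of the identity except those of q are known, so it
    -- determines e (π q).
    have h := hD b₁ q b₂ t₁ hb h2 (hne _ _ hb₁ ht₁) h1
    have := hlo q; have := hhi q; have := hlo (π q); have := hhi (π q)
    rw [hb₁, hb₂, ht₁, c1, c2, c3] at h
    omega
  · right
    intro q
    by_cases h1 : q = b₂
    · rw [h1, c2, hb₂]; ring
    by_cases h2 : q = t₁
    · rw [h2, c3, ht₁]; ring
    have h := hD b₁ q b₂ t₁ hb h2 (hne _ _ hb₁ ht₁) h1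
    have := hlo q; have := hhi q; have := hlo (π q); have := hhi (π q)
    rw [hb₁, hb₂, ht₁, c1, c2, c3] at h
    omega

end Tree

section Levels

variable {r l : ℕ}

/-- The exponents of a degenerating family of roots. -/
def level (r l : ℕ) : Fin l × Option (Fin (r - 1)) → ℤ
  | (i, some j) => i * (r - 1 : ℕ) + j + 1
  | (i, none) => -∑ j : Fin (r - 1), ((i * (r - 1 : ℕ) + j + 1 : ℤ))

theorem level_some_pos (i : Fin l) (j : Fin (r - 1)) : 0 < level r l (i, some j) := by
  simp only [level]
  positivity

theorem level_none (i : Fin l) : level r l (i, none) = -∑ j, level r l (i, some j) := rfl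

theorem level_none_neg (hr : 2 ≤ r) (i : Fin l) : level r l (i, none) < 0 := by
  rw [level_none, neg_lt_zero]
  have : Nonempty (Fin (r - 1)) := ⟨⟨0, by omega⟩⟩
  exact Finset.sum_pos (fun j _ => level_some_pos i j) Finset.univ_nonempty

/-- The positive levels are 1 plus the numbers i(r-1) + j with j < r-1, so division with remainder
recovers (i, j). The negative levels strictly decrease with i. -/
theorem level_injective (hr : 2 ≤ r) : Function.Injective (level r l) := by
  have : Nonempty (Fin (r - 1)) := ⟨⟨0, by omega⟩⟩
  have hlt : ∀ i i' : Fin l, i < i' → level r l (i', none) < level r l (i, none) := by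
    intro i i' h
    rw [level_none, level_none, neg_lt_neg_iff]
    refine Finset.sum_lt_sum_of_nonempty Finset.univ_nonempty fun j _ => ?_
    simp only [level]
    have h1 : (i : ℤ) < i' := by exact_mod_cast h
    have h2 : (0 : ℤ) < (r - 1 : ℕ) := by exact_mod_cast (show 0 < r - 1 by omega)
    nlinarith
  rintro ⟨i, _ | j⟩ ⟨i', _ | j'⟩ h
  · rcases lt_trichotomy i i' with h1 | rfl | h1
    · exact absurd h (hlt _ _ h1).ne'
    · rfl
    · exact absurd h (hlt _ _ h1).ne
  · have h1 := level_none_neg hr i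
    have h2 := level_some_pos i' j'
    omega
  · have h1 := level_none_neg hr i'
    have h2 := level_some_pos i j
    omega
  · simp only [level] at h
    have h1 : (i : ℕ) * (r - 1) + j = i' * (r - 1) + j' := by
      have : ((i : ℕ) : ℤ) * ((r - 1 : ℕ) : ℤ) + (j : ℕ) =
          (i' : ℕ) * ((r - 1 : ℕ) : ℤ) + (j' : ℕ) := by
        linarith
      exact_mod_cast this
    have h2 : (i : ℕ) = i' := by
      have hj := j.2
      have hj' := j'.2
      have hpos : 0 < r - 1 := by omega
      have e1 := Nat.add_mul_div_right (j : ℕ) i hpos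
      have e2 := Nat.add_mul_div_right (j' : ℕ) i' hpos
      rw [Nat.div_eq_of_lt hj] at e1
      rw [Nat.div_eq_of_lt hj'] at e2
      rw [add_comm] at h1
      rw [h1, add_comm, e2] at e1
      omega
    have h3 : (j : ℕ) = j' := by
      rw [h2] at h1
      omega
    rw [Fin.ext h2, Fin.ext h3]

theorem sum_level : ∑ p, level r l p = 0 := by
  rw [Fintype.sum_prod_type]
  refine Finset.sum_eq_zero fun i _ => ?_
  rw [Fintype.sum_option, level_none]
  simp

/-- The levels are not symmetric when `3 ≤ r`; when `r = 2` the only symmetry is `e ↦ -e`. -/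
theorem eq_zero_of_level_reflect {c : ℤ} (hr : 2 ≤ r) (hl : 1 ≤ l)
    (h : ∀ p, ∃ p', level r l p' = c - level r l p) : r = 2 ∧ c = 0 := by
  choose φ hφ using h
  have hinj : Function.Injective φ := by
    intro p q hpq
    apply level_injective hr
    have h1 := hφ p
    have h2 := hφ q
    rw [hpq] at h1
    omega
  -- The reflection permutes the levels, whose sum is 0; summing gives c times the number of levels
  -- equal to 0.
  have hsum := Equiv.sum_comp (Equiv.ofBijective φ (Finite.injective_iff_bijective.1 hinj))
    (level r l)
  simp only [Equiv.ofBijective_apply, hφ] at hsum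
  rw [Finset.sum_sub_distrib, sum_level, Finset.sum_const, sub_zero, Finset.card_univ,
    nsmul_eq_mul, mul_eq_zero] at hsum
  have hc : c = 0 := by
    refine hsum.resolve_left ?_
    have : Nonempty (Fin l) := ⟨⟨0, by omega⟩⟩
    exact_mod_cast Fintype.card_ne_zero
  refine ⟨?_, hc⟩
  by_contra hr2
  have hne : (Finset.univ : Finset (Fin l × Option (Fin (r - 1)))).Nonempty :=
    ⟨(⟨0, by omega⟩, none), Finset.mem_univ _⟩
  obtain ⟨p, -, hp⟩ := Finset.exists_max_image Finset.univ (level r l) hne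
  have hpmax : ∀ q, level r l q ≤ level r l p := fun q => hp q (Finset.mem_univ q)
  obtain ⟨i, _ | j⟩ := p
  · have h1 := hpmax (i, some ⟨0, by omega⟩)
    have h2 := level_some_pos i (⟨0, by omega⟩ : Fin (r - 1))
    have h3 := level_none_neg hr i
    omega
  -- For r ≥ 3 the reflected level of (i, none) is a sum of at least two positive levels, one of
  -- them the maximal one, so it exceeds the maximum.
  · have h1 := hpmax (φ (i, none))
    rw [hφ, hc, level_none] at h1
    obtain ⟨j', hj'⟩ : ∃ j' : Fin (r - 1), j' ≠ j := by
      have : Nontrivial (Fin (r - 1)) := Fin.nontrivial_iff_two_le.2 (by omega)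
      exact exists_ne j
    have h2 := Finset.single_lt_sum hj' (Finset.mem_univ j) (Finset.mem_univ j')
      (level_some_pos i j') (fun j'' _ _ => (level_some_pos i j'').le)
    omega

end Levels

section Degree

variable {k : Type*} [Field k]

theorem intDegree_sub_of_lt {x y : RatFunc k} (hx : x ≠ 0) (hy : y ≠ 0)
    (h : x.intDegree < y.intDegree) : (x - y).intDegree = y.intDegree := by
  have hne : x - y ≠ 0 := by
    intro h0
    rw [sub_eq_zero.1 h0] at h
    exact lt_irrefl _ h
  have h1 := RatFunc.intDegree_add_le (neg_ne_zero.2 hy) (x := x) (by rwa [← sub_eq_add_neg])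
  have h2 := RatFunc.intDegree_add_le hx (x := -(x - y)) (by simpa using hy)
  rw [← sub_eq_add_neg, RatFunc.intDegree_neg] at h1
  rw [neg_sub, sub_add_cancel, ← neg_sub, RatFunc.intDegree_neg] at h2
  omega

theorem intDegree_sub_of_ne {x y : RatFunc k} (hx : x ≠ 0) (hy : y ≠ 0)
    (h : x.intDegree ≠ y.intDegree) :
    (x - y).intDegree = max x.intDegree y.intDegree := by
  rcases lt_or_gt_of_ne h with h | h
  · rw [intDegree_sub_of_lt hx hy h, max_eq_right h.le]
  · rw [← neg_sub, RatFunc.intDegree_neg, intDegree_sub_of_lt hy hx h, max_eq_left h.le]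

theorem intDegree_prod {ι : Type*} (s : Finset ι) (g : ι → RatFunc k) (h : ∀ i ∈ s, g i ≠ 0) :
    (∏ i ∈ s, g i).intDegree = ∑ i ∈ s, (g i).intDegree := by
  classical
  induction s using Finset.induction_on with
  | empty => simp
  | insert i s hi ih =>
    rw [Finset.prod_insert hi, Finset.sum_insert hi, RatFunc.intDegree_mul
      (h _ (Finset.mem_insert_self _ _))
      (Finset.prod_ne_zero_iff.2 fun j hj => h j (Finset.mem_insert_of_mem hj)),
      ih fun j hj => h j (Finset.mem_insert_of_mem hj)]

theorem intDegree_pow {x : RatFunc k} (hx : x ≠ 0) (n : ℕ) :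
    (x ^ n).intDegree = n * x.intDegree := by
  rw [← Finset.card_range n, ← Finset.prod_const, intDegree_prod _ _ fun _ _ => hx]
  simp

theorem intDegree_algebraMap_mul {c : k} (hc : c ≠ 0) {x : RatFunc k} (hx : x ≠ 0) :
    (algebraMap k (RatFunc k) c * x).intDegree = x.intDegree := by
  have h : algebraMap k (RatFunc k) c ≠ 0 := by simpa using hc
  rw [RatFunc.intDegree_mul h hx, RatFunc.algebraMap_eq_C, RatFunc.intDegree_C, zero_add]

end Degree

section Point

variable {k S : Type*} [Field k] [CommRing S] [Algebra k S] {r l m : ℕ}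

theorem root_ne_zero [Nontrivial S] [NoZeroDivisors S] {ε : k} (hε : ε ≠ 0)
    (a : Fin l → Fin (r - 1) → Sˣ) (p : Fin l × Option (Fin (r - 1))) : root ε a p ≠ 0 := by
  obtain ⟨i, _ | j⟩ := p
  · exact mul_ne_zero (by simpa using hε) (Units.ne_zero _)
  · exact Units.ne_zero _

/-- The `m`-fold family of roots of the product of the forms `h_i(X^m, 1)`. -/
def point (ω ε : k) (a : Fin l → Fin (r - 1) → Sˣ)
    (p : (Fin l × Option (Fin (r - 1))) × Fin m) : S :=
  algebraMap k S (ω ^ (p.2 : ℕ)) * root ε a p.1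

theorem point_ne_zero [Nontrivial S] [NoZeroDivisors S] {ω ε : k} (hω : ω ≠ 0) (hε : ε ≠ 0)
    (a : Fin l → Fin (r - 1) → Sˣ) (p : (Fin l × Option (Fin (r - 1))) × Fin m) :
    point ω ε a p ≠ 0 :=
  mul_ne_zero (by simpa using fun h => absurd h hω) (root_ne_zero hε a _)

theorem point_pow {ω ε : k} (hω : ω ^ m = 1) (a : Fin l → Fin (r - 1) → Sˣ)
    (p : (Fin l × Option (Fin (r - 1))) × Fin m) : point ω ε a p ^ m = root ε a p.1 ^ m := by
  rw [point, mul_pow, ← map_pow, pow_right_comm, hω, one_pow, map_one, one_mul]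

/-- The difference of the two sides of the equation that two quadruples with the same cross-ratio
satisfy. -/
def crossDiff {I R : Type*} [CommRing R] (A : I → R) (t : Fin 4 → I × I) : R :=
  (A (t 0).2 - A (t 2).2) * (A (t 1).2 - A (t 3).2) *
      ((A (t 0).1 - A (t 3).1) * (A (t 1).1 - A (t 2).1)) -
    (A (t 0).2 - A (t 3).2) * (A (t 1).2 - A (t 2).2) *
      ((A (t 0).1 - A (t 2).1) * (A (t 1).1 - A (t 3).1))

theorem crossDiff_moebius {I K : Type*} [Field K] (A : I → K) (π : I → I) {α β γ η : K}
    (h0 : ∀ i, γ * A i + η ≠ 0) (hπ : ∀ i, A (π i) = (α * A i + β) / (γ * A i + η))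
    (i : Fin 4 → I) : crossDiff A (fun j => (i j, π (i j))) = 0 := by
  have h : ∀ i j, A (π i) - A (π j) =
      (α * η - β * γ) * (A i - A j) / ((γ * A i + η) * (γ * A j + η)) := by
    intro i j
    rw [hπ, hπ, div_sub_div _ _ (h0 i) (h0 j)]
    congr 1
    ring
  have e0 := h0 (i 0)
  have e1 := h0 (i 1)
  have e2 := h0 (i 2)
  have e3 := h0 (i 3)
  simp only [crossDiff, h]
  field_simp
  ring

/-- The polynomial `crossDiff` in the roots. -/
def crossPoly (ω : k) (t : Fin 4 → ((Fin l × Option (Fin (r - 1))) × Fin m) ×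
      ((Fin l × Option (Fin (r - 1))) × Fin m)) :
    MvPolynomial (Fin l × Option (Fin (r - 1))) k :=
  crossDiff (fun p => MvPolynomial.C (ω ^ (p.2 : ℕ)) * MvPolynomial.X p.1) t

theorem aeval_crossPoly (ω ε : k) (a : Fin l → Fin (r - 1) → Sˣ)
    (t : Fin 4 → ((Fin l × Option (Fin (r - 1))) × Fin m) ×
      ((Fin l × Option (Fin (r - 1))) × Fin m)) :
    MvPolynomial.aeval (root ε a) (crossPoly ω t) = crossDiff (point ω ε a) t := by
  simp [crossPoly, crossDiff, point]

end Point

section Degeneration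

variable {k : Type*} [Field k] {r l m : ℕ}

/-- The degenerating family of roots with the exponents `level`. -/
def levelUnit (k : Type*) [Field k] (r l : ℕ) (i : Fin l) (j : Fin (r - 1)) : (RatFunc k)ˣ :=
  Units.mk0 (RatFunc.X ^ ((i : ℕ) * (r - 1) + j + 1)) (pow_ne_zero _ RatFunc.X_ne_zero)

theorem intDegree_root_levelUnit {ε : k} (hε : ε ≠ 0) (p : Fin l × Option (Fin (r - 1))) :
    (root ε (levelUnit k r l) p).intDegree = level r l p := by
  have hsome : ∀ i j, ((levelUnit k r l i j : (RatFunc k)ˣ) : RatFunc k).intDegree =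
      level r l (i, some j) := by
    intro i j
    rw [levelUnit, Units.val_mk0, intDegree_pow RatFunc.X_ne_zero, RatFunc.intDegree_X, level]
    push_cast
    ring
  obtain ⟨i, _ | j⟩ := p
  · rw [root, intDegree_algebraMap_mul hε (Units.ne_zero _), Units.val_inv_eq_inv_val,
      RatFunc.intDegree_inv, Units.coe_prod, intDegree_prod _ _ fun _ _ => Units.ne_zero _,
      level_none]
    simp only [hsome]
  · exact hsome i j

/-- Points of different levels have different degrees, so nothing cancels; points of the same level
differ by a nonzero constant ω^s - ω^t times their common root. -/
theorem intDegree_point_sub (hr : 2 ≤ r) {ω ε : k} (hω : IsPrimitiveRoot ω m) (hε : ε ≠ 0)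
    {p q : (Fin l × Option (Fin (r - 1))) × Fin m} (hpq : p ≠ q) :
    point ω ε (levelUnit k r l) p - point ω ε (levelUnit k r l) q ≠ 0 ∧
    (point ω ε (levelUnit k r l) p - point ω ε (levelUnit k r l) q).intDegree =
      max (level r l p.1) (level r l q.1) := by
  have hm : m ≠ 0 := by
    have := p.2.2
    omega
  have hω0 : ω ≠ 0 := hω.ne_zero hm
  have hdeg : ∀ p : (Fin l × Option (Fin (r - 1))) × Fin m,
      (point ω ε (levelUnit k r l) p).intDegree = level r l p.1 := fun p => by
    rw [point, intDegree_algebraMap_mul (pow_ne_zero _ hω0) (root_ne_zero hε _ _),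
      intDegree_root_levelUnit hε]
  by_cases h : p.1 = q.1
  · have h2 : (ω ^ (p.2 : ℕ) - ω ^ (q.2 : ℕ)) ≠ 0 := by
      intro h0
      exact hpq (Prod.ext h (Fin.ext (hω.pow_inj p.2.2 q.2.2 (sub_eq_zero.1 h0))))
    have h3 := root_ne_zero hε (levelUnit k r l) q.1
    rw [point, point, h, ← sub_mul, ← map_sub, intDegree_algebraMap_mul h2 h3,
      intDegree_root_levelUnit hε, max_self]
    exact ⟨mul_ne_zero ((_root_.map_ne_zero _).2 h2) h3, rfl⟩
  · have h1 : (point ω ε (levelUnit k r l) p).intDegree ≠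
        (point ω ε (levelUnit k r l) q).intDegree := by
      rw [hdeg, hdeg]
      exact fun h0 => h (level_injective hr h0)
    have h0 := point_ne_zero (m := m) hω0 hε (levelUnit k r l)
    refine ⟨fun h0 => h1 (by rw [sub_eq_zero.1 h0]), ?_⟩
    rw [intDegree_sub_of_ne (h0 p) (h0 q) h1, hdeg, hdeg]

theorem level_add_eq_of_crossDiff_eq_zero (hr : 2 ≤ r) {ω ε : k} (hω : IsPrimitiveRoot ω m)
    (hε : ε ≠ 0)
    {t : Fin 4 → ((Fin l × Option (Fin (r - 1))) × Fin m) ×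
      ((Fin l × Option (Fin (r - 1))) × Fin m)}
    (ht : crossDiff (point ω ε (levelUnit k r l)) t = 0)
    (h02 : (t 0).1 ≠ (t 2).1) (h13 : (t 1).1 ≠ (t 3).1) (h03 : (t 0).1 ≠ (t 3).1)
    (h12 : (t 1).1 ≠ (t 2).1) (h02' : (t 0).2 ≠ (t 2).2) (h13' : (t 1).2 ≠ (t 3).2)
    (h03' : (t 0).2 ≠ (t 3).2) (h12' : (t 1).2 ≠ (t 2).2) :
    max (level r l (t 0).2.1) (level r l (t 2).2.1) +
        max (level r l (t 1).2.1) (level r l (t 3).2.1) +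
        max (level r l (t 0).1.1) (level r l (t 3).1.1) +
        max (level r l (t 1).1.1) (level r l (t 2).1.1) =
      max (level r l (t 0).2.1) (level r l (t 3).2.1) +
        max (level r l (t 1).2.1) (level r l (t 2).2.1) +
        max (level r l (t 0).1.1) (level r l (t 2).1.1) +
        max (level r l (t 1).1.1) (level r l (t 3).1.1) := by
  have D := fun {p q : (Fin l × Option (Fin (r - 1))) × Fin m} (h : p ≠ q) =>
    intDegree_point_sub hr hω hε h
  have h := congrArg RatFunc.intDegree (sub_eq_zero.1 ht)
  rw [RatFunc.intDegree_mul (mul_ne_zero (D h02').1 (D h13').1) (mul_ne_zero (D h03).1 (D h12).1),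
    RatFunc.intDegree_mul (D h02').1 (D h13').1, RatFunc.intDegree_mul (D h03).1 (D h12).1,
    RatFunc.intDegree_mul (mul_ne_zero (D h03').1 (D h12').1) (mul_ne_zero (D h02).1 (D h13).1),
    RatFunc.intDegree_mul (D h03').1 (D h12').1, RatFunc.intDegree_mul (D h02).1 (D h13).1,
    (D h02').2, (D h13').2, (D h03).2, (D h12).2, (D h03').2, (D h12').2, (D h02).2,
    (D h13).2] at h
  linarith

/-- Finitely many generic conditions on the roots hold simultaneously. -/
theorem exists_generic_family (hr : r ≠ 0) (hm : m ≠ 0) {ε : k} (hε : ε ^ m = (-1) ^ r)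
    {K : Type*} [Field K] [Algebra k K] (a₀ : Fin l → Fin (r - 1) → Kˣ) {ι : Type*} [Fintype ι]
    (Q : ι → MvPolynomial (Fin l × Option (Fin (r - 1))) k) :
    ∃ P : MvPolynomial (Fin l × Fin (r - 1)) k, P ≠ 0 ∧ ∀ a : Fin l → Fin (r - 1) → kˣ,
      MvPolynomial.eval (fun ij => coef m ε a ij.1 ij.2) P ≠ 0 →
        ∀ t, MvPolynomial.aeval (root ε a) (Q t) = 0 →
          MvPolynomial.aeval (root ε a₀) (Q t) = 0 := by
  classical
  -- All polynomials not vanishing at the test family are multiplied together, so one hypersurface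
  -- serves for them all.
  obtain ⟨P, hP, h⟩ := exists_generic hr hm hε a₀
    (∏ t, if MvPolynomial.aeval (root ε a₀) (Q t) = 0 then 1 else Q t) (by
      rw [map_prod, Finset.prod_ne_zero_iff]
      intro t _
      split_ifs with h
      · simp
      · exact h)
  refine ⟨P, hP, fun a ha t ht => ?_⟩
  by_contra h0
  apply h a ha
  rw [map_prod]
  exact Finset.prod_eq_zero (Finset.mem_univ t) (by rw [if_neg h0, ht])

/-- For generic coefficients, the squares of the roots of the forms `h_i` are distinct, and
quadruples of points with the same cross-ratio have a matching combinatorial type. -/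
theorem exists_generic_levels (hr : 2 ≤ r) (ω : k) {ε : k} (hm : m ≠ 0)
    (hε : ε ^ m = (-1) ^ r) :
    ∃ P : MvPolynomial (Fin l × Fin (r - 1)) k, P ≠ 0 ∧ ∀ a : Fin l → Fin (r - 1) → kˣ,
      MvPolynomial.eval (fun ij => coef m ε a ij.1 ij.2) P ≠ 0 →
        (Function.Injective fun p => (root ε a p ^ m) ^ 2) ∧
        ∀ t : Fin 4 → ((Fin l × Option (Fin (r - 1))) × Fin m) ×
            ((Fin l × Option (Fin (r - 1))) × Fin m),
          crossDiff (point ω ε a) t = 0 →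
            crossDiff (point ω ε (levelUnit k r l)) t = 0 := by
  have hε0 : ε ≠ 0 := by
    rintro rfl
    rw [zero_pow hm] at hε
    exact pow_ne_zero r (neg_ne_zero.2 one_ne_zero) hε.symm
  obtain ⟨P₁, hP₁, h₁⟩ := exists_generic_family (l := l) (by omega) hm hε (levelUnit k r l)
    (crossPoly (m := m) ω)
  -- On the test family these squares have degrees 2m times the levels, so they are distinct.
  obtain ⟨P₂, hP₂, h₂⟩ := exists_generic_family (l := l) (by omega) hm hε (levelUnit k r l)
    fun p : (Fin l × Option (Fin (r - 1))) × (Fin l × Option (Fin (r - 1))) =>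
      (MvPolynomial.X p.1 ^ m) ^ 2 - (MvPolynomial.X p.2 ^ m) ^ 2
  refine ⟨P₁ * P₂, mul_ne_zero hP₁ hP₂, fun a ha => ?_⟩
  rw [map_mul] at ha
  refine ⟨fun p q hpq => ?_, fun t ht => ?_⟩
  · have h := h₂ a (right_ne_zero_of_mul ha) (p, q) (by
      simpa [sub_eq_zero] using hpq)
    simp only [map_sub, map_pow, MvPolynomial.aeval_X, sub_eq_zero] at h
    have h := congrArg RatFunc.intDegree h
    have hd := intDegree_root_levelUnit (r := r) (l := l) hε0
    have h0 := root_ne_zero hε0 (levelUnit k r l)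
    rw [intDegree_pow (pow_ne_zero _ (h0 _)), intDegree_pow (pow_ne_zero _ (h0 _)),
      intDegree_pow (h0 _), intDegree_pow (h0 _), hd, hd] at h
    have hm' : (m : ℤ) ≠ 0 := by exact_mod_cast hm
    exact level_injective hr (mul_left_cancel₀ hm' (mul_left_cancel₀ (by norm_num) h))
  · have h := h₁ a (left_ne_zero_of_mul ha) t
    rw [aeval_crossPoly, aeval_crossPoly] at h
    exact h ht

end Degeneration

end Superelliptic
end

/-! ### Möbius transformations permuting the roots of f. -/

noncomputable section

namespace Superelliptic

open Polynomial

section Stabilizer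

variable {k : Type*} [Field k] {r l m : ℕ}

theorem coeff_linear_pow_pred (hm : m ≠ 0) (α β : k) :
    ((C α * X + C β) ^ m).coeff (m - 1) = m * (α ^ (m - 1) * β) := by
  rw [add_pow, finsetSum_coeff, Finset.sum_eq_single (m - 1)]
  · rw [mul_pow, ← C_pow, ← C_pow, ← C_eq_natCast, mul_assoc, mul_assoc, coeff_C_mul, ← C_mul,
      coeff_mul_C, coeff_X_pow, if_pos rfl]
    obtain ⟨n, rfl⟩ := Nat.exists_eq_succ_of_ne_zero hm
    simp
    ring
  · intro n _ hn
    rw [mul_pow, ← C_pow, ← C_pow, ← C_eq_natCast, mul_assoc, mul_assoc, coeff_C_mul, ← C_mul,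
      coeff_mul_C, coeff_X_pow, if_neg hn.symm]
    simp
  · intro h
    exact absurd (Finset.mem_range.2 (by omega)) h

theorem natDegree_linear_pow_le (α β : k) : ((C α * X + C β) ^ m).natDegree ≤ m :=
  natDegree_pow_le.trans (by
    simpa using Nat.mul_le_mul_left m (natDegree_linear_le (a := α) (b := β)))

/-- The polynomial (αX+β)^m - z(γX+η)^m has degree at most m and vanishes at the m roots of X^m - z,
so it is a constant multiple of it. For m ≥ 2 its coefficient at X^(m-1) is therefore 0. -/
theorem pow_mul_eq_of_forall_root (hm : 2 ≤ m) (hmk : (m : k) ≠ 0) {ω : k}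
    (hω : IsPrimitiveRoot ω m) {b z α β γ η : k} (hb : b ≠ 0) (hz : b ^ m = z)
    (h : ∀ s < m, (α * (ω ^ s * b) + β) ^ m = z * (γ * (ω ^ s * b) + η) ^ m) :
    α ^ (m - 1) * β = z * (γ ^ (m - 1) * η) := by
  obtain ⟨g, hgdef⟩ : ∃ g : k[X], g = (C α * X + C β) ^ m - C z * (C γ * X + C η) ^ m := ⟨_, rfl⟩
  have hg : g.natDegree ≤ m := by
    rw [hgdef]
    exact (natDegree_sub_le _ _).trans (max_le (natDegree_linear_pow_le _ _)
      ((natDegree_C_mul_le _ _).trans (natDegree_linear_pow_le _ _)))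
  have hqdeg : (g - C (g.coeff m) * (X ^ m - C z)).degree < (m : WithBot ℕ) := by
    rw [degree_lt_iff_coeff_zero]
    intro n hn
    rw [coeff_sub, coeff_C_mul, coeff_sub, coeff_X_pow, coeff_C]
    rcases hn.eq_or_lt with rfl | hn
    · rw [if_pos rfl, if_neg (by omega)]
      ring
    · rw [if_neg (by omega), if_neg (by omega), coeff_eq_zero_of_natDegree_lt (by omega)]
      ring
  have hinj : Set.InjOn (fun s => ω ^ s * b) (Finset.range m) := by
    intro s hs t ht hst
    simp only [Finset.coe_range, Set.mem_Iio] at hs ht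
    exact hω.pow_inj hs ht (mul_right_cancel₀ hb hst)
  have hq : g - C (g.coeff m) * (X ^ m - C z) = 0 := by
    refine eq_zero_of_degree_lt_of_eval_index_eq_zero (s := Finset.range m) hinj
      (by rwa [Finset.card_range]) fun s hs => ?_
    have h1 := h s (Finset.mem_range.1 hs)
    have h2 : (ω ^ s * b) ^ m = z := by
      rw [mul_pow, pow_right_comm, hω.pow_eq_one, one_pow, one_mul, hz]
    simp only [hgdef, eval_sub, eval_mul, eval_pow, eval_add, eval_C, eval_X, h1, h2]
    ring
  have hc : (g - C (g.coeff m) * (X ^ m - C z)).coeff (m - 1) = 0 := by rw [hq, coeff_zero]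
  rw [coeff_sub, coeff_C_mul, coeff_sub, coeff_X_pow, coeff_C, if_neg (by omega),
    if_neg (by omega), sub_zero, mul_zero, sub_zero, hgdef, coeff_sub, coeff_C_mul,
    coeff_linear_pow_pred (by omega),
    coeff_linear_pow_pred (by omega)] at hc
  apply mul_left_cancel₀ hmk
  linear_combination hc

/-- A Möbius transformation that preserves the fibres of `w ↦ w^m` over two points whose squares
are distinct is multiplication by an `m`-th root of unity. -/
theorem moebius_eq_scale (hm : 2 ≤ m) (hmk : (m : k) ≠ 0) {ω : k}
    (hω : IsPrimitiveRoot ω m) {b b' α β γ η : k} (hb : b ≠ 0) (hb' : b' ≠ 0)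
    (hbb' : (b ^ m) ^ 2 ≠ (b' ^ m) ^ 2) (hdet : α * η - β * γ ≠ 0)
    (h : ∀ s < m, (α * (ω ^ s * b) + β) ^ m = b ^ m * (γ * (ω ^ s * b) + η) ^ m)
    (h' : ∀ s < m, (α * (ω ^ s * b') + β) ^ m = b' ^ m * (γ * (ω ^ s * b') + η) ^ m) :
    β = 0 ∧ γ = 0 ∧ α ^ m = η ^ m := by
  have e := pow_mul_eq_of_forall_root hm hmk hω hb rfl h
  have e' := pow_mul_eq_of_forall_root hm hmk hω hb' rfl h'
  have hz : b ^ m - b' ^ m ≠ 0 := by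
    intro h0
    rw [sub_eq_zero.1 h0] at hbb'
    exact hbb' rfl
  -- The same relation holds with two different values of z, so both of its sides vanish.
  have hγη : γ ^ (m - 1) * η = 0 := by
    refine (mul_eq_zero.1 (?_ : (b ^ m - b' ^ m) * _ = 0)).resolve_left hz
    linear_combination e' - e
  have hαβ : α ^ (m - 1) * β = 0 := by rw [e, hγη, mul_zero]
  have hm1 : m - 1 ≠ 0 := by omega
  have f := h 0 (by omega)
  have f' := h' 0 (by omega)
  rw [pow_zero, one_mul] at f f'
  rw [mul_eq_zero, pow_eq_zero_iff hm1] at hγη hαβ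
  rcases hγη with rfl | rfl
  · rcases hαβ with rfl | rfl
    · simp at hdet
    · refine ⟨rfl, rfl, ?_⟩
      rw [add_zero, zero_mul, zero_add, mul_pow, mul_comm] at f
      exact mul_left_cancel₀ (pow_ne_zero m hb) f
  · rcases hαβ with rfl | rfl
    · exfalso
      have hγ : γ ^ m ≠ 0 := pow_ne_zero _ (by rintro rfl; simp at hdet)
      rw [zero_mul, zero_add, add_zero, mul_pow] at f f'
      -- The case α = η = 0, x ↦ β/(γx), would give (b^m)^2 = β^m/γ^m for both b and b'; this is why
      -- the squares must differ.
      apply hbb'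
      apply mul_left_cancel₀ hγ
      linear_combination f' - f
    · simp at hdet

/-- For r = 2 each form has two roots, with product 1 and opposite levels, and injectivity of the
levels identifies the partner. -/
theorem root_pow_mul_root_pow {l : ℕ} {S : Type*} [CommRing S] [Algebra k S] {ε : k}
    (hε : ε ^ m = (-1) ^ 2) (a : Fin l → Fin (2 - 1) → Sˣ) {p p' : Fin l × Option (Fin (2 - 1))}
    (h : level 2 l p' = -level 2 l p) : root ε a p' ^ m * root ε a p ^ m = 1 := by
  have hP : ∀ i, root ε a (i, none) ^ m * root ε a (i, some (0 : Fin 1)) ^ m = 1 := by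
    intro i
    have h := prod_root_pow hε a i
    rw [Fintype.prod_option, show ∏ j : Fin (2 - 1), root ε a (i, some j) ^ m =
      root ε a (i, some (0 : Fin 1)) ^ m from Fin.prod_univ_one _] at h
    rw [h]
    simp
  have hL : ∀ i, level 2 l (i, none) = -level 2 l (i, some (0 : Fin 1)) := by
    intro i
    rw [level_none]
    exact congrArg _ (Fin.sum_univ_one _)
  obtain ⟨i, _ | j⟩ := p
  · rw [hL, neg_neg] at h
    rw [level_injective le_rfl h, mul_comm]
    exact hP i
  · have hj : j = (0 : Fin 1) := Subsingleton.elim (α := Fin 1) _ _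
    rw [hj, ← hL] at h
    rw [level_injective le_rfl h, hj]
    exact hP i

/-- The stabilizer of a generic family of points in the group of Möbius transformations. -/
theorem moebius_stabilizer (hr : 2 ≤ r) (hl : 1 ≤ l) (hm : 2 ≤ m) (hmk : (m : k) ≠ 0) {ω ε : k}
    (hω : IsPrimitiveRoot ω m) (hε : ε ^ m = (-1) ^ r) (a : Fin l → Fin (r - 1) → kˣ)
    (hz : Function.Injective fun p => (root ε a p ^ m) ^ 2)
    (hcross : ∀ t : Fin 4 → ((Fin l × Option (Fin (r - 1))) × Fin m) ×
      ((Fin l × Option (Fin (r - 1))) × Fin m), crossDiff (point ω ε a) t = 0 →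
        crossDiff (point ω ε (levelUnit k r l)) t = 0)
    {α β γ η : k} (hdet : α * η - β * γ ≠ 0)
    (hpt : ∀ p : (Fin l × Option (Fin (r - 1))) × Fin m, γ * point ω ε a p + η ≠ 0 ∧
      ∃ p' : (Fin l × Option (Fin (r - 1))) × Fin m,
      point ω ε a p' = (α * point ω ε a p + β) / (γ * point ω ε a p + η)) :
    (β = 0 ∧ γ = 0 ∧ α ^ m = η ^ m) ∨ (r = 2 ∧ α = 0 ∧ η = 0 ∧ β ^ m = γ ^ m) := by
  have hm0 : m ≠ 0 := by omega
  have hε0 : ε ≠ 0 := by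
    rintro rfl
    rw [zero_pow hm0] at hε
    exact pow_ne_zero r (neg_ne_zero.2 one_ne_zero) hε.symm
  have hroot := root_ne_zero hε0 a
  have hden := fun p => (hpt p).1
  choose π hπ using fun p => (hpt p).2
  have hinj : Function.Injective (point (m := m) ω ε a) := by
    intro p q h
    have h1 : p.1 = q.1 := hz (by
      simp only [← point_pow hω.pow_eq_one, h])
    have h2 : (p.2 : ℕ) = q.2 := by
      rw [point, point, h1] at h
      exact hω.pow_inj p.2.2 q.2.2 (mul_right_cancel₀ (hroot q.1) h)
    exact Prod.ext h1 (Fin.ext h2)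
  have hπinj : Function.Injective π := by
    intro p q h
    have h1 := hπ p
    rw [h, hπ q, div_eq_div_iff (hden q) (hden p)] at h1
    apply hinj
    apply mul_left_cancel₀ hdet
    linear_combination -h1
  have hne : (Finset.univ : Finset (Fin l × Option (Fin (r - 1)))).Nonempty :=
    ⟨(⟨0, by omega⟩, none), Finset.mem_univ _⟩
  obtain ⟨ph, -, hph⟩ := Finset.exists_max_image Finset.univ (level r l) hne
  obtain ⟨pl, -, hpl⟩ := Finset.exists_min_image Finset.univ (level r l) hne
  have hlt : level r l pl < level r l ph :=
    ((hpl (⟨0, by omega⟩, none) (Finset.mem_univ _)).trans_lt (level_none_neg hr _)).trans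
      ((level_some_pos ⟨0, by omega⟩ ⟨0, by omega⟩).trans_le
        (hph (⟨0, by omega⟩, some ⟨0, by omega⟩) (Finset.mem_univ _)))
  have h01 : (⟨0, by omega⟩ : Fin m) ≠ ⟨1, by omega⟩ := by simp
  -- Each level carries m ≥ 2 points, which supplies the two leaves at either end of the spine.
  have hlevel := eq_or_eq_reflect (e := fun p => level r l p.1) (π := π) hlt
    (fun p => hpl p.1 (Finset.mem_univ _)) (fun p => hph p.1 (Finset.mem_univ _))
    (b₁ := (ph, ⟨0, by omega⟩)) (b₂ := (ph, ⟨1, by omega⟩))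
    (t₁ := (pl, ⟨0, by omega⟩)) (t₂ := (pl, ⟨1, by omega⟩))
    (fun h => h01 (congrArg Prod.snd h)) (fun h => h01 (congrArg Prod.snd h)) rfl rfl rfl rfl
    (fun p q s u hps hqu hpu hqs => level_add_eq_of_crossDiff_eq_zero hr hω hε0
      (t := fun j => (![p, q, s, u] j, π (![p, q, s, u] j)))
      (hcross _ (crossDiff_moebius _ π hden hπ _)) hps hqu hpu hqs
      (hπinj.ne hps) (hπinj.ne hqu) (hπinj.ne hpu) (hπinj.ne hqs))
  have hzne : (root ε a ph ^ m) ^ 2 ≠ (root ε a pl ^ m) ^ 2 := hz.ne (by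
    rintro rfl
    exact lt_irrefl _ hlt)
  rcases hlevel with hlevel | hlevel
  · left
    have h : ∀ (p) (s : ℕ), s < m → (α * (ω ^ s * root ε a p) + β) ^ m =
        root ε a p ^ m * (γ * (ω ^ s * root ε a p) + η) ^ m := by
      intro p s hs
      have h1 : (π (p, ⟨s, hs⟩)).1 = p := level_injective hr (hlevel _)
      have h2 := point_pow (ε := ε) hω.pow_eq_one a (π (p, ⟨s, hs⟩))
      rw [hπ, h1, div_pow, div_eq_iff (pow_ne_zero _ (hden _))] at h2
      exact h2
    exact moebius_eq_scale hm hmk hω (hroot ph) (hroot pl) hzne hdet (h ph) (h pl)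
  · right
    obtain ⟨rfl, hc⟩ := eq_zero_of_level_reflect (c := level r l ph + level r l pl) hr hl
      fun p => ⟨(π (p, ⟨0, by omega⟩)).1, hlevel _⟩
    -- The transformation sends the fibre over z to the fibre over 1/z, so its reciprocal, with the
    -- rows of the matrix interchanged, preserves fibres.
    have h : ∀ (p) (s : ℕ), s < m → (γ * (ω ^ s * root ε a p) + η) ^ m =
        root ε a p ^ m * (α * (ω ^ s * root ε a p) + β) ^ m := by
      intro p s hs
      have h1 : level 2 l (π (p, ⟨s, hs⟩)).1 = -level 2 l p := by
        have h0 := hlevel (p, ⟨s, hs⟩)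
        simp only [hc, zero_sub] at h0
        exact h0
      have h2 := point_pow (ε := ε) hω.pow_eq_one a (π (p, ⟨s, hs⟩))
      have h3 := root_pow_mul_root_pow hε a h1
      rw [hπ, div_pow, div_eq_iff (pow_ne_zero _ (hden _))] at h2
      change (α * (ω ^ s * root ε a p) + β) ^ m = _ * (γ * (ω ^ s * root ε a p) + η) ^ m at h2
      linear_combination (-root ε a p ^ m) * h2 -
        (γ * (ω ^ s * root ε a p) + η) ^ m * h3
    obtain ⟨h1, h2, h3⟩ := moebius_eq_scale hm hmk hω (hroot ph) (hroot pl) hzne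
      (show γ * β - η * α ≠ 0 from fun h0 => hdet (by linear_combination -h0)) (h ph) (h pl)
    exact ⟨rfl, h2, h1, h3.symm⟩

end Stabilizer

end Superelliptic
end

/-! ### Explicit automorphisms and the two reduced groups. -/

noncomputable section

namespace Superelliptic

open Polynomial

variable {k : Type*} [Field k] {r l m d : ℕ} {ζ : k} {f : k[X]}

section Groups

theorem transcendental_algebraMap_mul {E : Type*} [Field E] [Algebra k E] {u : k} (hu : u ≠ 0)
    {x : E} (hx : Transcendental k x) : Transcendental k (algebraMap k E u * x) := by
  intro h
  apply hx
  have h1 := (isAlgebraic_algebraMap (A := E) u⁻¹).mul h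
  rwa [← mul_assoc, ← map_mul, inv_mul_cancel₀ hu, map_one, one_mul] at h1

theorem exists_rootsOfUnity_hom [NeZero m] {ω : k} (hω : IsPrimitiveRoot ω m) :
    ∃ χ : Multiplicative (ZMod m) →* kˣ, Function.Injective χ ∧
      (∀ i, ((χ i : kˣ) : k) ^ m = 1) ∧ ∀ u : k, u ^ m = 1 → ∃ i, ((χ i : kˣ) : k) = u := by
  obtain ⟨w, rfl⟩ := hω.isUnit (NeZero.ne m)
  have hw : IsPrimitiveRoot w m := IsPrimitiveRoot.coe_units_iff.1 hω
  let e : Multiplicative (ZMod m) ≃* Subgroup.zpowers w :=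
    AddEquiv.toMultiplicativeLeft hw.zmodEquivZPowers
  refine ⟨(Subgroup.zpowers w).subtype.comp e.toMonoidHom,
    (Subgroup.subtype_injective _).comp e.injective, fun i => ?_, fun u hu => ?_⟩
  · obtain ⟨n, hn⟩ := Subgroup.mem_zpowers_iff.1 (e i).2
    change (((e i : Subgroup.zpowers w) : kˣ) : k) ^ m = 1
    rw [← hn, ← Units.val_pow_eq_pow_val, ← zpow_natCast, zpow_comm, zpow_natCast, hw.pow_eq_one,
      one_zpow, Units.val_one]
  · obtain ⟨n, -, hn⟩ := hω.eq_pow_of_pow_eq_one hu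
    refine ⟨e.symm ⟨w ^ n, Subgroup.npow_mem_zpowers w n⟩, ?_⟩
    change ((e (e.symm _) : kˣ) : k) = u
    rw [e.apply_symm_apply, ← hn]
    simp

variable [Fact (Irreducible (equation r f))]

/-- The automorphism `(x, y) ↦ (u x, y)`. -/
def scaleX (u : kˣ) (hu : aeval (algebraMap k _ (u : k) * xCoord r f) f = aeval (xCoord r f) f) :
    FunctionField r f →ₐ[k] FunctionField r f :=
  liftHom (algebraMap k _ (u : k) * xCoord r f) (yCoord r f)
    (transcendental_algebraMap_mul u.ne_zero transcendental_xCoord)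
    (by rw [hu, yCoord_pow_eq_aeval])

/-- The automorphism `(x, y) ↦ (u / x, y / x^d)` of a hyperelliptic curve. -/
def invertX (d : ℕ) (u : kˣ)
    (hu : aeval (algebraMap k _ (u : k) * (xCoord r f)⁻¹) f * (xCoord r f ^ d) ^ r =
      aeval (xCoord r f) f) :
    FunctionField r f →ₐ[k] FunctionField r f :=
  liftHom (algebraMap k _ (u : k) * (xCoord r f)⁻¹) (yCoord r f * (xCoord r f ^ d)⁻¹)
    (transcendental_algebraMap_mul u.ne_zero (transcendental_inv transcendental_xCoord))
    (by
      have hx : (xCoord r f ^ d) ^ r ≠ 0 := pow_ne_zero _ (pow_ne_zero _ xCoord_ne_zero)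
      rw [mul_pow, yCoord_pow_eq_aeval, ← hu, inv_pow, mul_assoc, mul_inv_cancel₀ hx, mul_one])

theorem reducedAutIso_zmod [PerfectField k] [NeZero m] (h : IsAdmissible r d ζ f)
    (hrd : ¬(r = 2 ∧ d = 2)) {ω : k} (hω : IsPrimitiveRoot ω m)
    (hper : ∀ u : k, u ^ m = 1 → ∀ z : FunctionField r f,
      aeval (algebraMap k _ u * z) f = aeval z f)
    (hstab : ∀ σ : AutGroup r f, ∃ u : k, u ^ m = 1 ∧
      σ (xCoord r f) = algebraMap k _ u * xCoord r f) :
    ReducedAutIso r f (Multiplicative (ZMod m)) := by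
  obtain ⟨χ, hχ, hχm, hχs⟩ := exists_rootsOfUnity_hom hω
  have hx0 : xCoord r f ≠ 0 := xCoord_ne_zero
  let g := fun i => scaleX (χ i) (hper _ (hχm i) (xCoord r f))
  have gx : ∀ i, g i (xCoord r f) = algebraMap k _ (χ i : k) * xCoord r f := fun i =>
    liftHom_xCoord _ _
  have gy : ∀ i, g i (yCoord r f) = yCoord r f := fun i => liftHom_yCoord _ _
  have gc : ∀ i (u : k) z, g i (algebraMap k _ u * z) = algebraMap k _ u * g i z := fun i u z =>
    (map_mul (g i) _ _).trans (congrArg (· * g i z) (AlgHom.commutes _ _))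
  let ψ : Multiplicative (ZMod m) →* (FunctionField r f →ₐ[k] FunctionField r f) :=
    { toFun := g
      map_one' := by
        refine algHom_ext h.ne_zero ?_ ?_
        · rw [gx, map_one, Units.val_one, map_one, one_mul, AlgHom.one_apply]
        · rw [gy, AlgHom.one_apply]
      map_mul' := fun i j => by
        refine algHom_ext h.ne_zero ?_ ?_
        · rw [AlgHom.mul_apply, gx, gx, gc, gx, map_mul, Units.val_mul, map_mul]
          ring
        · rw [AlgHom.mul_apply, gy, gy, gy] }
  refine reducedAutIso_of_monoidHom h hrd ψ (fun i hi => ?_) fun σ => ?_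
  · have h1 : g i (xCoord r f) = xCoord r f := hi
    rw [gx, mul_eq_right₀ hx0, ← map_one (algebraMap k (FunctionField r f))] at h1
    have h2 : χ i = 1 := Units.ext ((algebraMap k (FunctionField r f)).injective h1)
    rwa [map_eq_one_iff χ hχ] at h2
  · obtain ⟨u, hu, hσ⟩ := hstab σ
    obtain ⟨i, rfl⟩ := hχs u hu
    exact ⟨i, by rw [hσ]; exact gx i⟩

theorem reducedAutIso_dihedralGroup [PerfectField k] [NeZero m] (h : IsAdmissible r d ζ f)
    (hrd : ¬(r = 2 ∧ d = 2)) {ω : k} (hω : IsPrimitiveRoot ω m) (hmd : m ∣ d)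
    (hper : ∀ u : k, u ^ m = 1 → ∀ z : FunctionField r f,
      aeval (algebraMap k _ u * z) f = aeval z f)
    (hpal : ∀ z : FunctionField r f, z ≠ 0 → aeval z⁻¹ f * (z ^ d) ^ r = aeval z f)
    (hstab : ∀ σ : AutGroup r f, ∃ u : k, u ^ m = 1 ∧
      (σ (xCoord r f) = algebraMap k _ u * xCoord r f ∨
        σ (xCoord r f) = algebraMap k _ u * (xCoord r f)⁻¹)) :
    ReducedAutIso r f (DihedralGroup m) := by
  obtain ⟨χ, hχ, hχm, hχs⟩ := exists_rootsOfUnity_hom hω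
  have hx0 : xCoord r f ≠ 0 := xCoord_ne_zero
  let c : ZMod m → FunctionField r f := fun i => algebraMap k _ (χ (Multiplicative.ofAdd i) : k)
  have c0 : ∀ i, c i ≠ 0 := fun i => by simp [c]
  have cadd : ∀ i j, c (i + j) = c i * c j := fun i j => by simp [c]
  have czero : c 0 = 1 := by simp [c]
  have csub : ∀ i j, c (i - j) = c i * (c j)⁻¹ := fun i j => by
    rw [← div_eq_mul_inv, eq_div_iff (c0 j), ← cadd, sub_add_cancel]
  -- As m divides d, the factors (u x)^d and x^d agree, so the dihedral relations hold on y as well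
  -- as on x and the map to endomorphisms is multiplicative.
  have cd : ∀ i, c i ^ d = 1 := by
    intro i
    obtain ⟨t, rfl⟩ := hmd
    simp only [c]
    rw [← map_pow, pow_mul, hχm, one_pow, map_one]
  have cinj : ∀ i, c i = 1 → i = 0 := by
    intro i hi
    rw [← map_one (algebraMap k (FunctionField r f))] at hi
    have h2 : χ (Multiplicative.ofAdd i) = 1 :=
      Units.ext ((algebraMap k (FunctionField r f)).injective hi)
    rwa [map_eq_one_iff χ hχ] at h2
  let g : DihedralGroup m → (FunctionField r f →ₐ[k] FunctionField r f)
    | .r i => scaleX (χ (Multiplicative.ofAdd i)) (hper _ (hχm _) (xCoord r f))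
    | .sr i => invertX d (χ (Multiplicative.ofAdd i))
        (by rw [hper _ (hχm _), hpal _ hx0])
  have gc : ∀ q i z, g q (c i * z) = c i * g q z := fun q i z =>
    (map_mul (g q) _ _).trans (congrArg (· * g q z) (AlgHom.commutes _ _))
  have rx : ∀ i, g (.r i) (xCoord r f) = c i * xCoord r f := fun i => liftHom_xCoord _ _
  have ry : ∀ i, g (.r i) (yCoord r f) = yCoord r f := fun i => liftHom_yCoord _ _
  have sx : ∀ i, g (.sr i) (xCoord r f) = c i * (xCoord r f)⁻¹ := fun i => liftHom_xCoord _ _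
  have sy : ∀ i, g (.sr i) (yCoord r f) = yCoord r f * (xCoord r f ^ d)⁻¹ :=
    fun i => liftHom_yCoord _ _
  have hc : ∀ i, c i = algebraMap k _ (χ (Multiplicative.ofAdd i) : k) := fun _ => rfl
  clear_value g c
  let ψ : DihedralGroup m →* (FunctionField r f →ₐ[k] FunctionField r f) :=
    { toFun := g
      map_one' := by
        rw [DihedralGroup.one_def]
        refine algHom_ext h.ne_zero ?_ ?_
        · rw [rx, czero, one_mul, AlgHom.one_apply]
        · rw [ry, AlgHom.one_apply]
      map_mul' := by
        rintro (i | i) (j | j)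
        · rw [DihedralGroup.r_mul_r]
          refine algHom_ext h.ne_zero ?_ ?_
          · rw [AlgHom.mul_apply, rx, rx, gc, rx, cadd]
            ring
          · rw [AlgHom.mul_apply, ry, ry, ry]
        · rw [DihedralGroup.r_mul_sr]
          refine algHom_ext h.ne_zero ?_ ?_
          · rw [AlgHom.mul_apply, sx, sx, gc, map_inv₀, rx, csub, mul_inv]
            ring
          · rw [AlgHom.mul_apply, sy, sy, map_mul, map_inv₀, map_pow, ry, rx, mul_pow, cd, one_mul]
        · rw [DihedralGroup.sr_mul_r]
          refine algHom_ext h.ne_zero ?_ ?_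
          · rw [AlgHom.mul_apply, rx, sx, gc, sx, cadd]
            ring
          · rw [AlgHom.mul_apply, ry, sy, sy]
        · rw [DihedralGroup.sr_mul_sr]
          refine algHom_ext h.ne_zero ?_ ?_
          · rw [AlgHom.mul_apply, sx, rx, gc, map_inv₀, sx, csub, mul_inv, inv_inv]
            ring
          · rw [AlgHom.mul_apply, sy, ry, map_mul, map_inv₀, map_pow, sy, sx, mul_pow, cd, one_mul,
              inv_pow, inv_inv, mul_assoc, inv_mul_cancel₀ (pow_ne_zero _ hx0), mul_one] }
  refine reducedAutIso_of_monoidHom h hrd ψ (fun q hq => ?_) fun σ => ?_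
  · obtain i | i := q
    · have h1 : g (.r i) (xCoord r f) = xCoord r f := hq
      rw [rx, mul_eq_right₀ hx0] at h1
      rw [cinj i h1, DihedralGroup.one_def]
    · exfalso
      have h1 : g (.sr i) (xCoord r f) = xCoord r f := hq
      rw [sx, mul_inv_eq_iff_eq_mul₀ hx0] at h1
      -- u / x = x would give x^2 = u, making x algebraic.
      refine transcendental_xCoord (r := r) (f := f) ⟨X ^ 2 - C (χ (Multiplicative.ofAdd i) : k),
        X_pow_sub_C_ne_zero two_pos _, ?_⟩
      rw [map_sub, map_pow, aeval_X, aeval_C, pow_two, ← h1, hc, sub_self]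
  · obtain ⟨u, hu, hσ⟩ := hstab σ
    obtain ⟨i, rfl⟩ := hχs u hu
    rcases hσ with hσ | hσ
    · exact ⟨.r (Multiplicative.toAdd i), by rw [hσ]; exact (rx _).trans (by rw [hc]; rfl)⟩
    · exact ⟨.sr (Multiplicative.toAdd i), by rw [hσ]; exact (sx _).trans (by rw [hc]; rfl)⟩

end Groups

section Rhs

theorem aeval_rhs {E : Type*} [CommRing E] [Algebra k E] (c : Fin l → Fin (r - 1) → k) (z : E) :
    aeval z (rhs m c) = ∏ i, form (c i) (z ^ m) 1 := by
  rw [rhs, map_prod]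
  refine Finset.prod_congr rfl fun i _ => ?_
  rw [form_eq_aeval_genPoly, form_eq_aeval_genPoly, ← aeval_algHom_apply, map_pow, aeval_X]

theorem aeval_rhs_mul {E : Type*} [CommRing E] [Algebra k E] (c : Fin l → Fin (r - 1) → k) {u : k}
    (hu : u ^ m = 1) (z : E) : aeval (algebraMap k E u * z) (rhs m c) = aeval z (rhs m c) := by
  rw [aeval_rhs, aeval_rhs, mul_pow, ← map_pow, hu, map_one, one_mul]

/-- For r = 2 the form w^2 + c w + 1 is palindromic; this is the source of the extra involution x ↦
1/x. -/
theorem form_inv {E : Type*} [Field E] [Algebra k E] (c : Fin (2 - 1) → k) {w : E} (hw : w ≠ 0) :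
    form c w⁻¹ 1 * w ^ 2 = form c w 1 := by
  have h : ∀ w : E, form c w 1 = w ^ 2 + c (0 : Fin 1) • w + 1 := by
    intro w
    rw [form, show ∑ j : Fin (2 - 1), c j • (w ^ (2 - 1 - (j : ℕ)) * (1 : E) ^ ((j : ℕ) + 1)) =
      c (0 : Fin 1) • (w ^ 1 * 1 ^ 1) from Fin.sum_univ_one _]
    simp
  rw [h, h, Algebra.smul_def, Algebra.smul_def]
  field_simp
  ring

theorem aeval_inv_rhs {E : Type*} [Field E] [Algebra k E] (c : Fin l → Fin (2 - 1) → k) {z : E}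
    (hz : z ≠ 0) : aeval z⁻¹ (rhs m c) * (z ^ (l * m)) ^ 2 = aeval z (rhs m c) := by
  have h : (z ^ (l * m)) ^ 2 = ∏ _i : Fin l, (z ^ m) ^ 2 := by
    rw [Finset.prod_const, Finset.card_univ, Fintype.card_fin]
    ring
  rw [aeval_rhs, aeval_rhs, h, ← Finset.prod_mul_distrib]
  refine Finset.prod_congr rfl fun i _ => ?_
  rw [inv_pow, form_inv _ (pow_ne_zero _ hz)]

theorem rhs_coef (hr : r ≠ 0) {ε : k} (hε : ε ^ m = (-1) ^ r) (a : Fin l → Fin (r - 1) → kˣ) :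
    rhs m (coef m ε a) = ∏ p, (X ^ m - C (root ε a p ^ m)) := by
  rw [rhs, Fintype.prod_prod_type]
  refine Finset.prod_congr rfl fun i _ => ?_
  rw [form_eq_aeval_genPoly, ← rootPoly_eq_genPoly hr hε, rootPoly, map_prod]
  refine Finset.prod_congr rfl fun j _ => ?_
  rw [map_sub, aeval_X, aeval_C]
  rfl

theorem isAdmissible_rhs (hr : 2 ≤ r) (hl : 1 ≤ l) (hm : 2 ≤ m) (hrk : (r : k) ≠ 0)
    (hmk : (m : k) ≠ 0) (hζ : IsPrimitiveRoot ζ r) {ε : k} (hε : ε ^ m = (-1) ^ r)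
    (hε0 : ε ≠ 0) (a : Fin l → Fin (r - 1) → kˣ)
    (hz : Function.Injective fun p => root ε a p ^ m) :
    IsAdmissible r (l * m) ζ (rhs m (coef m ε a)) where
  two_le := hr
  cast_ne_zero := hrk
  isPrimitiveRoot := hζ
  separable := by
    rw [rhs_coef (by omega) hε]
    refine separable_prod (fun p q hpq => ?_) fun p =>
      separable_X_pow_sub_C _ hmk (pow_ne_zero _ (root_ne_zero hε0 a p))
    -- Linear factors with distinct roots are coprime, and substituting X^m for X preserves the
    -- Bézout identity.
    have h := (isCoprime_X_sub_C_of_isUnit_sub (sub_ne_zero.2 (hz.ne hpq)).isUnit).map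
      (expand k m : k[X] →+* k[X])
    simpa using h
  natDegree_eq := by
    rw [rhs_coef (by omega) hε,
      natDegree_prod_of_monic _ _ fun p _ => monic_X_pow_sub_C _ (by omega)]
    simp only [natDegree_X_pow_sub_C]
    rw [Finset.sum_const, Finset.card_univ, Fintype.card_prod, Fintype.card_option,
      Fintype.card_fin, Fintype.card_fin, smul_eq_mul, Nat.sub_add_cancel (by omega)]
    ring
  two_le_natDegree := by nlinarith
  coeff_zero_ne_zero := by
    rw [rhs_coef (by omega) hε, coeff_zero_eq_eval_zero, eval_prod, Finset.prod_ne_zero_iff]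
    intro p _
    rw [eval_sub, eval_pow, eval_X, eval_C, zero_pow (by omega), zero_sub, neg_ne_zero]
    exact pow_ne_zero _ (root_ne_zero hε0 a p)

theorem eval_rhs_eq_zero_iff [NeZero m] (hr : r ≠ 0) {ω ε : k} (hω : IsPrimitiveRoot ω m)
    (hε : ε ^ m = (-1) ^ r) (hε0 : ε ≠ 0) (a : Fin l → Fin (r - 1) → kˣ) (b : k) :
    (rhs m (coef m ε a)).eval b = 0 ↔ ∃ p, point (m := m) ω ε a p = b := by
  rw [rhs_coef hr hε, eval_prod, Finset.prod_eq_zero_iff]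
  simp only [eval_sub, eval_pow, eval_X, eval_C, sub_eq_zero, Finset.mem_univ, true_and]
  constructor
  · rintro ⟨p, hp⟩
    have h0 := root_ne_zero hε0 a p
    obtain ⟨s, hs, h⟩ := hω.eq_pow_of_pow_eq_one (ξ := b / root ε a p)
      (by rw [div_pow, hp, div_self (pow_ne_zero _ h0)])
    refine ⟨(p, ⟨s, hs⟩), ?_⟩
    change ω ^ s * root ε a p = b
    rw [h, div_mul_cancel₀ _ h0]
  · rintro ⟨p, rfl⟩
    exact ⟨p.1, point_pow hω.pow_eq_one a p⟩

/-- For generic coefficients, an automorphism acts on `x` as `x ↦ u x` or, if `r = 2`, as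
`x ↦ u / x`, for an `m`-th root of unity `u`. -/
theorem exists_generic_isAdmissible [IsAlgClosed k] (hr : 2 ≤ r) (hl : 1 ≤ l) (hm : 2 ≤ m)
    (hrk : (r : k) ≠ 0) (hmk : (m : k) ≠ 0) (hgenus : ¬(r = 2 ∧ l = 1 ∧ m = 2))
    (hζ : IsPrimitiveRoot ζ r) {ω : k} (hω : IsPrimitiveRoot ω m) :
    Generically fun c : Fin l → Fin (r - 1) → k =>
      IsAdmissible r (l * m) ζ (rhs m c) ∧ ∀ [Fact (Irreducible (equation r (rhs m c)))]
        (σ : AutGroup r (rhs m c)), ∃ u : k, u ^ m = 1 ∧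
          (σ (xCoord r _) = algebraMap k _ u * xCoord r _ ∨
            r = 2 ∧ σ (xCoord r _) = algebraMap k _ u * (xCoord r _)⁻¹) := by
  have hm0 : m ≠ 0 := by omega
  have : NeZero m := ⟨hm0⟩
  obtain ⟨ε, hε⟩ := IsAlgClosed.exists_pow_nat_eq ((-1 : k) ^ r) (n := m) (by omega)
  have hε0 : ε ≠ 0 := by
    rintro rfl
    rw [zero_pow hm0] at hε
    exact pow_ne_zero r (neg_ne_zero.2 one_ne_zero) hε.symm
  obtain ⟨P, hP, hgen⟩ := exists_generic_levels (l := l) hr ω hm0 hε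
  refine ⟨P, hP, fun c hc => ?_⟩
  obtain ⟨a, rfl⟩ := exists_coef_eq (by omega) hm0 hε c
  obtain ⟨hz, hcross⟩ := hgen a hc
  have h := isAdmissible_rhs hr hl hm hrk hmk hζ hε hε0 a
    fun p q hpq => hz (congrArg (· ^ 2) hpq)
  refine ⟨h, fun σ => ?_⟩
  -- As m ≥ 2, the product l m equals 2 only for l = 1 and m = 2, the excluded curve of genus one.
  have hrd : ¬(r = 2 ∧ l * m = 2) := by
    rintro ⟨h1, h2⟩
    exact hgenus ⟨h1, by nlinarith, by nlinarith⟩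
  obtain ⟨α, β, γ, η, hdet, hσ, hroots⟩ := exists_moebius_roots h hrd σ
  have hx0 : xCoord r (rhs m (coef m ε a)) ≠ 0 := xCoord_ne_zero
  rcases moebius_stabilizer hr hl hm hmk hω hε a hz hcross hdet (fun p => by
    obtain ⟨h1, h2⟩ := hroots (point ω ε a p)
      ((eval_rhs_eq_zero_iff (by omega) hω hε hε0 a _).2 ⟨p, rfl⟩)
    exact ⟨h1, (eval_rhs_eq_zero_iff (by omega) hω hε hε0 a _).1 h2⟩) with
    ⟨rfl, rfl, h3⟩ | ⟨h2, rfl, rfl, h3⟩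
  · have hη : η ≠ 0 := by
      rintro rfl
      simp at hdet
    refine ⟨α / η, by rw [div_pow, h3, div_self (pow_ne_zero _ hη)], Or.inl ?_⟩
    have hη' : algebraMap k (FunctionField r (rhs m (coef m ε a))) η ≠ 0 := by simpa using hη
    rw [map_zero, zero_mul, zero_add, add_zero] at hσ
    rw [map_div₀, eq_div_of_mul_eq hη' hσ]
    ring
  · have hγ : γ ≠ 0 := by
      rintro rfl
      simp at hdet
    refine ⟨β / γ, by rw [div_pow, h3, div_self (pow_ne_zero _ hγ)], Or.inr ⟨h2, ?_⟩⟩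
    have hγ' : algebraMap k (FunctionField r (rhs m (coef m ε a))) γ ≠ 0 := by simpa using hγ
    rw [map_zero, zero_mul, zero_add, add_zero] at hσ
    rw [map_div₀, eq_div_of_mul_eq (mul_ne_zero hγ' hx0) hσ]
    field_simp

end Rhs

end Superelliptic
end

theorem mainTheorem9 {k : Type*} [Field k] [IsAlgClosed k] (r l m : ℕ)
    (hr : 2 ≤ r) (hl : 1 ≤ l) (hm : 2 ≤ m) (hrk : (r : k) ≠ 0) (hmk : (m : k) ≠ 0)
    (hgenus : ¬ (r = 2 ∧ l = 1 ∧ m = 2)) :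
    (r ≠ 2 → Superelliptic.Generically fun c : Fin l → Fin (r - 1) → k =>
      Superelliptic.ReducedAutIso r (Superelliptic.rhs m c) (Multiplicative (ZMod m))) ∧
    (r = 2 → Superelliptic.Generically fun c : Fin l → Fin (r - 1) → k =>
      Superelliptic.ReducedAutIso r (Superelliptic.rhs m c) (DihedralGroup m)) := by
  have : NeZero (r : k) := ⟨hrk⟩
  have : NeZero (m : k) := ⟨hmk⟩
  have : NeZero m := ⟨by omega⟩
  obtain ⟨ζ, hζ⟩ := HasEnoughRootsOfUnity.exists_primitiveRoot k r
  obtain ⟨ω, hω⟩ := HasEnoughRootsOfUnity.exists_primitiveRoot k m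
  have hrd : ¬(r = 2 ∧ l * m = 2) := by
    rintro ⟨h1, h2⟩
    exact hgenus ⟨h1, by nlinarith, by nlinarith⟩
  obtain ⟨P, hP, hgen⟩ :=
    Superelliptic.exists_generic_isAdmissible hr hl hm hrk hmk hgenus hζ hω
  refine ⟨fun hr2 => ⟨P, hP, fun c hc => ?_⟩, fun hr2 => ⟨P, hP, fun c hc => ?_⟩⟩
  · obtain ⟨h, hstab⟩ := hgen c hc
    have : Fact (Irreducible (Superelliptic.equation r (Superelliptic.rhs m c))) := ⟨h.irreducible⟩
    refine Superelliptic.reducedAutIso_zmod h hrd hω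
      (fun u hu z => Superelliptic.aeval_rhs_mul c hu z) fun σ => ?_
    obtain ⟨u, hu, hσ⟩ := hstab σ
    exact ⟨u, hu, hσ.resolve_right fun h0 => hr2 h0.1⟩
  · subst hr2
    obtain ⟨h, hstab⟩ := hgen c hc
    have : Fact (Irreducible (Superelliptic.equation 2 (Superelliptic.rhs m c))) := ⟨h.irreducible⟩
    refine Superelliptic.reducedAutIso_dihedralGroup h hrd hω (Dvd.intro_left _ rfl)
      (fun u hu z => Superelliptic.aeval_rhs_mul c hu z)
      (fun z hz => Superelliptic.aeval_inv_rhs c hz) fun σ => ?_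
    obtain ⟨u, hu, hσ⟩ := hstab σ
    exact ⟨u, hu, hσ.imp_right And.right⟩
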